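/- **Setting.** Let $x(z)=z^3C_{zzz}$ with $C_{zzz}=\frac{5}{(1-5^5z)z^3}$, let $\theta=z\,\partial_z$, and let $\mathcal M=\mathbb P^1\setminus\{0,5^{-5},\infty\}$ be the moduli space of the mirror quintic $Y_z$. Let $\omega_i=\partial_\rho^i\sum_{n\ge0}\frac{(5\rho+1)_{5n}}{((\rho+1)_n)^5}z^{n+\rho}\big|_{\rho=0}$ $(0\le i\le 3)$ and $\mathcal T=60\sum_{n\ge0}\frac{(7/2)_{5n}}{((3/2)_n)^5}z^{n+1/2}$, where $(\alpha)_n=\alpha(\alpha+1)\cdots(\alpha+n-1)$. Work on a connected open set $U\subset\mathcal M$ that meets the slit disc $\{|z|<5^{-5}\}\setminus(-\infty,0]$ and on which single-valued branches of $\omega_i,\mathcal T,\sqrt z$ are given, continuing their principal germs at a point of $U$ in that disc. Put $$e^{-K}=i\int_{Y_z}\Omega\wedge\overline\Omega=-\tfrac53\,\mathrm{Re}(\omega_0\overline{\omega_3})-5\,\mathrm{Re}(\omega_1\overline{\omega_2})+400\,\zeta(3)|\omega_0|^2,$$ $G=\partial_z\partial_{\bar z}K$ and $\Gamma=G^{-1}\partial_zG$,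 and suppose that $e^{-K}>0$ and $G\neq0$ on $U$. On sections of $(T^*)^m\otimes\mathcal L^n$ put $D_z=\partial_z-m\Gamma-n\,\partial_zK$; $\mathcal T$ is a section of $\mathcal L^*=\mathcal L^{-1}$, and $\overline D_{\bar z}\overline{\mathcal T}=(\partial_{\bar z}+\partial_{\bar z}K)\overline{\mathcal T}$. Let $$\triangle_{zz}=D_zD_z\mathcal T-\frac{e^KC_{zzz}}{G}\,\overline D_{\bar z}\overline{\mathcal T},\qquad C_{\bar z}^{zz}=\overline{C_{zzz}}\,e^{2K}G^{-2},\qquad \triangle_{\bar z}^z=\overline{\triangle_{zz}}\,e^KG^{-1}.$$ **Amplitudes.** For $2g-2+h>0$ the amplitude $\mathcal F^{(g,h)}$ is a section of $\mathcal L^{2g-2+h}$; put $\mathcal F^{(g,h)}_0=\mathcal F^{(g,h)}$. In the remaining cases the initial data are $\mathcal F^{(0,0)}_3=C_{zzz}$, $\mathcal F^{(0,1)}_2=\triangle_{zz}$, $$\mathcal F^{(1,0)}_1=\tfrac12\partial_z\log\!\big(e^{\frac{62}{3}K}G^{-1}(1-5^5z)^{-1/6}z^{-31/6}\big),\qquad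 \mathcal F^{(0,2)}_1=\frac{\triangle_{zz}^2}{2C_{zzz}}+\tfrac12\partial_zK+\frac{75}{2(1-5^5z)}.$$ In all cases $\mathcal F^{(g,h)}_{n+1}=D_z\mathcal F^{(g,h)}_n$, where $\mathcal F^{(g,h)}_n$ is a section of $(T^*)^n\otimes\mathcal L^{2g-2+h}$. The extended holomorphic anomaly equation at $(g,h)$ with $2g-2+h>0$ is $$(\ast)_{g,h}\qquad \partial_{\bar z}\mathcal F^{(g,h)}=\tfrac12C_{\bar z}^{zz}\Big(\sum\mathcal F^{(g_1,h_1)}_1\mathcal F^{(g_2,h_2)}_1+\mathcal F^{(g-1,h)}_2\Big)-\triangle_{\bar z}^z\,\mathcal F^{(g,h-1)}_1,$$ the sum over $g_1+g_2=g$, $h_1+h_2=h$ with $(g_i,h_i)\ne(0,0),(0,1)$; the term with $g-1$ (resp. $h-1$) is zero if $g=0$ (resp. $h=0$). Put $P^{(g,h)}_n=x^{g+h-1}z^{n+h/2}\mathcal F^{(g,h)}_n$ if $2g-2+h+n>0$, $P^{(g,h)}_n=0$ otherwise, and $P^{(g,h)}=P^{(g,h)}_0$. **Generators.** Let $A_p=\theta^pG/G$,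 $B_p=\theta^pe^{-K}/e^{-K}$, $Q_p=z^{1/2}\theta^p\mathcal T$, $R_1=z^{5/2}\frac{e^KC_{zzz}}{G}\overline D_{\bar z}\overline{\mathcal T}$, $R_2=z^{7/2}e^KC_{zzz}\overline{\mathcal T}$, $V_1=A_1+2B_1+1$, $V_2=B_2-B_1V_1$, $\xi=\frac{\theta x}{x}$, $h(z)=\frac{1-3\cdot5^4z}{1-5^5z}$, $s(z)=\frac{12}{25}-\frac15h(z)+\frac3{25}\xi$, and $$u=B_1,\quad v_1=V_1+\tfrac35,\quad v_2=V_2+\tfrac2{25},\quad v_3=B_3-B_1\big(-V_2+\xi V_1+h(z)-1\big)+s(z),$$ $$m_1=\tfrac2{25}Q_0+\tfrac35Q_1+Q_2-R_1,$$ $$m_2=Q_0\big(s(z)-\tfrac2{25}\xi\big)+Q_1\big(\tfrac{23}{25}-h(z)\big)-Q_2\,\xi+Q_3-R_2-B_1R_1.$$ Let $J=\mathbb C(z)[u,v_1,v_2,v_3,Q_0,Q_1,Q_2,Q_3,m_1,m_2]$ be the polynomial ring in these symbols; an element of $J$ defines a function on $U$ away from the poles of its coefficients. Identities between functions are understood on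 $U$ outside a finite set. Assume that $\partial_{\bar z}A_1,\partial_{\bar z}B_1,\partial_{\bar z}R_1$ are independent over $J$: if $a,b,c\in J$ and $a\,\partial_{\bar z}A_1+b\,\partial_{\bar z}B_1+c\,\partial_{\bar z}R_1=0$ as functions, then $a=b=c=0$ in $J$. **Theorem.** Let $2g-2+h>0$. Suppose that for all $(g',h')$ with $g'\le g$, $h'\le h$, $2g'-2+h'>0$ the function $P^{(g',h')}$ is given by an element of $J$ (denoted by the same letter), and that $(\ast)_{g',h'}$ holds for all these $(g',h')\neq(g,h)$. Then there are unique $Y_0,Y_1,W_0,W_1,W_2\in J$ not involving $u$ such that $Y_0+uY_1=P^{(g,h-1)}_1$ (read as $0$ if $h=0$) and $$W_0+uW_1+u^2W_2=-\tfrac12\Big(\sum P^{(g_1,h_1)}_1P^{(g_2,h_2)}_1+P^{(g-1,h)}_2\Big)+(B_1Q_0-Q_1)P^{(g,h-1)}_1$$ (same summation and conventions as in $(\ast)_{g,h}$), and the equation $(\ast)_{g,h}$ is equivalent to the system in $J$ $$\frac{\partial P}{\partial u}=0,\quad\frac{\partial P}{\partial m_1}=Y_0,\quad\frac{\partial P}{\partial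 m_2}=Y_1,\quad\frac{\partial P}{\partial v_1}=W_0,\quad\frac{\partial P}{\partial v_2}=-W_1+\xi W_2,\quad\frac{\partial P}{\partial v_3}=-W_2$$ for $P=P^{(g,h)}$. -/

import Mathlib

open scoped ComplexConjugate Topology

noncomputable section

namespace MirrorQuintic

/-! ### Wirtinger calculus in one complex variable -/

/-- The Wirtinger derivative `∂f/∂z = (∂f/∂x - i ∂f/∂y) / 2`. -/
def dz (f : ℂ → ℂ) (z : ℂ) : ℂ :=
  (fderiv ℝ f z 1 - Complex.I * fderiv ℝ f z Complex.I) / 2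

/-- The Wirtinger derivative `∂f/∂z̄ = (∂f/∂x + i ∂f/∂y) / 2`. -/
def dzbar (f : ℂ → ℂ) (z : ℂ) : ℂ :=
  (fderiv ℝ f z 1 + Complex.I * fderiv ℝ f z Complex.I) / 2

/-- The logarithmic derivative operator `θ_z = z ∂/∂z`. -/
def theta (f : ℂ → ℂ) (z : ℂ) : ℂ := z * dz f z

/-! ### Periods of the mirror quintic, the domain-wall tension, and their branches -/

/-- The moduli space `ℙ¹ ∖ {0, 5⁻⁵, ∞}` in the coordinate `z`. -/
def moduli : Set ℂ := {z | z ≠ 0 ∧ z ≠ 1 / 5 ^ 5}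

/-- Frobenius periods at `z = 0`:
`ω_i(z) = ∂_ρ^i (∑_n (5ρ+1)_{5n} / ((ρ+1)_n)^5 z^{n+ρ})` at `ρ = 0`, differentiated term by term,
with the principal branch of `log z`. -/
def frobenius (i : ℕ) (z : ℂ) : ℂ :=
  ∑' n : ℕ, iteratedDeriv i
    (fun ρ : ℂ => (ascPochhammer ℂ (5 * n)).eval (5 * ρ + 1)
      / (ascPochhammer ℂ n).eval (ρ + 1) ^ 5 * z ^ ((n : ℂ) + ρ)) 0

/-- `τ(z) = ∑_n (7/2)_{5n} / ((3/2)_n)^5 z^{n+1/2}`, with the principal branch of `√z`. -/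
def tau (z : ℂ) : ℂ :=
  ∑' n : ℕ, (ascPochhammer ℂ (5 * n)).eval (7 / 2 : ℂ)
    / (ascPochhammer ℂ n).eval (3 / 2 : ℂ) ^ 5 * z ^ ((n : ℂ) + 1 / 2)

/-- A branch, on a connected open subset `U` of the moduli space, of the multivalued holomorphic
functions `ω₀, …, ω₃`, `𝒯 = 60 τ` and `√z`: holomorphic functions on `U` that are the analytic
continuations of the principal germs at a point of the slit disc `{|z| < 5⁻⁵} ∖ (-∞, 0]`, where
the series converge. -/
structure Branch where
  U : Set ℂ
  isOpen : IsOpen U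
  isPreconnected : IsPreconnected U
  subset_moduli : U ⊆ moduli
  ω : Fin 4 → ℂ → ℂ
  T : ℂ → ℂ
  sqrtz : ℂ → ℂ
  ω_holomorphic : ∀ i, DifferentiableOn ℂ (ω i) U
  T_holomorphic : DifferentiableOn ℂ T U
  sqrtz_holomorphic : DifferentiableOn ℂ sqrtz U
  principal : ∃ z₀ ∈ U, z₀ ∈ Complex.slitPlane ∧ ‖z₀‖ < 1 / 5 ^ 5 ∧
    ∀ᶠ z in 𝓝 z₀, (∀ i : Fin 4, ω i z = frobenius i z) ∧ T z = 60 * tau z ∧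
      sqrtz z = z ^ (1 / 2 : ℂ)

/-! ### Rational functions of `z` -/

/-- The Yukawa coupling `C_zzz = 5 / ((1 - 5⁵ z) z³)`. -/
def yukawa (z : ℂ) : ℂ := 5 / ((1 - 5 ^ 5 * z) * z ^ 3)

/-- `z³ C_zzz`. -/
def yukawaX (z : ℂ) : ℂ := z ^ 3 * yukawa z

/-- `θ_z (z³ C_zzz) / (z³ C_zzz)`. -/
def xi (z : ℂ) : ℂ := theta yukawaX z / yukawaX z

/-- The same function `θ_z (z³ C_zzz) / (z³ C_zzz) = 5⁵ z / (1 - 5⁵ z)` as an element of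
`ℂ(z)`. -/
def xiRat : RatFunc ℂ :=
  RatFunc.C (5 ^ 5) * RatFunc.X / (1 - RatFunc.C (5 ^ 5) * RatFunc.X)

/-- `h(z) = (1 - 3·5⁴ z) / (1 - 5⁵ z)`. -/
def hFun (z : ℂ) : ℂ := (1 - 3 * 5 ^ 4 * z) / (1 - 5 ^ 5 * z)

/-- `s(z) = 12/25 - h(z)/5 + (3/25) θ_z(z³C_zzz)/(z³C_zzz)`. -/
def sFun (z : ℂ) : ℂ := 12 / 25 - hFun z / 5 + 3 / 25 * xi z

/-! ### The polynomial ring `J` -/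

/-- The names of the generators of `J`. -/
inductive Gen
  | u | v₁ | v₂ | v₃ | Q₀ | Q₁ | Q₂ | Q₃ | m₁ | m₂

/-- `J = ℂ(z)[u, v₁, v₂, v₃, Q₀, Q₁, Q₂, Q₃, m₁, m₂]`. -/
abbrev J : Type := MvPolynomial Gen (RatFunc ℂ)

namespace Branch

variable (B : Branch)

/-- `p z` holds for all but finitely many `z ∈ U`. Used for identities between elements of `J`
viewed as functions: their `ℂ(z)`-coefficients may have finitely many poles in `U`. -/
def Generically (p : ℂ → Prop) : Prop := {z | z ∈ B.U ∧ ¬ p z}.Finite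

/-! ### Special Kähler geometry -/

/-- `e^{-K} = (Ω, Ω̄) = i ∫ Ω ∧ Ω̄`, written in the Frobenius periods, for the form `Ω` normalised
by `∫ Ω ∧ ∇³Ω = C_zzz`. -/
def hermNorm (z : ℂ) : ℝ :=
  -(5 / 3) * (B.ω 0 z * conj (B.ω 3 z)).re - 5 * (B.ω 1 z * conj (B.ω 2 z)).re
    + 400 * (riemannZeta 3).re * ‖B.ω 0 z‖ ^ 2

/-- `K = -log (Ω, Ω̄)`. -/
def K (z : ℂ) : ℂ := ((-Real.log (B.hermNorm z) : ℝ) : ℂ)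

/-- The Weil–Petersson metric `G_{z z̄} = ∂_z ∂_z̄ K`. -/
def G : ℂ → ℂ := dz (dzbar B.K)

/-- `Γ_{zz}^z = G^{z z̄} ∂_z G_{z z̄}`. -/
def Gam (z : ℂ) : ℂ := dz B.G z / B.G z

/-- `D_z` on sections of `(T^*)^m ⊗ 𝓛^n`. -/
def covD (m : ℕ) (n : ℤ) (f : ℂ → ℂ) (z : ℂ) : ℂ :=
  dz f z - m * B.Gam z * f z - n * dz B.K z * f z

/-- `D̄_z̄ 𝒯̄ = (∂_z̄ + ∂_z̄ K) 𝒯̄`. -/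
def covDbarTbar (z : ℂ) : ℂ :=
  dzbar (fun y => conj (B.T y)) z + dzbar B.K z * conj (B.T z)

/-- The disk two-point amplitude
`△_{zz} = D_z D_z 𝒯 - (e^K C_zzz / G_{z z̄}) D̄_z̄ 𝒯̄`, with `𝒯` a section of `𝓛^*`. -/
def disk (z : ℂ) : ℂ :=
  B.covD 1 (-1) (B.covD 0 (-1) B.T) z
    - Complex.exp (B.K z) * yukawa z / B.G z * B.covDbarTbar z

/-- `C_z̄^{zz} = C_{z̄z̄z̄} e^{2K} G_{z z̄}^{-2}`. -/
def Cbar (z : ℂ) : ℂ := conj (yukawa z) * Complex.exp (2 * B.K z) / B.G z ^ 2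

/-- `△_z̄^z = △_{z̄z̄} e^K G_{z z̄}^{-1}`. -/
def diskBar (z : ℂ) : ℂ := conj (B.disk z) * Complex.exp (B.K z) / B.G z

/-! ### Amplitudes -/

/-- `ℱ^{(1,0)}_1 = ½ ∂_z log (e^{(4-χ/12)K} G^{-1} (1-5⁵z)^{-1/6} z^{-1-c₂·H/12})`, with
`χ = -200`, `c₂·H = 50`; the logarithmic derivative is expanded. -/
def F10 (z : ℂ) : ℂ :=
  1 / 2 * ((4 - (-200) / 12) * dz B.K z - dz B.G z / B.G z
    - 1 / 6 * (dz (fun y => 1 - 5 ^ 5 * y) z / (1 - 5 ^ 5 * z))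
    + (-1 - 50 / 12) / z)

/-- The terminator `△^z = - △_{zz} / C_zzz`. -/
def diskUp (z : ℂ) : ℂ := -B.disk z / yukawa z

/-- `ℱ^{(0,2)}_1 = -△_{zz}△^z - ½ C_zzz △^z△^z + (N/2) ∂_z K + 75 / (2(1-5⁵z))`, with `N = 1`. -/
def F02 (z : ℂ) : ℂ :=
  -B.disk z * B.diskUp z - 1 / 2 * yukawa z * B.diskUp z * B.diskUp z
    + 1 / 2 * dz B.K z + 75 / (2 * (1 - 5 ^ 5 * z))

/-- The first covariant derivative of `ℱ^{(g,h)}` that is defined: it is of order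
`3 - (2g + h)` (truncated at `0`). -/
def initial (F : ℕ → ℕ → ℂ → ℂ) : ℕ → ℕ → ℂ → ℂ
  | 0, 0 => yukawa
  | 0, 1 => B.disk
  | 1, 0 => B.F10
  | 0, 2 => B.F02
  | g, h => F g h

/-- `ℱ^{(g,h)}_n`, where `F g h` is `ℱ^{(g,h)}` for `2g - 2 + h > 0`; set to zero when
`2g - 2 + h + n ≤ 0`. It is a section of `(T^*)^n ⊗ 𝓛^{2g-2+h}`, and
`ℱ^{(g,h)}_{n+1} = D_z ℱ^{(g,h)}_n`. -/
def amp (F : ℕ → ℕ → ℂ → ℂ) (g h : ℕ) : ℕ → ℂ → ℂ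
  | 0 => if 3 - (2 * g + h) = 0 then B.initial F g h else 0
  | n + 1 =>
    if n + 1 < 3 - (2 * g + h) then 0
    else if n + 1 = 3 - (2 * g + h) then B.initial F g h
    else B.covD n (2 * g - 2 + h) (amp F g h n)

/-- `P^{(g,h)}_n = (z³C_zzz)^{g+h-1} z^{n+h/2} ℱ^{(g,h)}_n`, as a function. -/
def PFun (F : ℕ → ℕ → ℂ → ℂ) (g h n : ℕ) (z : ℂ) : ℂ :=
  yukawaX z ^ ((g : ℤ) + h - 1) * B.sqrtz z ^ h * z ^ n * B.amp F g h n z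

/-- The pairs `((g₁,g₂),(h₁,h₂))` with `g₁+g₂ = g`, `h₁+h₂ = h` and
`(g₁,h₁), (g₂,h₂) ≠ (0,0), (0,1)`. -/
def splittings (g h : ℕ) : Finset ((ℕ × ℕ) × (ℕ × ℕ)) :=
  (Finset.HasAntidiagonal.antidiagonal g ×ˢ Finset.HasAntidiagonal.antidiagonal h).filter fun p =>
    (p.1.1, p.2.1) ≠ (0, 0) ∧ (p.1.1, p.2.1) ≠ (0, 1) ∧
    (p.1.2, p.2.2) ≠ (0, 0) ∧ (p.1.2, p.2.2) ≠ (0, 1)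

/-- The right-hand side of the extended holomorphic anomaly equation. -/
def anomalyRHS (F : ℕ → ℕ → ℂ → ℂ) (g h : ℕ) (z : ℂ) : ℂ :=
  1 / 2 * B.Cbar z *
      ((∑ p ∈ splittings g h, B.amp F p.1.1 p.2.1 1 z * B.amp F p.1.2 p.2.2 1 z)
        + if g = 0 then 0 else B.amp F (g - 1) h 2 z)
    - if h = 0 then 0 else B.diskBar z * B.amp F g (h - 1) 1 z

/-- Walcher's extended holomorphic anomaly equation for `ℱ^{(g,h)}`. -/
def AnomalyEquation (F : ℕ → ℕ → ℂ → ℂ) (g h : ℕ) : Prop :=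
  B.Generically fun z => dzbar (F g h) z = B.anomalyRHS F g h z

/-! ### Generators -/

/-- `A_p = θ_z^p G_{z z̄} / G_{z z̄}`. -/
def A (p : ℕ) (z : ℂ) : ℂ := theta^[p] B.G z / B.G z

/-- `B_p = θ_z^p e^{-K} / e^{-K}`. -/
def Bp (p : ℕ) (z : ℂ) : ℂ :=
  theta^[p] (fun y => Complex.exp (-B.K y)) z / Complex.exp (-B.K z)

/-- `Q_p = z^{1/2} θ_z^p 𝒯`. -/
def Q (p : ℕ) (z : ℂ) : ℂ := B.sqrtz z * theta^[p] B.T z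

/-- `R₁ = z^{5/2} (e^K C_zzz / G_{z z̄}) D̄_z̄ 𝒯̄`. -/
def R₁ (z : ℂ) : ℂ :=
  B.sqrtz z ^ 5 * (Complex.exp (B.K z) * yukawa z / B.G z) * B.covDbarTbar z

/-- `R₂ = z^{7/2} e^K C_zzz 𝒯̄`. -/
def R₂ (z : ℂ) : ℂ := B.sqrtz z ^ 7 * Complex.exp (B.K z) * yukawa z * conj (B.T z)

/-- `V₁ = A₁ + 2B₁ + 1`. -/
def V₁ (z : ℂ) : ℂ := B.A 1 z + 2 * B.Bp 1 z + 1

/-- `V₂ = B₂ - B₁V₁`. -/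
def V₂ (z : ℂ) : ℂ := B.Bp 2 z - B.Bp 1 z * B.V₁ z

/-- The functions on `U` that the generators of `J` stand for. -/
def gen : Gen → ℂ → ℂ
  | .u => B.Bp 1
  | .v₁ => fun z => B.V₁ z + 3 / 5
  | .v₂ => fun z => B.V₂ z + 2 / 25
  | .v₃ => fun z =>
      B.Bp 3 z - B.Bp 1 z * (-B.V₂ z + xi z * B.V₁ z + hFun z - 1) + sFun z
  | .Q₀ => B.Q 0
  | .Q₁ => B.Q 1
  | .Q₂ => B.Q 2
  | .Q₃ => B.Q 3
  | .m₁ => fun z => 2 / 25 * B.Q 0 z + 3 / 5 * B.Q 1 z + B.Q 2 z - B.R₁ z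
  | .m₂ => fun z =>
      B.Q 0 z * (sFun z - 2 / 25 * xi z) + B.Q 1 z * (23 / 25 - hFun z) - B.Q 2 z * xi z
        + B.Q 3 z - B.R₂ z - B.Bp 1 z * B.R₁ z

/-- The function on `U` given by an element of `J` (meaningful away from the finitely many poles
of the coefficients). -/
def ev (f : J) (z : ℂ) : ℂ :=
  ∑ s ∈ f.support, (f.coeff s).eval (RingHom.id ℂ) z * s.prod fun i k => B.gen i z ^ k

/-- `∂_z̄ A₁`, `∂_z̄ B₁`, `∂_z̄ R₁` are independent over the polynomial ring. -/
def Independent : Prop :=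
  ∀ a b c : J,
    (B.Generically fun z =>
      B.ev a z * dzbar (B.A 1) z + B.ev b z * dzbar (B.Bp 1) z + B.ev c z * dzbar B.R₁ z = 0) →
    a = 0 ∧ b = 0 ∧ c = 0

/-- The function
`-½ (∑ P₁^{(g₁,h₁)} P₁^{(g₂,h₂)} + P₂^{(g-1,h)}) + (B₁Q₀ - Q₁) P₁^{(g,h-1)}`. -/
def WFun (F : ℕ → ℕ → ℂ → ℂ) (g h : ℕ) (z : ℂ) : ℂ :=
  -(1 / 2) *
      ((∑ p ∈ splittings g h, B.PFun F p.1.1 p.2.1 1 z * B.PFun F p.1.2 p.2.2 1 z)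
        + if g = 0 then 0 else B.PFun F (g - 1) h 2 z)
    + (B.Bp 1 z * B.Q 0 z - B.Q 1 z) * (if h = 0 then 0 else B.PFun F g (h - 1) 1 z)

/-- `Y₀, Y₁, W₀, W₁, W₂ ∈ J` do not involve `u`, `Y₀ + u Y₁ = P₁^{(g,h-1)}` (zero if `h = 0`), and
`W₀ + u W₁ + u² W₂` is the function `WFun`. -/
structure IsUExpansion (F : ℕ → ℕ → ℂ → ℂ) (g h : ℕ) (Y : Fin 2 → J) (W : Fin 3 → J) : Prop where
  Y_indep : ∀ i, MvPolynomial.pderiv Gen.u (Y i) = 0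
  W_indep : ∀ i, MvPolynomial.pderiv Gen.u (W i) = 0
  Y_eq : B.Generically fun z =>
    B.ev (Y 0 + MvPolynomial.X Gen.u * Y 1) z = if h = 0 then 0 else B.PFun F g (h - 1) 1 z
  W_eq : B.Generically fun z =>
    B.ev (W 0 + MvPolynomial.X Gen.u * W 1 + MvPolynomial.X Gen.u ^ 2 * W 2) z = B.WFun F g h z

end Branch

/-- The system of partial differential equations for `P ∈ J`. -/
structure PDESystem (Y : Fin 2 → J) (W : Fin 3 → J) (P : J) : Prop where
  du : MvPolynomial.pderiv Gen.u P = 0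
  dm₁ : MvPolynomial.pderiv Gen.m₁ P = Y 0
  dm₂ : MvPolynomial.pderiv Gen.m₂ P = Y 1
  dv₁ : MvPolynomial.pderiv Gen.v₁ P = W 0
  dv₂ : MvPolynomial.pderiv Gen.v₂ P = -W 1 + MvPolynomial.C xiRat * W 2
  dv₃ : MvPolynomial.pderiv Gen.v₃ P = -W 2

end MirrorQuintic

end

/-!
The anomaly equation at `(g,h)`, multiplied by the weight `x^{g+h-1} z^{h/2}`, becomes
`∂P/∂z̄ = W ∂V₁/∂z̄ - Y ∂R₁/∂z̄` with `Y = P_1^{(g,h-1)}` and `W` the function `WFun`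
(`weight_mul_anomalyRHS`). For `P ∈ J` the left-hand side is given by the chain rule, the
coefficients in `ℂ(z)` being holomorphic. The `∂/∂z̄`-derivatives of the generators are
`ℂ(z)[u]`-multiples of `∂B₁/∂z̄`, `∂V₁/∂z̄ = ∂A₁/∂z̄ + 2 ∂B₁/∂z̄` and `∂R₁/∂z̄`
(`hasWirtinger_gen`). By independence, the equation is therefore equivalent to three identities
in `J` (`anomalyEquation_iff`):
`P_u = 0`, `P_{v₁} - u P_{v₂} - u (u + ξ) P_{v₃} = W` and `P_{m₁} + u P_{m₂} = Y`.
In particular the lower equations show, by induction, that the lower `P^{(g',h')}` do not involve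
`u`. The operator `θ` preserves the polynomial ring in the generators other than `u`, the terms
in `u` cancelling, and the connection terms of `D_z` are linear in `u`; so `P_1` and `P_2` have
degree at most one and two in `u`. Hence `Y` and `W` have degree at most one and two
(`degLE_YFun`, `degLE_WFun`). This gives the expansions, and comparing the coefficients of the
powers of `u` turns the three identities into the system (`pdeSystem_iff`).

The derivatives of the generators rest on three facts about the periods. They satisfy the
Picard–Fuchs equation, and `𝒯` its inhomogeneous version: this is a recursion for the
coefficients of the Frobenius series, carried from the disc to `U` by the identity theorem.
The symplectic pairing of `ω` and `θω` vanishes, and the pairing of `ω` and `θ³ω` is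
`1/(1-5⁵z)` (`frobPair_zero_one`, `frobPair_zero_three`): the first is a power series satisfying
a fifth-order equation that forces its vanishing. Finally
`e^{-K}` is the pairing of `ω` with a vector built from the conjugate periods. Writing
`S_{pq}` for the pairing of `θ^pω` with the conjugate of `θ^qω` (`herm`), the metric and the
generators `B_p`, `V₁`, `V₂` are ratios of minors of this matrix. The formula for `θV₁` is then
an identity between `2 × 2` minors (`minor_three`, from `pairing_pfaffian`), and the formula
`∂V₁/∂z̄ = -z C_zzz C_z̄^{zz}` the evaluation of a `3 × 3` determinant (`herm_det`, from
`pairing_det`).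
-/

open scoped ComplexConjugate Topology

noncomputable section

namespace MirrorQuintic

/-! ### Taylor coefficients in the Frobenius parameter -/

/-- The `k`-th Taylor coefficient of `f` at the origin. -/
def taylorCoeff (k : ℕ) (f : ℂ → ℂ) : ℂ := iteratedDeriv k f 0 / k.factorial

theorem taylorCoeff_congr {f g : ℂ → ℂ} (h : f =ᶠ[𝓝 0] g) (k : ℕ) :
    taylorCoeff k f = taylorCoeff k g := by
  rw [taylorCoeff, taylorCoeff, h.iteratedDeriv_eq k]

theorem taylorCoeff_add {f g : ℂ → ℂ} (hf : AnalyticAt ℂ f 0) (hg : AnalyticAt ℂ g 0) (k : ℕ) :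
    taylorCoeff k (fun x => f x + g x) = taylorCoeff k f + taylorCoeff k g := by
  rw [taylorCoeff, taylorCoeff, taylorCoeff, iteratedDeriv_fun_add hf.contDiffAt hg.contDiffAt,
    add_div]

theorem taylorCoeff_const_mul (c : ℂ) (f : ℂ → ℂ) (k : ℕ) :
    taylorCoeff k (fun x => c * f x) = c * taylorCoeff k f := by
  rw [taylorCoeff, taylorCoeff, iteratedDeriv_const_mul_field, mul_div_assoc]

theorem taylorCoeff_mul {f g : ℂ → ℂ} (hf : AnalyticAt ℂ f 0) (hg : AnalyticAt ℂ g 0) (k : ℕ) :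
    taylorCoeff k (fun x => f x * g x)
      = ∑ i ∈ Finset.range (k + 1), taylorCoeff i f * taylorCoeff (k - i) g := by
  rw [taylorCoeff, iteratedDeriv_fun_mul hf.contDiffAt hg.contDiffAt, Finset.sum_div]
  refine Finset.sum_congr rfl fun i hi => ?_
  have hi : i ≤ k := Nat.lt_succ_iff.mp (Finset.mem_range.mp hi)
  have h := Nat.choose_mul_factorial_mul_factorial hi
  have h' : (k.factorial : ℂ) = k.choose i * i.factorial * (k - i).factorial := by
    exact_mod_cast h.symm
  have h1 : (i.factorial : ℂ) ≠ 0 := by exact_mod_cast i.factorial_ne_zero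
  have h2 : ((k - i).factorial : ℂ) ≠ 0 := by exact_mod_cast (k - i).factorial_ne_zero
  have h3 : (k.choose i : ℂ) ≠ 0 := by exact_mod_cast (Nat.choose_pos hi).ne'
  rw [taylorCoeff, taylorCoeff, h']
  field_simp

theorem taylorCoeff_id_mul {f : ℂ → ℂ} (hf : AnalyticAt ℂ f 0) (k : ℕ) :
    taylorCoeff k (fun x => x * f x) = if k = 0 then 0 else taylorCoeff (k - 1) f := by
  have hid : ∀ i, taylorCoeff i (fun x : ℂ => x) = if i = 1 then 1 else 0 := by
    intro i
    rw [taylorCoeff]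
    rcases i with _ | _ | i
    · simp
    · simp
    · simp [iteratedDeriv_succ', iteratedDeriv_const]
  rw [taylorCoeff_mul (f := fun x => x) analyticAt_id hf]
  simp only [hid, ite_mul, one_mul, zero_mul, Finset.sum_ite_eq', Finset.mem_range]
  split_ifs <;> first | rfl | omega

/-- The coefficient `a_n(ρ) = (5ρ+1)_{5n} / ((ρ+1)_n)^5` of the Frobenius series. -/
def frobCoeff (n : ℕ) (ρ : ℂ) : ℂ :=
  (ascPochhammer ℂ (5 * n)).eval (5 * ρ + 1) / (ascPochhammer ℂ n).eval (ρ + 1) ^ 5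

theorem add_one_ne_zero_of_norm {ρ : ℂ} (hρ : ‖ρ‖ ≤ 1 / 2) (n : ℕ) : (n + 1 + ρ : ℂ) ≠ 0 := by
  intro h
  have h1 : ρ = -((n + 1 : ℝ) : ℂ) := by push_cast; linear_combination h
  rw [h1, norm_neg, Complex.norm_real, Real.norm_of_nonneg (by positivity)] at hρ
  have : (0 : ℝ) ≤ n := n.cast_nonneg
  linarith

theorem ascPochhammer_eval_ne_zero {ρ : ℂ} (hρ : ‖ρ‖ ≤ 1 / 2) (n : ℕ) :
    (ascPochhammer ℂ n).eval (ρ + 1) ≠ 0 := by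
  induction n with
  | zero => simp
  | succ n ih =>
    rw [ascPochhammer_succ_eval]
    refine mul_ne_zero ih ?_
    have := add_one_ne_zero_of_norm hρ n
    contrapose! this
    linear_combination this

theorem frobCoeff_succ {ρ : ℂ} (hρ : ‖ρ‖ ≤ 1 / 2) (n : ℕ) :
    frobCoeff (n + 1) ρ = frobCoeff n ρ *
      ((5 * n + 5 * ρ + 1) * (5 * n + 5 * ρ + 2) * (5 * n + 5 * ρ + 3) * (5 * n + 5 * ρ + 4)
        * (5 * n + 5 * ρ + 5)) / (n + 1 + ρ) ^ 5 := by
  have h1 := ascPochhammer_eval_ne_zero hρ n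
  have h2 := add_one_ne_zero_of_norm hρ n
  have h3 : (ρ + 1 + n : ℂ) ≠ 0 := by contrapose! h2; linear_combination h2
  rw [frobCoeff, frobCoeff, ascPochhammer_succ_eval,
    show 5 * (n + 1) = 5 * n + 1 + 1 + 1 + 1 + 1 by ring]
  simp only [ascPochhammer_succ_eval]
  push_cast
  rw [show (ρ + 1 + n : ℂ) = n + 1 + ρ by ring]
  field_simp
  ring

/-- The recursion that makes the Frobenius series a solution of the Picard–Fuchs equation. -/
theorem frobCoeff_rec {ρ : ℂ} (hρ : ‖ρ‖ ≤ 1 / 2) (n : ℕ) :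
    (n + 1 + ρ) ^ 4 * frobCoeff (n + 1) ρ
      = 5 * (625 * ((n + ρ) ^ 4 * frobCoeff n ρ) + 1250 * ((n + ρ) ^ 3 * frobCoeff n ρ)
        + 875 * ((n + ρ) ^ 2 * frobCoeff n ρ) + 250 * ((n + ρ) ^ 1 * frobCoeff n ρ)
        + 24 * ((n + ρ) ^ 0 * frobCoeff n ρ)) := by
  have h2 := add_one_ne_zero_of_norm hρ n
  rw [frobCoeff_succ hρ]
  field_simp
  ring

theorem frobCoeff_zero (ρ : ℂ) : frobCoeff 0 ρ = 1 := by simp [frobCoeff]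

theorem differentiableAt_frobCoeff {ρ : ℂ} (hρ : ‖ρ‖ ≤ 1 / 2) (n : ℕ) :
    DifferentiableAt ℂ (frobCoeff n) ρ := by
  unfold frobCoeff
  refine DifferentiableAt.div ?_ ?_ (pow_ne_zero _ (ascPochhammer_eval_ne_zero hρ n))
  · exact ((ascPochhammer ℂ (5 * n)).differentiable.comp
      (by fun_prop : Differentiable ℂ fun x : ℂ => 5 * x + 1)) ρ
  · exact (((ascPochhammer ℂ n).differentiable.comp
      (by fun_prop : Differentiable ℂ fun x : ℂ => x + 1)) ρ).pow 5

theorem analyticAt_frobCoeff (n : ℕ) : AnalyticAt ℂ (frobCoeff n) 0 := by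
  have : DifferentiableOn ℂ (frobCoeff n) (Metric.ball 0 (1 / 2)) := fun ρ hρ =>
    (differentiableAt_frobCoeff
      (by simpa using (Metric.mem_ball.mp hρ).le) n).differentiableWithinAt
  exact this.analyticAt (Metric.ball_mem_nhds 0 (by norm_num))

/-- A majorant of `|a_n(ρ)|` on `|ρ| ≤ 1/2`. -/
def frobBound (n : ℕ) : ℝ := ∏ m ∈ Finset.range n, ((5 * m + 15 / 2) / (m + 1 / 2)) ^ 5

theorem frobBound_pos (n : ℕ) : 0 < frobBound n := Finset.prod_pos fun m _ => by positivity

theorem norm_frobCoeff_le {ρ : ℂ} (hρ : ‖ρ‖ ≤ 1 / 2) (n : ℕ) : ‖frobCoeff n ρ‖ ≤ frobBound n := by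
  induction n with
  | zero => simp [frobCoeff_zero, frobBound]
  | succ n ih =>
    have hn : (0 : ℝ) ≤ n := n.cast_nonneg
    have key : ∀ j : ℝ, 0 ≤ j → j ≤ 5 → ‖(5 * n + 5 * ρ + (j : ℂ) : ℂ)‖ ≤ 5 * n + 15 / 2 := by
      intro j hj hj5
      calc ‖(5 * n + 5 * ρ + (j : ℂ) : ℂ)‖ ≤ ‖(5 * n : ℂ)‖ + ‖5 * ρ‖ + ‖(j : ℂ)‖ := norm_add₃_le
        _ ≤ 5 * n + 15 / 2 := by
          rw [norm_mul, norm_mul, Complex.norm_real, Real.norm_of_nonneg hj]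
          simp only [Complex.norm_ofNat, Complex.norm_natCast]
          linarith
    have hden : (n + 1 / 2 : ℝ) ≤ ‖(n + 1 + ρ : ℂ)‖ := by
      have h1 : ‖((n + 1 : ℝ) : ℂ)‖ ≤ ‖(n + 1 + ρ : ℂ)‖ + ‖ρ‖ := by
        calc ‖((n + 1 : ℝ) : ℂ)‖ = ‖(n + 1 + ρ : ℂ) - ρ‖ := by push_cast; ring_nf
          _ ≤ _ := norm_sub_le _ _
      rw [Complex.norm_real, Real.norm_of_nonneg (by positivity)] at h1
      linarith
    have k1 := key 1 (by norm_num) (by norm_num)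
    have k2 := key 2 (by norm_num) (by norm_num)
    have k3 := key 3 (by norm_num) (by norm_num)
    have k4 := key 4 (by norm_num) (by norm_num)
    have k5 := key 5 (by norm_num) (by norm_num)
    push_cast at k1 k2 k3 k4 k5
    rw [frobCoeff_succ hρ, frobBound, Finset.prod_range_succ, ← frobBound, norm_div, norm_mul,
      norm_mul, norm_mul, norm_mul, norm_mul, norm_pow, div_pow, mul_div_assoc]
    refine mul_le_mul ih (div_le_div₀ (by positivity) ?_ (by positivity)
      (pow_le_pow_left₀ (by positivity) hden 5)) (by positivity) (frobBound_pos n).le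
    calc _ ≤ (5 * n + 15 / 2 : ℝ) * (5 * n + 15 / 2) * (5 * n + 15 / 2) * (5 * n + 15 / 2)
        * (5 * n + 15 / 2) := by gcongr
      _ = _ := by ring

theorem frobBound_succ (n : ℕ) :
    frobBound (n + 1) = frobBound n * ((5 * n + 15 / 2) / (n + 1 / 2)) ^ 5 := by
  rw [frobBound, Finset.prod_range_succ, ← frobBound]

/-- The ratios of consecutive terms tend to `5⁵ r`. -/
theorem summable_frobBound (j : ℕ) {r : ℝ} (hr : 0 ≤ r) (hr' : r < 1 / 5 ^ 5) :
    Summable fun n : ℕ => ((n : ℝ) + 1 / 2) ^ j * frobBound n * r ^ n := by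
  rcases hr.eq_or_lt with rfl | hr
  · refine summable_of_ne_finset_zero (s := {0}) fun n hn => ?_
    simp at hn
    simp [hn]
  refine summable_of_ratio_test_tendsto_lt_one (l := 1 ^ j * 5 ^ 5 * r)
    (by rw [one_pow]; linarith)
    (Filter.Eventually.of_forall fun n => ?_) ?_
  · have := frobBound_pos n
    positivity
  have hlim : Filter.Tendsto (fun n : ℕ => ((n + 3 / 2 : ℝ) / (n + 1 / 2))) Filter.atTop (𝓝 1) := by
    have h : Filter.Tendsto (fun n : ℕ => 1 + 1 / ((n : ℝ) + 1 / 2)) Filter.atTop (𝓝 (1 + 0)) := by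
      refine tendsto_const_nhds.add ?_
      simp only [one_div]
      exact (Filter.tendsto_atTop_add_const_right _ _ tendsto_natCast_atTop_atTop).inv_tendsto_atTop
    rw [add_zero] at h
    refine h.congr fun n => ?_
    have : (n : ℝ) + 1 / 2 ≠ 0 := by positivity
    field_simp
    ring
  have h2 := ((hlim.pow j).mul ((hlim.const_mul 5).pow 5)).mul_const r
  simp only [mul_one] at h2
  refine h2.congr fun n => ?_
  have hb := frobBound_pos n
  have h1 : (n : ℝ) + 1 / 2 ≠ 0 := by positivity
  have h3 : (n : ℝ) + 1 + 1 / 2 ≠ 0 := by positivity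
  rw [Real.norm_of_nonneg (by have := frobBound_pos (n + 1); positivity),
    Real.norm_of_nonneg (by positivity), frobBound_succ, pow_succ]
  push_cast
  rw [show (n : ℝ) + 1 + 1 / 2 = n + 3 / 2 by ring,
    show (5 * n + 15 / 2 : ℝ) = 5 * (n + 3 / 2) by ring, div_pow,
    pow_succ r]
  field_simp

/-! ### Holomorphic logarithmic derivatives -/

/-- `f` is holomorphic at `z` with `z f'(z) = a`. -/
def HasTheta (f : ℂ → ℂ) (a z : ℂ) : Prop := ∃ f' : ℂ, HasDerivAt f f' z ∧ z * f' = a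

namespace HasTheta

variable {f g : ℂ → ℂ} {a b z : ℂ}

theorem differentiableAt (h : HasTheta f a z) : DifferentiableAt ℂ f z :=
  h.choose_spec.1.differentiableAt

theorem mul_deriv (h : HasTheta f a z) : z * deriv f z = a := by
  obtain ⟨f', h, rfl⟩ := h
  rw [h.deriv]

theorem of_differentiableAt (h : DifferentiableAt ℂ f z) : HasTheta f (z * deriv f z) z :=
  ⟨_, h.hasDerivAt, rfl⟩

theorem add (hf : HasTheta f a z) (hg : HasTheta g b z) :
    HasTheta (fun y => f y + g y) (a + b) z := by
  obtain ⟨f', hf, rfl⟩ := hf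
  obtain ⟨g', hg, rfl⟩ := hg
  exact ⟨_, hf.add hg, by ring⟩

theorem mul (hf : HasTheta f a z) (hg : HasTheta g b z) :
    HasTheta (fun y => f y * g y) (a * g z + f z * b) z := by
  obtain ⟨f', hf, rfl⟩ := hf
  obtain ⟨g', hg, rfl⟩ := hg
  exact ⟨_, hf.mul hg, by ring⟩

theorem const (c z : ℂ) : HasTheta (fun _ => c) 0 z := ⟨0, hasDerivAt_const _ _, by ring⟩

theorem const_mul (c : ℂ) (hf : HasTheta f a z) : HasTheta (fun y => c * f y) (c * a) z := by
  obtain ⟨f', hf, rfl⟩ := hf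
  exact ⟨_, hf.const_mul c, by ring⟩

theorem sub (hf : HasTheta f a z) (hg : HasTheta g b z) :
    HasTheta (fun y => f y - g y) (a - b) z := by
  obtain ⟨f', hf, rfl⟩ := hf
  obtain ⟨g', hg, rfl⟩ := hg
  exact ⟨_, hf.sub hg, by ring⟩

theorem pow (hf : HasTheta f a z) (n : ℕ) :
    HasTheta (fun y => f y ^ n) (n * f z ^ (n - 1) * a) z := by
  obtain ⟨f', hf, rfl⟩ := hf
  exact ⟨_, hf.pow n, by ring⟩

theorem congr_theta (hf : HasTheta f a z) (h : a = b) : HasTheta f b z := h ▸ hf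

theorem congr_fun (hf : HasTheta f a z) (h : g =ᶠ[𝓝 z] f) : HasTheta g a z := by
  obtain ⟨f', hf, rfl⟩ := hf
  exact ⟨_, hf.congr_of_eventuallyEq h, rfl⟩

end HasTheta

/-- `ξ = 5⁵ z / (1 - 5⁵ z)` in closed form. -/
def xiFun (z : ℂ) : ℂ := 5 ^ 5 * z / (1 - 5 ^ 5 * z)

theorem hasTheta_xiFun {z : ℂ} (hz : 1 - 5 ^ 5 * z ≠ 0) :
    HasTheta xiFun (xiFun z + xiFun z ^ 2) z := by
  have h1 : HasDerivAt (fun y : ℂ => 5 ^ 5 * y) (5 ^ 5) z := by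
    simpa using (hasDerivAt_id z).const_mul (5 ^ 5 : ℂ)
  refine ⟨_, h1.div (h1.const_sub 1) hz, ?_⟩
  unfold xiFun
  field_simp
  ring

/-! ### Power series in `z` -/

/-- The sum `∑ c_n zⁿ`. -/
def powSer (c : ℕ → ℂ) (z : ℂ) : ℂ := ∑' n, c n * z ^ n

/-- Absolute convergence of `∑ c_n zⁿ` on the disc `|z| < 5⁻⁵`. -/
def ConvOnDisc (c : ℕ → ℂ) : Prop :=
  ∀ r : ℝ, 0 ≤ r → r < 1 / 5 ^ 5 → Summable fun n => ‖c n‖ * r ^ n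

namespace ConvOnDisc

variable {c d : ℕ → ℂ} {z : ℂ}

theorem summable (hc : ConvOnDisc c) (hz : ‖z‖ < 1 / 5 ^ 5) : Summable fun n => c n * z ^ n := by
  refine Summable.of_norm ?_
  simpa [norm_mul, norm_pow] using hc ‖z‖ (norm_nonneg z) hz

theorem hasTheta (hc : ConvOnDisc c) (hz : ‖z‖ < 1 / 5 ^ 5) :
    HasTheta (powSer c) (powSer (fun n => n * c n) z) z := by
  obtain ⟨r, hzr, hr⟩ := exists_between hz
  have hzr' : z ∈ Metric.ball (0 : ℂ) r := by simpa using hzr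
  have hu := hc r ((norm_nonneg z).trans hzr.le) hr
  have hd : ∀ n : ℕ, DifferentiableOn ℂ (fun w : ℂ => c n * w ^ n) (Metric.ball 0 r) :=
    fun n => by fun_prop
  have hle : ∀ (n : ℕ) (w : ℂ), w ∈ Metric.ball (0 : ℂ) r → ‖c n * w ^ n‖ ≤ ‖c n‖ * r ^ n := by
    intro n w hw
    rw [norm_mul, norm_pow]
    have : ‖w‖ < r := by simpa using hw
    gcongr
  have h1 := Complex.differentiableOn_tsum_of_summable_norm hu hd Metric.isOpen_ball hle
  have h2 := Complex.hasSum_deriv_of_summable_norm hu hd Metric.isOpen_ball hle hzr'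
  refine ⟨_, (h1.differentiableAt (Metric.isOpen_ball.mem_nhds hzr')).hasDerivAt, ?_⟩
  rw [← h2.tsum_eq, ← tsum_mul_left]
  refine tsum_congr fun n => ?_
  rw [deriv_const_mul_field, deriv_pow_field]
  rcases n with _ | n
  · simp
  · rw [Nat.add_sub_cancel, pow_succ]
    ring

theorem powSer_eq_add (hc : ConvOnDisc c) (hz : ‖z‖ < 1 / 5 ^ 5) :
    powSer c z = c 0 + z * powSer (fun n => c (n + 1)) z := by
  rw [powSer, (hc.summable hz).tsum_eq_zero_add, powSer, ← tsum_mul_left]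
  simp [pow_succ]
  exact tsum_congr fun n => by ring

end ConvOnDisc

theorem powSer_zero (c : ℕ → ℂ) : powSer c 0 = c 0 := by
  rw [powSer, tsum_eq_single 0]
  · simp
  · intro n hn
    simp [hn]

/-! ### The Frobenius solutions of the Picard–Fuchs equation -/

/-- The coefficient of `ρᵏ` in `(n+ρ)ʲ a_n(ρ)`. -/
def frobTaylor (j k n : ℕ) : ℂ := taylorCoeff k fun ρ => (n + ρ) ^ j * frobCoeff n ρ

theorem analyticAt_frobTerm (j n : ℕ) : AnalyticAt ℂ (fun ρ => (n + ρ) ^ j * frobCoeff n ρ) 0 :=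
  ((analyticAt_const.add analyticAt_id).pow j).mul (analyticAt_frobCoeff n)

theorem frobTaylor_succ (j k n : ℕ) :
    frobTaylor (j + 1) k n
      = n * frobTaylor j k n + if k = 0 then 0 else frobTaylor j (k - 1) n := by
  have ha := analyticAt_frobTerm j n
  have h : frobTaylor (j + 1) k n = taylorCoeff k fun ρ =>
      n * ((n + ρ) ^ j * frobCoeff n ρ) + ρ * ((n + ρ) ^ j * frobCoeff n ρ) := by
    unfold frobTaylor
    congr 1
    ext ρ
    ring
  have ha' := analyticAt_frobCoeff n
  rw [h, taylorCoeff_add, taylorCoeff_const_mul, taylorCoeff_id_mul ha]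
  · rfl
  all_goals fun_prop

theorem frobTaylor_zero (j k : ℕ) : frobTaylor j k 0 = if k = j then 1 else 0 := by
  induction j generalizing k with
  | zero =>
    have h : frobTaylor 0 k 0 = taylorCoeff k fun _ => 1 := by
      unfold frobTaylor
      congr 1
      ext ρ
      simp [frobCoeff_zero]
    rw [h, taylorCoeff, iteratedDeriv_const]
    split_ifs with h0 <;> simp [h0]
  | succ j ih =>
    rw [frobTaylor_succ, ih, ih]
    rcases k with _ | k <;> simp

theorem frobTaylor_rec (k n : ℕ) :
    frobTaylor 4 k (n + 1) = 5 * (625 * frobTaylor 4 k n + 1250 * frobTaylor 3 k n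
      + 875 * frobTaylor 2 k n + 250 * frobTaylor 1 k n + 24 * frobTaylor 0 k n) := by
  have ha := analyticAt_frobCoeff n
  have h : frobTaylor 4 k (n + 1) = taylorCoeff k fun ρ =>
      5 * (625 * ((n + ρ) ^ 4 * frobCoeff n ρ) + 1250 * ((n + ρ) ^ 3 * frobCoeff n ρ)
        + 875 * ((n + ρ) ^ 2 * frobCoeff n ρ) + 250 * ((n + ρ) ^ 1 * frobCoeff n ρ)
        + 24 * ((n + ρ) ^ 0 * frobCoeff n ρ)) := by
    refine taylorCoeff_congr ?_ k
    filter_upwards [Metric.closedBall_mem_nhds (0 : ℂ) (show (0 : ℝ) < 1 / 2 by norm_num)] with ρ hρ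
    rw [← frobCoeff_rec (by simpa using hρ)]
    push_cast
    ring
  rw [h, taylorCoeff_const_mul, taylorCoeff_add, taylorCoeff_add, taylorCoeff_add, taylorCoeff_add]
  · simp only [taylorCoeff_const_mul]
    rfl
  all_goals fun_prop

theorem norm_frobTerm_le {ρ : ℂ} (hρ : ‖ρ‖ ≤ 1 / 2) (j n : ℕ) :
    ‖(n + ρ) ^ j * frobCoeff n ρ‖ ≤ ((n : ℝ) + 1 / 2) ^ j * frobBound n := by
  rw [norm_mul, norm_pow]
  have h : ‖(n + ρ : ℂ)‖ ≤ n + 1 / 2 := by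
    refine (norm_add_le _ _).trans ?_
    rw [Complex.norm_natCast]
    linarith
  exact mul_le_mul (pow_le_pow_left₀ (norm_nonneg _) h j) (norm_frobCoeff_le hρ n) (norm_nonneg _)
    (by positivity)

theorem convOnDisc_frobTaylor (j k : ℕ) : ConvOnDisc (frobTaylor j k) := by
  intro r hr hr'
  refine Summable.of_nonneg_of_le (fun n => by positivity) (fun n => ?_)
    ((summable_frobBound j hr hr').mul_left (2 ^ k))
  have h1 : ‖iteratedDeriv k (fun ρ => ((n : ℂ) + ρ) ^ j * frobCoeff n ρ) 0‖
      ≤ k.factorial * (((n : ℝ) + 1 / 2) ^ j * frobBound n) / (1 / 2) ^ k := by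
    refine Complex.norm_iteratedDeriv_le_of_forall_mem_sphere_norm_le k (by norm_num) ?_ ?_
    · refine DifferentiableOn.diffContOnCl ?_
      rw [closure_ball _ (by norm_num)]
      intro ρ hρ
      have := differentiableAt_frobCoeff (by simpa using hρ) n
      exact DifferentiableAt.differentiableWithinAt (by fun_prop)
    · intro ρ hρ
      exact norm_frobTerm_le (by simpa using (mem_sphere_zero_iff_norm.mp hρ).le) j n
  have hk : (0 : ℝ) < k.factorial := by exact_mod_cast k.factorial_pos
  have h2 : ‖frobTaylor j k n‖ ≤ 2 ^ k * (((n : ℝ) + 1 / 2) ^ j * frobBound n) := by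
    rw [frobTaylor, taylorCoeff, norm_div, Complex.norm_natCast, div_le_iff₀ hk]
    refine h1.trans (le_of_eq ?_)
    rw [one_div_pow]
    field_simp
  calc ‖frobTaylor j k n‖ * r ^ n ≤ 2 ^ k * (((n : ℝ) + 1 / 2) ^ j * frobBound n) * r ^ n := by
        gcongr
    _ = _ := by ring

/-- The holomorphic part of `θʲ` of the `k`-th Frobenius solution (divided by `k!`): the
coefficient of `ρᵏ` in `∑ (n+ρ)ʲ a_n(ρ) zⁿ`. -/
def frobSer (j k : ℕ) : ℂ → ℂ := powSer (frobTaylor j k)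

theorem hasTheta_frobSer (j k : ℕ) {z : ℂ} (hz : ‖z‖ < 1 / 5 ^ 5) :
    HasTheta (frobSer j k) (frobSer (j + 1) k z - if k = 0 then 0 else frobSer j (k - 1) z) z := by
  refine ((convOnDisc_frobTaylor j k).hasTheta hz).congr_theta ?_
  split_ifs with hk
  · subst hk
    rw [sub_zero]
    exact tsum_congr fun n => by simp [frobTaylor_succ]
  · rw [frobSer, frobSer, powSer, powSer, powSer,
      ← ((convOnDisc_frobTaylor (j + 1) k).summable hz).tsum_sub
        ((convOnDisc_frobTaylor j (k - 1)).summable hz)]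
    refine tsum_congr fun n => ?_
    rw [frobTaylor_succ, if_neg hk]
    ring

/-- The recursion `frobCoeff_rec` for the coefficients, as an equation for the sums of the series.
The coefficient at `n = 0` produces the inhomogeneous term. -/
theorem powSer_pf {b : ℕ → ℕ → ℂ} (hb : ∀ j, ConvOnDisc (b j))
    (hrec : ∀ n, b 4 (n + 1) = 5 * (625 * b 4 n + 1250 * b 3 n + 875 * b 2 n + 250 * b 1 n
      + 24 * b 0 n)) {z : ℂ} (hz : ‖z‖ < 1 / 5 ^ 5) :
    powSer (b 4) z = b 4 0 + z * (5 * (625 * powSer (b 4) z + 1250 * powSer (b 3) z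
      + 875 * powSer (b 2) z + 250 * powSer (b 1) z + 24 * powSer (b 0) z)) := by
  have hs := fun j => (hb j).summable hz
  rw [(hb 4).powSer_eq_add hz]
  congr 2
  rw [(hb 4).powSer_eq_add hz |>.symm]
  simp only [powSer]
  rw [← tsum_mul_left, ← tsum_mul_left, ← tsum_mul_left, ← tsum_mul_left, ← tsum_mul_left,
    ← ((hs 4).mul_left 625).tsum_add ((hs 3).mul_left 1250),
    ← (((hs 4).mul_left 625).add ((hs 3).mul_left 1250)).tsum_add ((hs 2).mul_left 875),
    ← ((((hs 4).mul_left 625).add ((hs 3).mul_left 1250)).add ((hs 2).mul_left 875)).tsum_add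
      ((hs 1).mul_left 250),
    ← (((((hs 4).mul_left 625).add ((hs 3).mul_left 1250)).add ((hs 2).mul_left 875)).add
      ((hs 1).mul_left 250)).tsum_add ((hs 0).mul_left 24), ← tsum_mul_left]
  refine tsum_congr fun n => ?_
  rw [hrec]
  ring

theorem one_sub_ne_zero_of_norm {z : ℂ} (hz : ‖z‖ < 1 / 5 ^ 5) : 1 - 5 ^ 5 * z ≠ 0 := by
  intro h
  have h1 : z = ((1 / 5 ^ 5 : ℝ) : ℂ) := by push_cast; linear_combination (-1 / 5 ^ 5) * h
  rw [h1, Complex.norm_real, Real.norm_of_nonneg (by positivity)] at hz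
  exact lt_irrefl _ hz

/-- For `k < 4` the inhomogeneous term vanishes, since
`(n+ρ)⁴ a_n(ρ)` is divisible by `ρ⁴` at `n = 0`. -/
theorem frobSer_pf {k : ℕ} (hk : k < 4) {z : ℂ} (hz : ‖z‖ < 1 / 5 ^ 5) :
    frobSer 4 k z = xiFun z * (2 * frobSer 3 k z + 7 / 5 * frobSer 2 k z + 2 / 5 * frobSer 1 k z
      + 24 / 625 * frobSer 0 k z) := by
  have h := powSer_pf (fun j => convOnDisc_frobTaylor j k) (frobTaylor_rec k) hz
  rw [frobTaylor_zero, if_neg (by omega)] at h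
  have h1 := one_sub_ne_zero_of_norm hz
  rw [xiFun]
  simp only [frobSer]
  field_simp
  linear_combination 625 * h

/-! ### The quadratic relations between the Frobenius solutions -/

/-- A solution of a fifth order equation `θ⁵a = ∑_{i<5} r_i θⁱa` whose exponents at the origin all
vanish is zero as soon as it is analytic and vanishes at the origin: if `a = z^m g` with
`g(0) ≠ 0`, then `θ⁵a = z^m g₅` with `g₅(0) = m⁵ g(0)`, whereas the right hand side is `z^m` times
a function vanishing at the origin. -/
theorem eventually_eq_zero_of_theta_ode {a : ℕ → ℂ → ℂ} {r : ℕ → ℂ → ℂ}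
    (ha : AnalyticAt ℂ (a 0) 0) (ha0 : a 0 0 = 0)
    (hθ : ∀ i < 5, ∀ᶠ z in 𝓝 0, z * deriv (a i) z = a (i + 1) z)
    (hr : ∀ i < 5, ContinuousAt (r i) 0) (hr0 : ∀ i < 5, r i 0 = 0)
    (hode : ∀ᶠ z in 𝓝 0, a 5 z = ∑ i ∈ Finset.range 5, r i z * a i z) :
    ∀ᶠ z in 𝓝 0, a 0 z = 0 := by
  by_contra hne
  obtain ⟨m, g, hg, hg0, hag⟩ := ha.exists_eventuallyEq_pow_smul_nonzero_iff.mpr hne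
  have hstep : ∀ i ≤ 5, ∃ G : ℂ → ℂ, AnalyticAt ℂ G 0 ∧ G 0 = (m : ℂ) ^ i * g 0 ∧
      ∀ᶠ z in 𝓝 0, a i z = z ^ m * G z := by
    intro i
    induction i with
    | zero =>
      intro _
      exact ⟨g, hg, by simp, by simpa using hag⟩
    | succ i ih =>
      intro hi
      obtain ⟨G, hG, hG0, haG⟩ := ih (by omega)
      refine ⟨fun z => m * G z + z * deriv G z, ?_, ?_, ?_⟩
      · exact (analyticAt_const.mul hG).add (analyticAt_id.mul hG.deriv)
      · simp [hG0, pow_succ]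
        ring
      · filter_upwards [hθ i (by omega), haG.eventually_nhds, hG.eventually_analyticAt]
          with z h1 h2 h3
        have h4 : HasDerivAt (fun z => z ^ m * G z)
            (m * z ^ (m - 1) * G z + z ^ m * deriv G z) z :=
          (hasDerivAt_pow m z).mul h3.differentiableAt.hasDerivAt
        rw [← h1, Filter.EventuallyEq.deriv_eq h2, h4.deriv]
        rcases m with _ | m
        · simp
        · rw [Nat.add_sub_cancel, pow_succ]
          ring
  choose! G hG hG0 haG using hstep
  have hpunct : ∀ᶠ z in 𝓝[≠] 0, G 5 z = ∑ i ∈ Finset.range 5, r i z * G i z := by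
    have hall : ∀ᶠ z in 𝓝 0, ∀ i ∈ Finset.range 6, a i z = z ^ m * G i z :=
      (Filter.eventually_all_finset _).mpr fun i hi =>
        haG i (by have := Finset.mem_range.mp hi; omega)
    filter_upwards [hall.filter_mono nhdsWithin_le_nhds, hode.filter_mono nhdsWithin_le_nhds,
      self_mem_nhdsWithin] with z h1 h2 hz
    have hzm : z ^ m ≠ 0 := pow_ne_zero _ hz
    apply mul_left_cancel₀ hzm
    rw [← h1 5 (by simp), h2, Finset.mul_sum]
    refine Finset.sum_congr rfl fun i hi => ?_
    rw [h1 i (by simp at hi ⊢; omega)]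
    ring
  have hlim1 : Filter.Tendsto (G 5) (𝓝[≠] 0) (𝓝 (G 5 0)) :=
    (hG 5 le_rfl).continuousAt.tendsto.mono_left nhdsWithin_le_nhds
  have hlim2 : Filter.Tendsto (fun z => ∑ i ∈ Finset.range 5, r i z * G i z) (𝓝[≠] 0)
      (𝓝 (∑ i ∈ Finset.range 5, r i 0 * G i 0)) := by
    refine tendsto_finsetSum _ fun i hi => ?_
    have hi' := Finset.mem_range.mp hi
    exact ((hr i hi').mul (hG i hi'.le).continuousAt).tendsto.mono_left nhdsWithin_le_nhds
  have heq := tendsto_nhds_unique hlim1 (hlim2.congr' (hpunct.mono fun _ h => h.symm))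
  rw [Finset.sum_eq_zero fun i hi => by rw [hr0 i (Finset.mem_range.mp hi), zero_mul],
    hG0 5 le_rfl] at heq
  have hm : m = 0 := by
    have := (mul_eq_zero.mp heq).resolve_right hg0
    exact_mod_cast pow_eq_zero_iff (by norm_num) |>.mp this
  have h0 := hag.self_of_nhds
  rw [hm, ha0] at h0
  simp at h0
  exact hg0 h0.symm

/-- The pairing `∑_i (-1)^i (θʲω)_i (θᵏω)_{3-i}` of the Frobenius solutions; the logarithms cancel,
so that only the holomorphic parts enter. -/
def frobPair (j k : ℕ) (z : ℂ) : ℂ :=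
  frobSer j 0 z * frobSer k 3 z - frobSer j 1 z * frobSer k 2 z + frobSer j 2 z * frobSer k 1 z
    - frobSer j 3 z * frobSer k 0 z

theorem hasTheta_frobPair (j k : ℕ) {z : ℂ} (hz : ‖z‖ < 1 / 5 ^ 5) :
    HasTheta (frobPair j k) (frobPair (j + 1) k z + frobPair j (k + 1) z) z := by
  have h := fun j i => hasTheta_frobSer j i hz
  refine HasTheta.congr_theta (((((h j 0).mul (h k 3)).sub ((h j 1).mul (h k 2))).add
    ((h j 2).mul (h k 1))).sub ((h j 3).mul (h k 0))) ?_
  simp [frobPair]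
  ring

theorem frobPair_four_left (k : ℕ) {z : ℂ} (hz : ‖z‖ < 1 / 5 ^ 5) :
    frobPair 4 k z = xiFun z * (2 * frobPair 3 k z + 7 / 5 * frobPair 2 k z
      + 2 / 5 * frobPair 1 k z + 24 / 625 * frobPair 0 k z) := by
  simp only [frobPair]
  rw [frobSer_pf (by norm_num : 0 < 4) hz, frobSer_pf (by norm_num : 1 < 4) hz,
    frobSer_pf (by norm_num : 2 < 4) hz, frobSer_pf (by norm_num : 3 < 4) hz]
  ring

theorem frobPair_swap (j k : ℕ) (z : ℂ) : frobPair j k z = -frobPair k j z := by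
  simp only [frobPair]
  ring

theorem frobPair_self (j : ℕ) (z : ℂ) : frobPair j j z = 0 := by
  simp only [frobPair]
  ring

theorem frobPair_at_zero (j k : ℕ) : frobPair j k 0
    = (if j = 0 ∧ k = 3 then 1 else 0) - (if j = 1 ∧ k = 2 then 1 else 0)
      + (if j = 2 ∧ k = 1 then 1 else 0) - (if j = 3 ∧ k = 0 then 1 else 0) := by
  simp only [frobPair, frobSer, powSer_zero, frobTaylor_zero, eq_comm (b := j), eq_comm (b := k)]
  simp only [ite_and, ite_mul, one_mul, zero_mul]

/-- `θ³⟨ω, θω⟩`, reduced by the Picard–Fuchs equation. -/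
def frobPairTheta₃ (z : ℂ) : ℂ :=
  2 * frobPair 1 3 z + xiFun z * (2 * frobPair 0 3 z + 7 / 5 * frobPair 0 2 z
    + 2 / 5 * frobPair 0 1 z)

/-- `θ⁴⟨ω, θω⟩`, reduced by the Picard–Fuchs equation. -/
def frobPairTheta₄ (z : ℂ) : ℂ :=
  2 * frobPair 2 3 z - 4 / 5 * xiFun z * frobPair 0 3 z
    + xiFun z * (3 * frobPairTheta₃ z + 21 / 5 * (frobPair 0 3 z + frobPair 1 2 z)
      + 9 / 5 * frobPair 0 2 z + 202 / 625 * frobPair 0 1 z)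

/-- `θⁱ⟨ω, θω⟩` for `i ≤ 5`, reduced by the Picard–Fuchs equation. The last line is the fifth order
equation of the pairing. -/
def frobPairTheta : ℕ → ℂ → ℂ
  | 0 => frobPair 0 1
  | 1 => frobPair 0 2
  | 2 => fun z => frobPair 0 3 z + frobPair 1 2 z
  | 3 => frobPairTheta₃
  | 4 => frobPairTheta₄
  | _ => fun z => 5 * xiFun z * frobPairTheta₄ z
      + (34 / 5 * xiFun z - 3 * xiFun z ^ 2) * frobPairTheta₃ z
      + (26 / 5 * xiFun z - 21 / 5 * xiFun z ^ 2) * (frobPair 0 3 z + frobPair 1 2 z)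
      + (1279 / 625 * xiFun z - 59 / 25 * xiFun z ^ 2) * frobPair 0 2 z
      + (202 / 625 * xiFun z - 302 / 625 * xiFun z ^ 2) * frobPair 0 1 z

theorem hasTheta_frobPairTheta {i : ℕ} (hi : i < 5) {z : ℂ} (hz : ‖z‖ < 1 / 5 ^ 5) :
    HasTheta (frobPairTheta i) (frobPairTheta (i + 1) z) z := by
  have h := fun j k => hasTheta_frobPair j k hz
  have hξ := hasTheta_xiFun (one_sub_ne_zero_of_norm hz)
  have e04 : frobPair 0 4 z = _ := (frobPair_swap 0 4 z).trans
    (congrArg Neg.neg (frobPair_four_left 0 hz))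
  have e14 : frobPair 1 4 z = _ := (frobPair_swap 1 4 z).trans
    (congrArg Neg.neg (frobPair_four_left 1 hz))
  have e24 : frobPair 2 4 z = _ := (frobPair_swap 2 4 z).trans
    (congrArg Neg.neg (frobPair_four_left 2 hz))
  simp only [frobPair_self, frobPair_swap 3 _ z, frobPair_swap 2 0 z, frobPair_swap 2 1 z,
    frobPair_swap 1 0 z] at e04 e14 e24
  have h3 : HasTheta (frobPairTheta 3) (frobPairTheta 4 z) z := by
    refine HasTheta.congr_theta (((h 1 3).const_mul 2).add (hξ.mul ((((h 0 3).const_mul 2).add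
      ((h 0 2).const_mul (7 / 5))).add ((h 0 1).const_mul (2 / 5))))) ?_
    simp only [frobPairTheta, frobPairTheta₃, frobPairTheta₄, frobPair_self, e04, e14]
    ring
  have h2 : HasTheta (frobPairTheta 2) (frobPairTheta 3 z) z := by
    refine HasTheta.congr_theta ((h 0 3).add (h 1 2)) ?_
    simp only [frobPairTheta, frobPairTheta₃, frobPair_self, e04]
    ring
  interval_cases i
  · refine HasTheta.congr_theta (h 0 1) ?_
    simp only [frobPairTheta, frobPair_self]
    ring
  · refine HasTheta.congr_theta (h 0 2) ?_
    simp only [frobPairTheta]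
    ring
  · exact h2
  · exact h3
  · refine HasTheta.congr_theta ((((h 2 3).const_mul 2).sub ((hξ.const_mul (4 / 5)).mul
      (h 0 3))).add (hξ.mul ((((h3.const_mul 3).add (h2.const_mul (21 / 5))).add
        ((h 0 2).const_mul (9 / 5))).add ((h 0 1).const_mul (202 / 625))))) ?_
    simp only [frobPairTheta, frobPairTheta₃, frobPairTheta₄, frobPair_self, e04, e24]
    ring

/-- The vanishing of `⟨ω, θω⟩`. The Picard–Fuchs equation of order four implies an equation of
order five for this pairing, to which `eventually_eq_zero_of_theta_ode` applies. -/
theorem frobPair_zero_one {z : ℂ} (hz : ‖z‖ < 1 / 5 ^ 5) : frobPair 0 1 z = 0 := by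
  have hball : ∀ {y : ℂ}, y ∈ Metric.ball (0 : ℂ) (1 / 5 ^ 5) → ‖y‖ < 1 / 5 ^ 5 := by
    intro y hy
    simpa using hy
  have han : AnalyticOnNhd ℂ (frobPair 0 1) (Metric.ball 0 (1 / 5 ^ 5)) := by
    refine DifferentiableOn.analyticOnNhd (fun y hy => ?_) Metric.isOpen_ball
    exact (hasTheta_frobPair 0 1 (hball hy)).differentiableAt.differentiableWithinAt
  have hmem : (0 : ℂ) ∈ Metric.ball (0 : ℂ) (1 / 5 ^ 5) := by simp
  have hnear : ∀ᶠ y in 𝓝 (0 : ℂ), ‖y‖ < 1 / 5 ^ 5 :=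
    (Metric.isOpen_ball.mem_nhds hmem : Metric.ball (0 : ℂ) (1 / 5 ^ 5) ∈ 𝓝 0) |> fun h =>
      Filter.mem_of_superset h fun y hy => hball hy
  have hξ : ContinuousAt xiFun 0 :=
    (hasTheta_xiFun (by simp)).differentiableAt.continuousAt
  have hξ0 : xiFun 0 = 0 := by simp [xiFun]
  have hev : ∀ᶠ y in 𝓝 (0 : ℂ), frobPairTheta 0 y = 0 := by
    refine eventually_eq_zero_of_theta_ode (a := frobPairTheta) (r := fun i y => match i with
      | 0 => 202 / 625 * xiFun y - 302 / 625 * xiFun y ^ 2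
      | 1 => 1279 / 625 * xiFun y - 59 / 25 * xiFun y ^ 2
      | 2 => 26 / 5 * xiFun y - 21 / 5 * xiFun y ^ 2
      | 3 => 34 / 5 * xiFun y - 3 * xiFun y ^ 2
      | _ => 5 * xiFun y) (han 0 hmem) ?_ ?_ ?_ ?_ ?_
    · simp only [frobPairTheta]
      simp [frobPair_at_zero]
    · intro i hi
      filter_upwards [hnear] with y hy
      exact (hasTheta_frobPairTheta hi hy).mul_deriv
    · intro i hi
      interval_cases i <;> simp only <;> fun_prop
    · intro i hi
      interval_cases i <;> simp [hξ0]
    · refine Filter.Eventually.of_forall fun y => ?_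
      simp only [Finset.sum_range_succ, Finset.sum_range_zero, frobPairTheta]
      ring
  exact han.eqOn_of_preconnected_of_eventuallyEq analyticOnNhd_const
    (convex_ball _ _).isPreconnected hmem hev (by simpa using hz)

/-- Logarithmic derivatives of functions that agree on the disc of convergence agree. -/
theorem theta_eq_of_eqOn_disc {f g : ℂ → ℂ} {a b z : ℂ} (hz : ‖z‖ < 1 / 5 ^ 5)
    (h : ∀ y : ℂ, ‖y‖ < 1 / 5 ^ 5 → f y = g y) (hf : HasTheta f a z) (hg : HasTheta g b z) :
    a = b := by
  have hmem : z ∈ Metric.ball (0 : ℂ) (1 / 5 ^ 5) := by simpa using hz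
  have : f =ᶠ[𝓝 z] g := by
    filter_upwards [Metric.isOpen_ball.mem_nhds hmem] with y hy
    exact h y (by simpa using hy)
  rw [← hf.mul_deriv, ← hg.mul_deriv, this.deriv_eq]

theorem frobPair_zero_two {z : ℂ} (hz : ‖z‖ < 1 / 5 ^ 5) : frobPair 0 2 z = 0 := by
  have h := theta_eq_of_eqOn_disc hz (fun y => frobPair_zero_one) (hasTheta_frobPair 0 1 hz)
    (HasTheta.const 0 z)
  rwa [frobPair_self, zero_add] at h

theorem frobPair_one_two {z : ℂ} (hz : ‖z‖ < 1 / 5 ^ 5) : frobPair 1 2 z = -frobPair 0 3 z := by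
  have h := theta_eq_of_eqOn_disc hz (fun y => frobPair_zero_two) (hasTheta_frobPair 0 2 hz)
    (HasTheta.const 0 z)
  linear_combination h

theorem frobPair_one_three {z : ℂ} (hz : ‖z‖ < 1 / 5 ^ 5) :
    frobPair 1 3 z = -xiFun z * frobPair 0 3 z := by
  have h := theta_eq_of_eqOn_disc hz (fun y hy => (eq_neg_iff_add_eq_zero.mp (frobPair_one_two hy)))
    ((hasTheta_frobPair 1 2 hz).add (hasTheta_frobPair 0 3 hz)) (HasTheta.const 0 z)
  have e := frobPair_four_left 0 hz
  rw [frobPair_swap 4, frobPair_swap 3, frobPair_swap 2, frobPair_swap 1, frobPair_zero_one hz,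
    frobPair_zero_two hz, frobPair_self] at e
  rw [frobPair_self] at h
  linear_combination h / 2 + e / 2

/-- By the Picard–Fuchs equation the function `(1 - 5⁵z) ⟨ω, θ³ω⟩` is constant. -/
theorem frobPair_zero_three {z : ℂ} (hz : ‖z‖ < 1 / 5 ^ 5) :
    frobPair 0 3 z = 1 / (1 - 5 ^ 5 * z) := by
  have hθ : ∀ {y : ℂ}, ‖y‖ < 1 / 5 ^ 5 →
      HasTheta (fun y => (1 - 5 ^ 5 * y) * frobPair 0 3 y) 0 y := by
    intro y hy
    have h1 := one_sub_ne_zero_of_norm hy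
    have e := frobPair_four_left 0 hy
    rw [frobPair_swap 4, frobPair_swap 3, frobPair_swap 2, frobPair_swap 1, frobPair_zero_one hy,
      frobPair_zero_two hy, frobPair_self] at e
    have hlin : HasTheta (fun y : ℂ => 1 - 5 ^ 5 * y) (-5 ^ 5 * y) y :=
      ⟨_, ((hasDerivAt_id y).const_mul (5 ^ 5 : ℂ)).const_sub 1, by ring⟩
    refine (hlin.mul (hasTheta_frobPair 0 3 hy)).congr_theta ?_
    have hx : (1 - 5 ^ 5 * y) * xiFun y = 5 ^ 5 * y := by
      rw [xiFun]
      field_simp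
    rw [frobPair_one_three hy]
    linear_combination (-(1 - 5 ^ 5 * y)) * e + frobPair 0 3 y * hx
  have hdiff : DifferentiableOn ℂ (fun y => (1 - 5 ^ 5 * y) * frobPair 0 3 y)
      (Metric.ball 0 (1 / 5 ^ 5)) := fun y hy =>
    (hθ (by simpa using hy)).differentiableAt.differentiableWithinAt
  have hmem : (0 : ℂ) ∈ Metric.ball (0 : ℂ) (1 / 5 ^ 5) := by simp
  have hd0 : ∀ y ∈ Metric.ball (0 : ℂ) (1 / 5 ^ 5),
      deriv (fun y => (1 - 5 ^ 5 * y) * frobPair 0 3 y) y = 0 := by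
    have hne : ∀ y ∈ Metric.ball (0 : ℂ) (1 / 5 ^ 5), y ≠ 0 →
        deriv (fun y => (1 - 5 ^ 5 * y) * frobPair 0 3 y) y = 0 := fun y hy hy0 =>
      (mul_eq_zero.mp (hθ (by simpa using hy)).mul_deriv).resolve_left hy0
    intro y hy
    rcases eq_or_ne y 0 with rfl | hy0
    · have hcont := ((hdiff.deriv Metric.isOpen_ball).continuousOn.continuousAt
        (Metric.isOpen_ball.mem_nhds hmem)).tendsto.mono_left
        (nhdsWithin_le_nhds (s := {(0 : ℂ)}ᶜ))
      refine tendsto_nhds_unique hcont (tendsto_const_nhds.congr' ?_)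
      filter_upwards [self_mem_nhdsWithin, nhdsWithin_le_nhds (Metric.isOpen_ball.mem_nhds hmem)]
        with y h1 h2
      exact (hne y h2 h1).symm
    · exact hne y hy hy0
  have hconst := (convex_ball (0 : ℂ) (1 / 5 ^ 5)).is_const_of_fderivWithin_eq_zero (𝕜 := ℂ) hdiff
    (fun y hy => by
      rw [fderivWithin_of_isOpen Metric.isOpen_ball hy]
      ext
      simpa using hd0 y hy)
    (show z ∈ Metric.ball (0 : ℂ) (1 / 5 ^ 5) by simpa using hz) hmem
  rw [frobPair_at_zero] at hconst
  simp at hconst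
  rw [eq_div_iff (one_sub_ne_zero_of_norm hz)]
  linear_combination hconst

theorem frobPair_two_three {z : ℂ} (hz : ‖z‖ < 1 / 5 ^ 5) :
    frobPair 2 3 z = 2 / 5 * xiFun z * frobPair 0 3 z := by
  have h1 := one_sub_ne_zero_of_norm hz
  have h := theta_eq_of_eqOn_disc hz
    (fun y hy => (eq_neg_iff_add_eq_zero.mp ((frobPair_one_three hy).trans (neg_mul _ _))))
    ((hasTheta_frobPair 1 3 hz).add ((hasTheta_xiFun h1).mul (hasTheta_frobPair 0 3 hz)))
    (HasTheta.const 0 z)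
  have e0 := frobPair_four_left 0 hz
  have e1 := frobPair_four_left 1 hz
  rw [frobPair_swap 4, frobPair_swap 3, frobPair_swap 2, frobPair_swap 1, frobPair_zero_one hz,
    frobPair_zero_two hz, frobPair_self] at e0
  rw [frobPair_swap 4, frobPair_swap 3, frobPair_swap 2, frobPair_one_two hz, frobPair_self,
    frobPair_zero_one hz] at e1
  rw [frobPair_one_three hz] at e1 h
  linear_combination h + e1 + xiFun z * e0

/-! ### Periods and tension on the slit disc -/

/-- `θʲ` of the `i`-th Frobenius solution, divided by `i!`. -/
def frobSol (j i : ℕ) (z : ℂ) : ℂ :=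
  ∑ m ∈ Finset.range (i + 1), Complex.log z ^ m / m.factorial * frobSer j (i - m) z

theorem hasTheta_log {z : ℂ} (hz : z ∈ Complex.slitPlane) : HasTheta Complex.log 1 z :=
  ⟨_, Complex.hasDerivAt_log hz, mul_inv_cancel₀ (Complex.slitPlane_ne_zero hz)⟩

theorem hasTheta_frobSol (j : ℕ) {i : ℕ} (hi : i < 4) {z : ℂ} (hz : ‖z‖ < 1 / 5 ^ 5)
    (hs : z ∈ Complex.slitPlane) : HasTheta (frobSol j i) (frobSol (j + 1) i z) z := by
  have h := fun k => hasTheta_frobSer j k hz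
  have hl := hasTheta_log hs
  have e0 : frobSol j 0 = frobSer j 0 := by
    ext y
    simp [frobSol]
  have e1 : frobSol j 1 = fun y => frobSer j 1 y + Complex.log y * frobSer j 0 y := by
    ext y
    simp [frobSol, Finset.sum_range_succ]
  have e2 : frobSol j 2 = fun y => frobSer j 2 y + Complex.log y * frobSer j 1 y
      + 1 / 2 * Complex.log y ^ 2 * frobSer j 0 y := by
    ext y
    simp only [frobSol, Finset.sum_range_succ, Nat.factorial, Finset.sum_range_zero]
    push_cast
    ring
  have e3 : frobSol j 3 = fun y => frobSer j 3 y + Complex.log y * frobSer j 2 y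
      + 1 / 2 * Complex.log y ^ 2 * frobSer j 1 y + 1 / 6 * Complex.log y ^ 3 * frobSer j 0 y := by
    ext y
    simp [frobSol, Finset.sum_range_succ, Nat.factorial]
    ring
  interval_cases i
  · rw [e0]
    refine (h 0).congr_theta ?_
    simp [frobSol]
  · rw [e1]
    refine ((h 1).add (hl.mul (h 0))).congr_theta ?_
    simp [frobSol, Finset.sum_range_succ]
    ring
  · rw [e2]
    refine (((h 2).add (hl.mul (h 1))).add (((hl.pow 2).const_mul (1 / 2)).mul
      (h 0))).congr_theta ?_
    simp [frobSol, Finset.sum_range_succ, Nat.factorial]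
    ring
  · rw [e3]
    refine ((((h 3).add (hl.mul (h 2))).add (((hl.pow 2).const_mul (1 / 2)).mul (h 1))).add
      (((hl.pow 3).const_mul (1 / 6)).mul (h 0))).congr_theta ?_
    simp [frobSol, Finset.sum_range_succ, Nat.factorial]
    ring

theorem frobSol_pf {i : ℕ} (hi : i < 4) {z : ℂ} (hz : ‖z‖ < 1 / 5 ^ 5) :
    frobSol 4 i z = xiFun z * (2 * frobSol 3 i z + 7 / 5 * frobSol 2 i z + 2 / 5 * frobSol 1 i z
      + 24 / 625 * frobSol 0 i z) := by
  simp only [frobSol, Finset.mul_sum, ← Finset.sum_add_distrib]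
  refine Finset.sum_congr rfl fun m _ => ?_
  rw [frobSer_pf (by omega) hz]
  ring

theorem frobSol_pair (j k : ℕ) (z : ℂ) :
    frobSol j 0 z * frobSol k 3 z - frobSol j 1 z * frobSol k 2 z + frobSol j 2 z * frobSol k 1 z
      - frobSol j 3 z * frobSol k 0 z = frobPair j k z := by
  simp only [frobSol, frobPair, Finset.sum_range_succ, Nat.factorial, Finset.sum_range_zero]
  push_cast
  ring

theorem taylorCoeff_exp_mul (c : ℂ) (k : ℕ) :
    taylorCoeff k (fun ρ => Complex.exp (c * ρ)) = c ^ k / k.factorial := by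
  rw [taylorCoeff, iteratedDeriv_cexp_const_mul]
  simp

/-- Expansion of `z^{n+ρ} = zⁿ exp(ρ log z)` in powers of `ρ`. -/
theorem frobenius_eq (i : ℕ) {z : ℂ} (hz : ‖z‖ < 1 / 5 ^ 5) (hs : z ∈ Complex.slitPlane) :
    frobenius i z = i.factorial * frobSol 0 i z := by
  have hz0 := Complex.slitPlane_ne_zero hs
  have hterm : ∀ n : ℕ, iteratedDeriv i (fun ρ : ℂ => (ascPochhammer ℂ (5 * n)).eval (5 * ρ + 1)
      / (ascPochhammer ℂ n).eval (ρ + 1) ^ 5 * z ^ ((n : ℂ) + ρ)) 0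
      = i.factorial * ∑ m ∈ Finset.range (i + 1), Complex.log z ^ m / m.factorial
        * (frobTaylor 0 (i - m) n * z ^ n) := by
    intro n
    have h1 : (fun ρ : ℂ => (ascPochhammer ℂ (5 * n)).eval (5 * ρ + 1)
        / (ascPochhammer ℂ n).eval (ρ + 1) ^ 5 * z ^ ((n : ℂ) + ρ))
        = fun ρ => z ^ n * (Complex.exp (Complex.log z * ρ) * frobCoeff n ρ) := by
      ext ρ
      rw [Complex.cpow_add _ _ hz0, Complex.cpow_natCast, Complex.cpow_def_of_ne_zero hz0,
        frobCoeff]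
      ring
    have hi : (i.factorial : ℂ) ≠ 0 := by exact_mod_cast i.factorial_ne_zero
    rw [h1, ← mul_div_cancel₀ (iteratedDeriv i _ 0) hi, ← taylorCoeff, taylorCoeff_const_mul,
      taylorCoeff_mul (by fun_prop) (analyticAt_frobCoeff n), Finset.mul_sum]
    congr 1
    refine Finset.sum_congr rfl fun m _ => ?_
    rw [taylorCoeff_exp_mul, frobTaylor]
    simp only [pow_zero, one_mul]
    ring
  rw [frobenius, tsum_congr hterm, tsum_mul_left, Summable.tsum_finsetSum]
  · simp only [tsum_mul_left]
    rfl
  · exact fun m _ => ((convOnDisc_frobTaylor 0 (i - m)).summable hz).mul_left _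

theorem hasTheta_cpow_half {z : ℂ} (hs : z ∈ Complex.slitPlane) :
    HasTheta (fun y => y ^ (1 / 2 : ℂ)) (1 / 2 * z ^ (1 / 2 : ℂ)) z := by
  have hz0 := Complex.slitPlane_ne_zero hs
  refine ⟨_, (hasDerivAt_id z).cpow_const hs, ?_⟩
  simp only [id]
  rw [Complex.cpow_sub _ _ hz0, Complex.cpow_one]
  field_simp

/-- The coefficients of `θʲ` of the domain-wall tension. -/
def tauCoeff (j n : ℕ) : ℂ := (n + 1 / 2) ^ j * frobCoeff n (1 / 2)

/-- `θʲ τ` on the slit disc. -/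
def tauSol (j : ℕ) (z : ℂ) : ℂ := z ^ (1 / 2 : ℂ) * powSer (tauCoeff j) z

theorem convOnDisc_tauCoeff (j : ℕ) : ConvOnDisc (tauCoeff j) := by
  intro r hr hr'
  refine Summable.of_nonneg_of_le (fun n => by positivity) (fun n => ?_)
    (summable_frobBound j hr hr')
  exact mul_le_mul_of_nonneg_right (norm_frobTerm_le (by norm_num) j n) (by positivity)

theorem hasTheta_tauSol (j : ℕ) {z : ℂ} (hz : ‖z‖ < 1 / 5 ^ 5) (hs : z ∈ Complex.slitPlane) :
    HasTheta (tauSol j) (tauSol (j + 1) z) z := by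
  refine ((hasTheta_cpow_half hs).mul ((convOnDisc_tauCoeff j).hasTheta hz)).congr_theta ?_
  have h : powSer (tauCoeff (j + 1)) z
      = powSer (fun n => n * tauCoeff j n) z + 1 / 2 * powSer (tauCoeff j) z := by
    have h1 : Summable fun n : ℕ => (n * tauCoeff j n : ℂ) * z ^ n := by
      refine (((convOnDisc_tauCoeff (j + 1)).summable hz).sub
        (((convOnDisc_tauCoeff j).summable hz).mul_left (1 / 2))).congr fun n => ?_
      simp only [tauCoeff]
      ring
    simp only [powSer]
    rw [← tsum_mul_left, ← h1.tsum_add (((convOnDisc_tauCoeff j).summable hz).mul_left (1 / 2))]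
    refine tsum_congr fun n => ?_
    simp only [tauCoeff]
    ring
  rw [tauSol, h]
  ring

/-- The inhomogeneous term comes from the coefficient `(1/2)⁴` of `θ⁴` at `n = 0`. -/
theorem tauSol_pf {z : ℂ} (hz : ‖z‖ < 1 / 5 ^ 5) :
    tauSol 4 z = xiFun z * (2 * tauSol 3 z + 7 / 5 * tauSol 2 z + 2 / 5 * tauSol 1 z
      + 24 / 625 * tauSol 0 z) + 1 / 16 * z ^ (1 / 2 : ℂ) / (1 - 5 ^ 5 * z) := by
  have hrec : ∀ n, tauCoeff 4 (n + 1) = 5 * (625 * tauCoeff 4 n + 1250 * tauCoeff 3 n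
      + 875 * tauCoeff 2 n + 250 * tauCoeff 1 n + 24 * tauCoeff 0 n) := by
    intro n
    have h := frobCoeff_rec (show ‖(1 / 2 : ℂ)‖ ≤ 1 / 2 by norm_num) n
    simp only [tauCoeff]
    push_cast
    exact h
  have h := powSer_pf convOnDisc_tauCoeff hrec hz
  have h0 : tauCoeff 4 0 = 1 / 16 := by
    rw [tauCoeff, frobCoeff_zero]
    norm_num
  rw [h0] at h
  have h1 := one_sub_ne_zero_of_norm hz
  simp only [tauSol, xiFun]
  field_simp
  linear_combination 10000 * z ^ (1 / 2 : ℂ) * h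

theorem tau_eq {z : ℂ} (hs : z ∈ Complex.slitPlane) : tau z = tauSol 0 z := by
  have hz0 := Complex.slitPlane_ne_zero hs
  rw [tau, tauSol, powSer, ← tsum_mul_left]
  refine tsum_congr fun n => ?_
  rw [Complex.cpow_add _ _ hz0, Complex.cpow_natCast, tauCoeff, frobCoeff]
  norm_num
  ring

/-! ### Wirtinger calculus -/

/-- `f` is real differentiable at `z` with `z ∂f/∂z = a` and `∂f/∂z̄ = b`. -/
structure HasWirtinger (f : ℂ → ℂ) (a b z : ℂ) : Prop where
  differentiableAt : DifferentiableAt ℝ f z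
  theta_eq : theta f z = a
  dzbar_eq : dzbar f z = b

theorem dz_congr {f g : ℂ → ℂ} {z : ℂ} (h : f =ᶠ[𝓝 z] g) : dz f z = dz g z := by
  rw [dz, dz, h.fderiv_eq]

theorem dzbar_congr {f g : ℂ → ℂ} {z : ℂ} (h : f =ᶠ[𝓝 z] g) : dzbar f z = dzbar g z := by
  rw [dzbar, dzbar, h.fderiv_eq]

theorem theta_congr {f g : ℂ → ℂ} {z : ℂ} (h : f =ᶠ[𝓝 z] g) : theta f z = theta g z := by
  rw [theta, theta, dz_congr h]

namespace HasWirtinger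

variable {f g : ℂ → ℂ} {a b c d z : ℂ}

theorem congr (hf : HasWirtinger f a b z) (h : g =ᶠ[𝓝 z] f) : HasWirtinger g a b z :=
  ⟨hf.1.congr_of_eventuallyEq h, (theta_congr h).trans hf.2, (dzbar_congr h).trans hf.3⟩

theorem congr_val (hf : HasWirtinger f a b z) (ha : a = c) (hb : b = d) : HasWirtinger f c d z :=
  ha ▸ hb ▸ hf

theorem of_differentiableAt (hf : DifferentiableAt ℝ f z) :
    HasWirtinger f (theta f z) (dzbar f z) z := ⟨hf, rfl, rfl⟩

theorem const (c z : ℂ) : HasWirtinger (fun _ => c) 0 0 z := by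
  refine ⟨by fun_prop, ?_, ?_⟩ <;> simp [theta, dz, dzbar]

theorem add (hf : HasWirtinger f a b z) (hg : HasWirtinger g c d z) :
    HasWirtinger (fun y => f y + g y) (a + c) (b + d) z := by
  obtain ⟨hf, rfl, rfl⟩ := hf
  obtain ⟨hg, rfl, rfl⟩ := hg
  refine ⟨hf.add hg, ?_, ?_⟩ <;> simp only [theta, dz, dzbar] <;> rw [fderiv_fun_add hf hg] <;>
    simp only [add_apply] <;> ring

theorem mul (hf : HasWirtinger f a b z) (hg : HasWirtinger g c d z) :
    HasWirtinger (fun y => f y * g y) (a * g z + f z * c) (b * g z + f z * d) z := by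
  obtain ⟨hf, rfl, rfl⟩ := hf
  obtain ⟨hg, rfl, rfl⟩ := hg
  refine ⟨hf.mul hg, ?_, ?_⟩ <;> simp only [theta, dz, dzbar] <;> rw [fderiv_fun_mul hf hg] <;>
    simp only [add_apply, smul_apply, smul_eq_mul] <;> ring

/-- Composition with a holomorphic function. -/
theorem comp {φ : ℂ → ℂ} {φ' : ℂ} (hφ : HasDerivAt φ φ' (f z)) (hf : HasWirtinger f a b z) :
    HasWirtinger (fun y => φ (f y)) (φ' * a) (φ' * b) z := by
  obtain ⟨hf, rfl, rfl⟩ := hf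
  have h := (hφ.hasFDerivAt.restrictScalars ℝ).comp z hf.hasFDerivAt
  refine ⟨h.differentiableAt, ?_, ?_⟩ <;> simp only [theta, dz, dzbar] <;>
    rw [show (fun y => φ (f y)) = φ ∘ f from rfl, h.fderiv] <;> simp <;> ring

theorem const_mul (k : ℂ) (hf : HasWirtinger f a b z) :
    HasWirtinger (fun y => k * f y) (k * a) (k * b) z :=
  ((const k z).mul hf).congr_val (by ring) (by ring)

theorem neg (hf : HasWirtinger f a b z) : HasWirtinger (fun y => -f y) (-a) (-b) z :=
  ((hf.const_mul (-1)).congr (.of_forall fun y => by ring)).congr_val (by ring) (by ring)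

theorem sub (hf : HasWirtinger f a b z) (hg : HasWirtinger g c d z) :
    HasWirtinger (fun y => f y - g y) (a - c) (b - d) z :=
  ((hf.add hg.neg).congr (.of_forall fun y => by ring)).congr_val (by ring) (by ring)

theorem inv (hf : HasWirtinger f a b z) (h : f z ≠ 0) :
    HasWirtinger (fun y => (f y)⁻¹) (-a / f z ^ 2) (-b / f z ^ 2) z :=
  (hf.comp (hasDerivAt_inv h)).congr_val (by ring) (by ring)

theorem div (hf : HasWirtinger f a b z) (hg : HasWirtinger g c d z) (h : g z ≠ 0) :
    HasWirtinger (fun y => f y / g y) ((a * g z - f z * c) / g z ^ 2)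
      ((b * g z - f z * d) / g z ^ 2) z :=
  (hf.mul (hg.inv h)).congr_val (by field_simp; ring) (by field_simp; ring)

theorem pow (hf : HasWirtinger f a b z) (n : ℕ) :
    HasWirtinger (fun y => f y ^ n) (n * f z ^ (n - 1) * a) (n * f z ^ (n - 1) * b) z :=
  hf.comp (hasDerivAt_pow n (f z))

theorem zpow (hf : HasWirtinger f a b z) (n : ℤ) (h : f z ≠ 0) :
    HasWirtinger (fun y => f y ^ n) (n * f z ^ (n - 1) * a) (n * f z ^ (n - 1) * b) z :=
  hf.comp (hasDerivAt_zpow n (f z) (.inl h))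

end HasWirtinger

theorem HasTheta.hasWirtinger {f : ℂ → ℂ} {a z : ℂ} (h : HasTheta f a z) :
    HasWirtinger f a 0 z := by
  obtain ⟨f', h, rfl⟩ := h
  have h' := h.hasFDerivAt.restrictScalars ℝ
  have h1 : fderiv ℝ f z 1 = f' := by simp [h'.fderiv]
  have hI : fderiv ℝ f z Complex.I = Complex.I * f' := by simp [h'.fderiv]
  refine ⟨h'.differentiableAt, ?_, ?_⟩
  · rw [theta, dz, h1, hI]
    linear_combination (-z * f' / 2) * Complex.I_mul_I
  · rw [dzbar, h1, hI]
    linear_combination (f' / 2) * Complex.I_mul_I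

theorem dz_conj (f : ℂ → ℂ) (z : ℂ) : dz (fun y => conj (f y)) z = conj (dzbar f z) := by
  have h : fderiv ℝ (fun y => conj (f y)) z
      = (Complex.conjCLE : ℂ →L[ℝ] ℂ).comp (fderiv ℝ f z) :=
    Complex.conjCLE.comp_fderiv
  simp [dz, dzbar, h, map_ofNat, sub_eq_add_neg]

theorem dzbar_conj (f : ℂ → ℂ) (z : ℂ) : dzbar (fun y => conj (f y)) z = conj (dz f z) := by
  have h : fderiv ℝ (fun y => conj (f y)) z
      = (Complex.conjCLE : ℂ →L[ℝ] ℂ).comp (fderiv ℝ f z) :=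
    Complex.conjCLE.comp_fderiv
  simp [dz, dzbar, h, map_ofNat]

theorem HasWirtinger.conj {f : ℂ → ℂ} {a b z : ℂ} (h : HasWirtinger f a b z) (hz : z ≠ 0) :
    HasWirtinger (fun y => conj (f y)) (z * conj b) (conj (a / z)) z := by
  obtain ⟨hf, rfl, rfl⟩ := h
  refine ⟨Complex.conjCLE.differentiableAt.comp z hf, ?_, ?_⟩
  · rw [theta, dz_conj]
  · rw [dzbar_conj, theta, mul_div_cancel_left₀ _ hz]

theorem hasTheta_id (z : ℂ) : HasTheta (fun y => y) z z := ⟨1, hasDerivAt_id z, mul_one z⟩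

theorem hasWirtinger_conj {z : ℂ} (hz : z ≠ 0) : HasWirtinger (fun y => conj y) 0 1 z :=
  ((hasTheta_id z).hasWirtinger.conj hz).congr_val (by simp) (by simp [hz])

/-! ### Period vectors -/

/-- The symplectic form on period vectors, for which `⟨Ω, θ³Ω⟩ = 1 / (1 - 5⁵z)`. -/
def pairing (v w : Fin 4 → ℂ) : ℂ := (v 0 * w 3 - 3 * v 1 * w 2 + 3 * v 2 * w 1 - v 3 * w 0) / 6

/-- The antilinear map `σ` with `⟨v, σ w⟩` the hermitian form whose restriction to the periods is
`e^{-K}`. -/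
def dualConj (w : Fin 4 → ℂ) : Fin 4 → ℂ :=
  ![5 * conj (w 0), -5 * conj (w 1), 5 * conj (w 2),
    -5 * conj (w 3) + 2400 * (riemannZeta 3).re * conj (w 0)]

/-- The hermitian form on period vectors. -/
def hermForm (v w : Fin 4 → ℂ) : ℂ := pairing v (dualConj w)

theorem hermForm_eq (v w : Fin 4 → ℂ) : hermForm v w
    = -(5 / 6) * (v 0 * conj (w 3) + v 3 * conj (w 0))
      - 5 / 2 * (v 1 * conj (w 2) + v 2 * conj (w 1))
      + 400 * (riemannZeta 3).re * (v 0 * conj (w 0)) := by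
  simp [hermForm, pairing, dualConj]
  ring

theorem conj_hermForm (v w : Fin 4 → ℂ) : conj (hermForm v w) = hermForm w v := by
  simp only [hermForm_eq, map_add, map_sub, map_mul, map_neg, map_div₀, Complex.conj_conj,
    Complex.conj_ofReal, map_ofNat]
  ring

/-- `σ` is antisymplectic up to the factor `-25`. -/
theorem pairing_dualConj (v w : Fin 4 → ℂ) :
    pairing (dualConj v) (dualConj w) = -25 * conj (pairing v w) := by
  simp [pairing, dualConj, map_ofNat]
  ring

/-- In a four-dimensional symplectic space, the polarised Pfaffian of the skew-symmetric matrices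
`⟨u_i, u_j⟩` and `⟨u_i, p⟩⟨u_j, q⟩ - ⟨u_j, p⟩⟨u_i, q⟩` is proportional to
`det(u₀, …, u₃) ⟨p, q⟩`. -/
theorem pairing_pfaffian (u₀ u₁ u₂ u₃ p q : Fin 4 → ℂ) (hpq : pairing p q = 0) :
    pairing u₀ u₁ * (pairing u₂ p * pairing u₃ q - pairing u₃ p * pairing u₂ q)
      - pairing u₀ u₂ * (pairing u₁ p * pairing u₃ q - pairing u₃ p * pairing u₁ q)
      + pairing u₀ u₃ * (pairing u₁ p * pairing u₂ q - pairing u₂ p * pairing u₁ q)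
      + pairing u₁ u₂ * (pairing u₀ p * pairing u₃ q - pairing u₃ p * pairing u₀ q)
      - pairing u₁ u₃ * (pairing u₀ p * pairing u₂ q - pairing u₂ p * pairing u₀ q)
      + pairing u₂ u₃ * (pairing u₀ p * pairing u₁ q - pairing u₁ p * pairing u₀ q) = 0 := by
  -- `D` is the determinant of `u₀, …, u₃`.
  have key : ∀ D : ℂ, D = (u₀ 0 * u₁ 1 - u₀ 1 * u₁ 0) * (u₂ 2 * u₃ 3 - u₂ 3 * u₃ 2)
      - (u₀ 0 * u₁ 2 - u₀ 2 * u₁ 0) * (u₂ 1 * u₃ 3 - u₂ 3 * u₃ 1)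
      + (u₀ 0 * u₁ 3 - u₀ 3 * u₁ 0) * (u₂ 1 * u₃ 2 - u₂ 2 * u₃ 1)
      + (u₀ 1 * u₁ 2 - u₀ 2 * u₁ 1) * (u₂ 0 * u₃ 3 - u₂ 3 * u₃ 0)
      - (u₀ 1 * u₁ 3 - u₀ 3 * u₁ 1) * (u₂ 0 * u₃ 2 - u₂ 2 * u₃ 0)
      + (u₀ 2 * u₁ 3 - u₀ 3 * u₁ 2) * (u₂ 0 * u₃ 1 - u₂ 1 * u₃ 0) →
      pairing u₀ u₁ * (pairing u₂ p * pairing u₃ q - pairing u₃ p * pairing u₂ q)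
      - pairing u₀ u₂ * (pairing u₁ p * pairing u₃ q - pairing u₃ p * pairing u₁ q)
      + pairing u₀ u₃ * (pairing u₁ p * pairing u₂ q - pairing u₂ p * pairing u₁ q)
      + pairing u₁ u₂ * (pairing u₀ p * pairing u₃ q - pairing u₃ p * pairing u₀ q)
      - pairing u₁ u₃ * (pairing u₀ p * pairing u₂ q - pairing u₂ p * pairing u₀ q)
      + pairing u₂ u₃ * (pairing u₀ p * pairing u₁ q - pairing u₁ p * pairing u₀ q)
      = -1 / 12 * D * pairing p q := by
    rintro D rfl
    unfold pairing
    ring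
  rw [key _ rfl, hpq, mul_zero]

/-- In a four-dimensional symplectic space, three vectors `u` correspond to the vector
`⟨u₁,u₂⟩u₀ - ⟨u₀,u₂⟩u₁ + ⟨u₀,u₁⟩u₂`, and this identifies the Gram determinant of two triples with
a single pairing. Here both triples have `⟨u₀,u₁⟩ = ⟨u₀,u₂⟩ = 0`. -/
theorem pairing_det (u₀ u₁ u₂ p₀ p₁ p₂ : Fin 4 → ℂ) (hu₁ : pairing u₀ u₁ = 0)
    (hu₂ : pairing u₀ u₂ = 0) (hp₁ : pairing p₀ p₁ = 0) (hp₂ : pairing p₀ p₂ = 0) :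
    pairing u₀ p₀ * (pairing u₁ p₁ * pairing u₂ p₂ - pairing u₁ p₂ * pairing u₂ p₁)
      - pairing u₀ p₁ * (pairing u₁ p₀ * pairing u₂ p₂ - pairing u₁ p₂ * pairing u₂ p₀)
      + pairing u₀ p₂ * (pairing u₁ p₀ * pairing u₂ p₁ - pairing u₁ p₁ * pairing u₂ p₀)
      = pairing u₁ u₂ * pairing p₁ p₂ * pairing u₀ p₀ := by
  have key : pairing u₀ p₀ * (pairing u₁ p₁ * pairing u₂ p₂ - pairing u₁ p₂ * pairing u₂ p₁)
      - pairing u₀ p₁ * (pairing u₁ p₀ * pairing u₂ p₂ - pairing u₁ p₂ * pairing u₂ p₀)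
      + pairing u₀ p₂ * (pairing u₁ p₀ * pairing u₂ p₁ - pairing u₁ p₁ * pairing u₂ p₀)
      = pairing u₁ u₂ * (pairing p₁ p₂ * pairing u₀ p₀ - pairing p₀ p₂ * pairing u₀ p₁
          + pairing p₀ p₁ * pairing u₀ p₂)
        - pairing u₀ u₂ * (pairing p₁ p₂ * pairing u₁ p₀ - pairing p₀ p₂ * pairing u₁ p₁
          + pairing p₀ p₁ * pairing u₁ p₂)
        + pairing u₀ u₁ * (pairing p₁ p₂ * pairing u₂ p₀ - pairing p₀ p₂ * pairing u₂ p₁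
          + pairing p₀ p₁ * pairing u₂ p₂) := by
    unfold pairing
    ring
  rw [key, hu₁, hu₂, hp₁, hp₂]
  ring

namespace Branch

variable (B : Branch)

/-! ### Analytic continuation of the identities to `U` -/

section Continuation

variable {B} {z : ℂ}

theorem ne_zero (hz : z ∈ B.U) : z ≠ 0 := (B.subset_moduli hz).1

theorem one_sub_ne_zero (hz : z ∈ B.U) : 1 - 5 ^ 5 * z ≠ 0 := by
  intro h
  exact (B.subset_moduli hz).2 (by linear_combination (-1 / 5 ^ 5) * h)

theorem mem_nhds (hz : z ∈ B.U) : B.U ∈ 𝓝 z := B.isOpen.mem_nhds hz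

theorem conj_ne_zero (hz : z ∈ B.U) : conj z ≠ 0 := by
  simpa using ne_zero hz

theorem hasTheta_of_differentiableOn {f : ℂ → ℂ} (hf : DifferentiableOn ℂ f B.U) (hz : z ∈ B.U) :
    HasTheta f (theta f z) z := by
  have h := HasTheta.of_differentiableAt (hf.differentiableAt (mem_nhds hz))
  exact h.congr_theta h.hasWirtinger.theta_eq.symm

theorem differentiableOn_theta {f : ℂ → ℂ} (hf : DifferentiableOn ℂ f B.U) :
    DifferentiableOn ℂ (theta f) B.U := by
  refine DifferentiableOn.congr (f := fun z => z * deriv f z)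
    (differentiableOn_id.mul (hf.deriv B.isOpen)) fun z hz => ?_
  exact (HasTheta.of_differentiableAt
    (hf.differentiableAt (mem_nhds hz))).hasWirtinger.theta_eq

theorem differentiableOn_theta_iterate {f : ℂ → ℂ} (hf : DifferentiableOn ℂ f B.U) (p : ℕ) :
    DifferentiableOn ℂ (theta^[p] f) B.U := by
  induction p with
  | zero => exact hf
  | succ p ih =>
    rw [Function.iterate_succ']
    exact differentiableOn_theta ih

theorem hasTheta_theta_iterate {f : ℂ → ℂ} (hf : DifferentiableOn ℂ f B.U) (p : ℕ)
    (hz : z ∈ B.U) : HasTheta (theta^[p] f) (theta^[p + 1] f z) z := by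
  rw [Function.iterate_succ']
  exact hasTheta_of_differentiableOn (differentiableOn_theta_iterate hf p) hz

/-- Holomorphic functions on `U` that agree near one point agree. -/
theorem eq_of_eventuallyEq {f g : ℂ → ℂ} (hf : DifferentiableOn ℂ f B.U)
    (hg : DifferentiableOn ℂ g B.U) {z₀ : ℂ} (hz₀ : z₀ ∈ B.U) (h : f =ᶠ[𝓝 z₀] g) (hz : z ∈ B.U) :
    f z = g z :=
  (hf.analyticOnNhd B.isOpen).eqOn_of_preconnected_of_eventuallyEq (hg.analyticOnNhd B.isOpen)
    B.isPreconnected hz₀ h hz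

theorem differentiableOn_xiFun : DifferentiableOn ℂ xiFun B.U := fun _ hz =>
  (hasTheta_xiFun (one_sub_ne_zero hz)).differentiableAt.differentiableWithinAt

end Continuation

/-- If `F 0, F 1, …` are successive logarithmic derivatives on an open set and `f` agrees with
`F 0` near a point, then `θᵖf` agrees with `F p` there. -/
theorem eventually_theta_iterate {f : ℂ → ℂ} {F : ℕ → ℂ → ℂ} {s : Set ℂ} (hs : IsOpen s)
    (hF : ∀ p, ∀ z ∈ s, HasTheta (F p) (F (p + 1) z) z) {z₀ : ℂ} (hz₀ : z₀ ∈ s)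
    (h : f =ᶠ[𝓝 z₀] F 0) (p : ℕ) : theta^[p] f =ᶠ[𝓝 z₀] F p := by
  induction p with
  | zero => exact h
  | succ p ih =>
    rw [Function.iterate_succ']
    filter_upwards [ih.eventually_nhds, hs.mem_nhds hz₀] with z h1 h2
    exact (theta_congr h1).trans (hF p z h2).hasWirtinger.theta_eq

/-- The vector of `θᵖω_0, …, θᵖω_3`. -/
def period (p : ℕ) (z : ℂ) (i : Fin 4) : ℂ := theta^[p] (B.ω i) z

theorem isOpen_slitDisc : IsOpen {z : ℂ | z ∈ Complex.slitPlane ∧ ‖z‖ < 1 / 5 ^ 5} :=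
  Complex.isOpen_slitPlane.inter (isOpen_lt continuous_norm continuous_const)

/-- A point of `U` near which all branches are the principal ones, together with their
logarithmic derivatives. -/
theorem exists_principal : ∃ z₀ ∈ B.U, ∀ᶠ z in 𝓝 z₀, ‖z‖ < 1 / 5 ^ 5 ∧ z ∈ Complex.slitPlane ∧
    B.sqrtz z = z ^ (1 / 2 : ℂ) ∧
    (∀ p ∈ Finset.range 5, ∀ i : Fin 4, B.period p z i = (i : ℕ).factorial * frobSol p i z) ∧
    ∀ p ∈ Finset.range 5, theta^[p] B.T z = 60 * tauSol p z := by
  obtain ⟨z₀, hU, hs, hz, h⟩ := B.principal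
  refine ⟨z₀, hU, ?_⟩
  have hmem := isOpen_slitDisc.mem_nhds (show z₀ ∈ {z : ℂ | _} from ⟨hs, hz⟩)
  have hω : ∀ p (i : Fin 4), ∀ᶠ z in 𝓝 z₀, B.period p z i = (i : ℕ).factorial * frobSol p i z := by
    intro p i
    refine eventually_theta_iterate (F := fun p z => (i : ℕ).factorial * frobSol p i z)
      isOpen_slitDisc (fun p z hz => (hasTheta_frobSol p i.2 hz.2 hz.1).const_mul _) ⟨hs, hz⟩ ?_ p
    filter_upwards [h, hmem] with z h1 h2
    rw [h1.1 i, frobenius_eq _ h2.2 h2.1]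
  have hT : ∀ p, ∀ᶠ z in 𝓝 z₀, theta^[p] B.T z = 60 * tauSol p z := by
    intro p
    refine eventually_theta_iterate (F := fun p z => 60 * tauSol p z)
      isOpen_slitDisc (fun p z hz => (hasTheta_tauSol p hz.2 hz.1).const_mul _) ⟨hs, hz⟩ ?_ p
    filter_upwards [h, hmem] with z h1 h2
    rw [h1.2.1, tau_eq h2.1]
  filter_upwards [h, hmem, (Filter.eventually_all_finset _).mpr fun p _ =>
    Filter.eventually_all.mpr (hω p), (Filter.eventually_all_finset _).mpr fun p _ => hT p]
    with z h1 h2 h3 h4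
  exact ⟨h2.2, h2.1, h1.2.2, h3, h4⟩

section Identities

variable {B} {z : ℂ}

theorem differentiableOn_period (p : ℕ) (i : Fin 4) :
    DifferentiableOn ℂ (fun z => B.period p z i) B.U :=
  differentiableOn_theta_iterate (B.ω_holomorphic i) p

theorem hasTheta_period (p : ℕ) (i : Fin 4) (hz : z ∈ B.U) :
    HasTheta (fun z => B.period p z i) (B.period (p + 1) z i) z :=
  hasTheta_theta_iterate (B.ω_holomorphic i) p hz

theorem differentiableOn_pairing_period (p q : ℕ) :
    DifferentiableOn ℂ (fun z => pairing (B.period p z) (B.period q z)) B.U := by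
  have h := fun p i => B.differentiableOn_period p i
  unfold pairing
  exact ((((h p 0).mul (h q 3)).sub (((h p 1).const_mul 3).mul (h q 2))).add
    (((h p 2).const_mul 3).mul (h q 1))).sub ((h p 3).mul (h q 0)) |>.div_const 6

/-- The Picard–Fuchs equation. -/
theorem period_four (hz : z ∈ B.U) (i : Fin 4) :
    B.period 4 z i = xiFun z * (2 * B.period 3 z i + 7 / 5 * B.period 2 z i
      + 2 / 5 * B.period 1 z i + 24 / 625 * B.period 0 z i) := by
  obtain ⟨z₀, hz₀, h⟩ := B.exists_principal
  have hd := fun p => B.differentiableOn_period p i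
  refine eq_of_eventuallyEq (f := fun z => B.period 4 z i) (g := fun z => xiFun z *
    (2 * B.period 3 z i + 7 / 5 * B.period 2 z i + 2 / 5 * B.period 1 z i
      + 24 / 625 * B.period 0 z i)) (hd 4) ?_ hz₀ ?_ hz
  · exact differentiableOn_xiFun.mul (((((hd 3).const_mul 2).add ((hd 2).const_mul (7 / 5))).add
      ((hd 1).const_mul (2 / 5))).add ((hd 0).const_mul (24 / 625)))
  · filter_upwards [h] with z hz
    obtain ⟨h1, -, -, h4, -⟩ := hz
    simp only [h4 0 (by simp), h4 1 (by simp), h4 2 (by simp), h4 3 (by simp), h4 4 (by simp)]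
    rw [frobSol_pf i.2 h1]
    ring

/-- The quadratic relations of the periods, from those of the Frobenius solutions. -/
theorem pairing_period_of_frobPair {p q : ℕ} (hp : p < 5) (hq : q < 5) {f : ℂ → ℂ}
    (hf : DifferentiableOn ℂ f B.U) (h : ∀ y : ℂ, ‖y‖ < 1 / 5 ^ 5 → frobPair p q y = f y)
    (hz : z ∈ B.U) : pairing (B.period p z) (B.period q z) = f z := by
  obtain ⟨z₀, hz₀, h'⟩ := B.exists_principal
  refine eq_of_eventuallyEq (differentiableOn_pairing_period p q) hf hz₀ ?_ hz
  filter_upwards [h'] with y hy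
  obtain ⟨h1, -, -, h4, -⟩ := hy
  rw [← h y h1, ← frobSol_pair]
  simp only [pairing, h4 p (by simpa using hp), h4 q (by simpa using hq)]
  simp [Nat.factorial]
  ring

theorem pairing_period_zero_one (hz : z ∈ B.U) : pairing (B.period 0 z) (B.period 1 z) = 0 :=
  pairing_period_of_frobPair (by norm_num) (by norm_num) (differentiableOn_const 0)
    (fun _ => frobPair_zero_one) hz

theorem pairing_period_zero_two (hz : z ∈ B.U) : pairing (B.period 0 z) (B.period 2 z) = 0 :=
  pairing_period_of_frobPair (by norm_num) (by norm_num) (differentiableOn_const 0)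
    (fun _ => frobPair_zero_two) hz

theorem differentiableOn_one_div : DifferentiableOn ℂ (fun z : ℂ => 1 / (1 - 5 ^ 5 * z)) B.U := by
  intro z hz
  have := one_sub_ne_zero hz
  exact DifferentiableAt.differentiableWithinAt (by fun_prop (disch := assumption))

theorem pairing_period_zero_three (hz : z ∈ B.U) :
    pairing (B.period 0 z) (B.period 3 z) = 1 / (1 - 5 ^ 5 * z) :=
  pairing_period_of_frobPair (by norm_num) (by norm_num) differentiableOn_one_div
    (fun _ => frobPair_zero_three) hz

theorem pairing_period_one_two (hz : z ∈ B.U) :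
    pairing (B.period 1 z) (B.period 2 z) = -(1 / (1 - 5 ^ 5 * z)) :=
  pairing_period_of_frobPair (f := fun z => -(1 / (1 - 5 ^ 5 * z))) (by norm_num) (by norm_num)
    differentiableOn_one_div.neg
    (fun y hy => by rw [frobPair_one_two hy, frobPair_zero_three hy]) hz

theorem pairing_period_one_three (hz : z ∈ B.U) :
    pairing (B.period 1 z) (B.period 3 z) = -xiFun z * (1 / (1 - 5 ^ 5 * z)) :=
  pairing_period_of_frobPair (f := fun z => -xiFun z * (1 / (1 - 5 ^ 5 * z))) (by norm_num)
    (by norm_num) (differentiableOn_xiFun.neg.mul differentiableOn_one_div)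
    (fun y hy => by rw [frobPair_one_three hy, frobPair_zero_three hy]) hz

theorem pairing_period_two_three (hz : z ∈ B.U) :
    pairing (B.period 2 z) (B.period 3 z) = 2 / 5 * xiFun z * (1 / (1 - 5 ^ 5 * z)) :=
  pairing_period_of_frobPair (f := fun z => 2 / 5 * xiFun z * (1 / (1 - 5 ^ 5 * z))) (by norm_num)
    (by norm_num) ((differentiableOn_xiFun.const_mul (2 / 5)).mul differentiableOn_one_div)
    (fun y hy => by rw [frobPair_two_three hy, frobPair_zero_three hy]) hz

theorem sqrtz_sq (hz : z ∈ B.U) : B.sqrtz z ^ 2 = z := by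
  obtain ⟨z₀, hz₀, h⟩ := B.exists_principal
  refine eq_of_eventuallyEq (f := fun z => B.sqrtz z ^ 2) (B.sqrtz_holomorphic.pow 2)
    differentiableOn_id hz₀ ?_ hz
  filter_upwards [h] with y hy
  rw [hy.2.2.1, ← Complex.cpow_nat_mul]
  norm_num

theorem sqrtz_ne_zero (hz : z ∈ B.U) : B.sqrtz z ≠ 0 := by
  intro h
  have := sqrtz_sq hz
  rw [h] at this
  exact ne_zero hz (by simpa using this.symm)

theorem hasTheta_sqrtz (hz : z ∈ B.U) : HasTheta B.sqrtz (1 / 2 * B.sqrtz z) z := by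
  have h := hasTheta_of_differentiableOn B.sqrtz_holomorphic hz
  have h2 : HasTheta (fun y => B.sqrtz y ^ 2) z z :=
    (hasTheta_id z).congr_fun (by filter_upwards [mem_nhds hz] with y hy using sqrtz_sq hy)
  have h3 := (h.pow 2).mul_deriv.symm.trans h2.mul_deriv
  refine h.congr_theta ?_
  have h4 := sqrtz_ne_zero hz
  have h5 := sqrtz_sq hz
  apply mul_left_cancel₀ h4
  push_cast at h3
  linear_combination h3 / 2 - h5 / 2

theorem hasTheta_T (p : ℕ) (hz : z ∈ B.U) :
    HasTheta (theta^[p] B.T) (theta^[p + 1] B.T z) z :=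
  hasTheta_theta_iterate B.T_holomorphic p hz

/-- The inhomogeneous Picard–Fuchs equation. -/
theorem T_four (hz : z ∈ B.U) :
    theta^[4] B.T z = xiFun z * (2 * theta^[3] B.T z + 7 / 5 * theta^[2] B.T z
      + 2 / 5 * theta^[1] B.T z + 24 / 625 * theta^[0] B.T z)
      + 15 / 4 * B.sqrtz z * (1 / (1 - 5 ^ 5 * z)) := by
  obtain ⟨z₀, hz₀, h⟩ := B.exists_principal
  have hd := fun p => differentiableOn_theta_iterate B.T_holomorphic p
  refine eq_of_eventuallyEq (f := theta^[4] B.T) (g := fun z => xiFun z *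
    (2 * theta^[3] B.T z + 7 / 5 * theta^[2] B.T z + 2 / 5 * theta^[1] B.T z
      + 24 / 625 * theta^[0] B.T z) + 15 / 4 * B.sqrtz z * (1 / (1 - 5 ^ 5 * z))) (hd 4) ?_
      hz₀ ?_ hz
  · exact (differentiableOn_xiFun.mul (((((hd 3).const_mul 2).add ((hd 2).const_mul (7 / 5))).add
      ((hd 1).const_mul (2 / 5))).add ((hd 0).const_mul (24 / 625)))).add
      ((B.sqrtz_holomorphic.const_mul _).mul differentiableOn_one_div)
  · filter_upwards [h] with z hz
    obtain ⟨h1, -, h3, -, h5⟩ := hz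
    rw [h5 0 (by simp), h5 1 (by simp), h5 2 (by simp), h5 3 (by simp), h5 4 (by simp), h3,
      tauSol_pf h1]
    ring

end Identities

end Branch

/-! ### The rational functions of the geometry -/

theorem yukawaX_eq {z : ℂ} (hz : z ≠ 0) : yukawaX z = 5 / (1 - 5 ^ 5 * z) := by
  rw [yukawaX, yukawa]
  field_simp

theorem hFun_eq {z : ℂ} (hz : 1 - 5 ^ 5 * z ≠ 0) : hFun z = 1 + 2 / 5 * xiFun z := by
  rw [hFun, xiFun]
  field_simp
  ring

theorem hasTheta_one_div {z : ℂ} (hz : 1 - 5 ^ 5 * z ≠ 0) :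
    HasTheta (fun y : ℂ => 1 / (1 - 5 ^ 5 * y)) (xiFun z * (1 / (1 - 5 ^ 5 * z))) z := by
  have h1 : HasDerivAt (fun y : ℂ => 1 - 5 ^ 5 * y) (-5 ^ 5) z := by
    simpa using ((hasDerivAt_id z).const_mul (5 ^ 5 : ℂ)).const_sub 1
  refine ⟨_, (hasDerivAt_const z (1 : ℂ)).div h1 hz, ?_⟩
  rw [xiFun]
  field_simp
  ring

namespace Branch

variable {B : Branch} {z : ℂ}

theorem hasTheta_yukawaX (hz : z ∈ B.U) : HasTheta yukawaX (xiFun z * yukawaX z) z := by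
  refine (((hasTheta_one_div (one_sub_ne_zero hz)).const_mul 5).congr_fun ?_).congr_theta ?_
  · filter_upwards [mem_nhds hz] with y hy
    rw [yukawaX_eq (ne_zero hy)]
    ring
  · rw [yukawaX_eq (ne_zero hz)]
    ring

theorem yukawaX_ne_zero (hz : z ∈ B.U) : yukawaX z ≠ 0 := by
  rw [yukawaX_eq (ne_zero hz)]
  exact div_ne_zero (by norm_num) (one_sub_ne_zero hz)

theorem xi_eq (hz : z ∈ B.U) : xi z = xiFun z := by
  rw [xi, (hasTheta_yukawaX hz).hasWirtinger.theta_eq,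
    mul_div_cancel_right₀ _ (yukawaX_ne_zero hz)]

theorem hasTheta_xi (hz : z ∈ B.U) : HasTheta xi (xi z + xi z ^ 2) z := by
  refine ((hasTheta_xiFun (one_sub_ne_zero hz)).congr_fun ?_).congr_theta ?_
  · filter_upwards [mem_nhds hz] with y hy using xi_eq hy
  · rw [xi_eq hz]

/-! ### Hermitian products of the periods -/

variable (B) in
/-- The hermitian product `θᵖ θ̄^q e^{-K}` of `θᵖΩ` and `θ^qΩ`. -/
def herm (p q : ℕ) (z : ℂ) : ℂ := hermForm (B.period p z) (B.period q z)

variable (B) in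
/-- The minor of the matrix of hermitian products with rows `i, j` and columns `0, 1`. -/
def minor (i j : ℕ) (z : ℂ) : ℂ := B.herm i 0 z * B.herm j 1 z - B.herm j 0 z * B.herm i 1 z

theorem hasWirtinger_herm (p q : ℕ) (hz : z ∈ B.U) :
    HasWirtinger (B.herm p q) (B.herm (p + 1) q z) (B.herm p (q + 1) z / conj z) z := by
  have h := fun i => (hasTheta_period p i hz).hasWirtinger
  have hc := fun i => (hasTheta_period q i hz).hasWirtinger.conj (ne_zero hz)
  have hz0 := conj_ne_zero hz
  have H := ((((((h 0).mul (hc 3)).add ((h 3).mul (hc 0))).const_mul (-(5 / 6))).sub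
    ((((h 1).mul (hc 2)).add ((h 2).mul (hc 1))).const_mul (5 / 2))).add
    (((h 0).mul (hc 0)).const_mul (400 * (riemannZeta 3).re)))
  refine (H.congr (.of_forall fun y => hermForm_eq _ _)).congr_val ?_ ?_
  · rw [herm, hermForm_eq]
    simp
  · rw [herm, hermForm_eq]
    simp only [map_div₀]
    field_simp
    ring

theorem conj_herm (p q : ℕ) (z : ℂ) : conj (B.herm p q z) = B.herm q p z := conj_hermForm _ _

theorem hermNorm_eq (z : ℂ) : (B.hermNorm z : ℂ) = B.herm 0 0 z := by
  rw [herm, hermForm_eq, hermNorm]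
  simp only [period, Function.iterate_zero, id]
  rw [← Complex.normSq_eq_norm_sq]
  push_cast
  rw [Complex.normSq_eq_conj_mul_self, Complex.re_eq_add_conj, Complex.re_eq_add_conj]
  simp only [map_mul, Complex.conj_conj]
  ring

theorem hasWirtinger_minor_zero_one (hz : z ∈ B.U) : HasWirtinger (B.minor 0 1) (B.minor 0 2 z)
    ((B.herm 0 0 z * B.herm 1 2 z - B.herm 1 0 z * B.herm 0 2 z) / conj z) z := by
  have h := fun p q => hasWirtinger_herm p q hz
  refine (((h 0 0).mul (h 1 1)).sub ((h 1 0).mul (h 0 1))).congr_val ?_ ?_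
  · simp only [minor]
    ring
  · ring

/-- The relation between minors behind the formula for `θV₁`. -/
theorem minor_three (hz : z ∈ B.U) :
    B.minor 0 3 z = B.minor 1 2 z + xi z * B.minor 0 2 z + 2 / 5 * xi z * B.minor 0 1 z := by
  have hpq : pairing (dualConj (B.period 0 z)) (dualConj (B.period 1 z)) = 0 := by
    rw [pairing_dualConj, pairing_period_zero_one hz]
    simp
  have h := pairing_pfaffian (B.period 0 z) (B.period 1 z) (B.period 2 z) (B.period 3 z) _ _ hpq
  rw [pairing_period_zero_one hz, pairing_period_zero_two hz, pairing_period_zero_three hz,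
    pairing_period_one_two hz, pairing_period_one_three hz, pairing_period_two_three hz] at h
  have h1 : (1 / (1 - 5 ^ 5 * z) : ℂ) ≠ 0 := one_div_ne_zero (one_sub_ne_zero hz)
  rw [xi_eq hz]
  apply mul_left_cancel₀ h1
  unfold minor herm hermForm
  linear_combination -h

/-- The determinant of hermitian products behind the formula for `∂V₁/∂z̄`. -/
theorem herm_det (hz : z ∈ B.U) :
    B.herm 0 0 z * (B.herm 1 1 z * B.herm 2 2 z - B.herm 1 2 z * B.herm 2 1 z)
      - B.herm 0 1 z * (B.herm 1 0 z * B.herm 2 2 z - B.herm 1 2 z * B.herm 2 0 z)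
      + B.herm 0 2 z * (B.herm 1 0 z * B.herm 2 1 z - B.herm 1 1 z * B.herm 2 0 z)
      = -(yukawaX z * conj (yukawaX z)) * B.herm 0 0 z := by
  have h1 : pairing (dualConj (B.period 0 z)) (dualConj (B.period 1 z)) = 0 := by
    rw [pairing_dualConj, pairing_period_zero_one hz]
    simp
  have h2 : pairing (dualConj (B.period 0 z)) (dualConj (B.period 2 z)) = 0 := by
    rw [pairing_dualConj, pairing_period_zero_two hz]
    simp
  have h := pairing_det _ _ _ _ _ _ (pairing_period_zero_one hz) (pairing_period_zero_two hz) h1 h2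
  rw [pairing_dualConj, pairing_period_one_two hz] at h
  rw [yukawaX_eq (ne_zero hz)]
  unfold herm hermForm
  rw [h]
  simp only [map_div₀, map_neg, map_one, map_ofNat]
  ring

/-! ### The Kähler potential and the metric -/

section Kahler

variable (hpos : ∀ z ∈ B.U, 0 < B.hermNorm z) (hG : ∀ z ∈ B.U, B.G z ≠ 0)
include hpos

theorem herm_ne_zero (hz : z ∈ B.U) : B.herm 0 0 z ≠ 0 := by
  rw [← hermNorm_eq]
  exact_mod_cast (hpos z hz).ne'

theorem K_eq (hz : z ∈ B.U) : B.K z = -Complex.log (B.herm 0 0 z) := by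
  rw [K, ← hermNorm_eq, ← Complex.ofReal_log (hpos z hz).le]
  push_cast
  rfl

theorem hasWirtinger_K (hz : z ∈ B.U) : HasWirtinger B.K (-(B.herm 1 0 z / B.herm 0 0 z))
    (-(B.herm 0 1 z / (conj z * B.herm 0 0 z))) z := by
  have hs : B.herm 0 0 z ∈ Complex.slitPlane := by
    rw [← hermNorm_eq, Complex.ofReal_mem_slitPlane]
    exact hpos z hz
  have h := ((hasWirtinger_herm 0 0 hz).comp (Complex.hasDerivAt_log hs)).neg
  refine (h.congr ?_).congr_val (by ring) (by field_simp)
  filter_upwards [mem_nhds hz] with y hy using K_eq hpos hy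

theorem exp_K (hz : z ∈ B.U) : Complex.exp (B.K z) = (B.herm 0 0 z)⁻¹ := by
  rw [K_eq hpos hz, Complex.exp_neg, Complex.exp_log (herm_ne_zero hpos hz)]

theorem exp_neg_K (hz : z ∈ B.U) : Complex.exp (-B.K z) = B.herm 0 0 z := by
  rw [Complex.exp_neg, exp_K hpos hz, inv_inv]

theorem dz_K (hz : z ∈ B.U) : dz B.K z = -(B.herm 1 0 z / B.herm 0 0 z) / z := by
  rw [eq_div_iff (ne_zero hz), ← (hasWirtinger_K hpos hz).theta_eq, theta]
  ring

theorem G_eq (hz : z ∈ B.U) :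
    B.G z = -(B.minor 0 1 z / (z * conj z * B.herm 0 0 z ^ 2)) := by
  have h0 := ne_zero hz
  have h1 := conj_ne_zero hz
  have h2 := herm_ne_zero hpos hz
  have h := ((hasWirtinger_herm 0 1 hz).div
    ((hasWirtinger_conj h0).mul (hasWirtinger_herm 0 0 hz)) (mul_ne_zero h1 h2)).neg
  have he : dzbar B.K =ᶠ[𝓝 z] fun y => -(B.herm 0 1 y / (conj y * B.herm 0 0 y)) := by
    filter_upwards [mem_nhds hz] with y hy using (hasWirtinger_K hpos hy).dzbar_eq
  have h3 := (h.congr he).theta_eq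
  rw [theta] at h3
  change z * B.G z = _ at h3
  apply mul_left_cancel₀ h0
  rw [h3, minor]
  field_simp
  ring

theorem conj_G (hz : z ∈ B.U) : conj (B.G z) = B.G z := by
  rw [G_eq hpos hz, minor]
  simp only [map_neg, map_div₀, map_sub, map_mul, map_pow, conj_herm, Complex.conj_conj]
  ring

theorem hasWirtinger_G (hz : z ∈ B.U) : HasWirtinger B.G
    (-(B.minor 0 2 z / (z * conj z * B.herm 0 0 z ^ 2))
      + B.minor 0 1 z / (z * conj z * B.herm 0 0 z ^ 2) * (1 + 2 * (B.herm 1 0 z / B.herm 0 0 z)))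
    (dzbar B.G z) z := by
  have h0 := ne_zero hz
  have h1 := conj_ne_zero hz
  have h2 := herm_ne_zero hpos hz
  have h := ((hasWirtinger_minor_zero_one hz).div
    (((hasTheta_id z).hasWirtinger.mul (hasWirtinger_conj h0)).mul
      ((hasWirtinger_herm 0 0 hz).pow 2))
    (by positivity)).neg
  have he : B.G =ᶠ[𝓝 z] fun y => -(B.minor 0 1 y / (y * conj y * B.herm 0 0 y ^ 2)) := by
    filter_upwards [mem_nhds hz] with y hy using G_eq hpos hy
  have h3 := h.congr he
  refine h3.congr_val ?_ h3.dzbar_eq.symm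
  push_cast
  field_simp
  ring

theorem theta_iterate_exp_neg_K (p : ℕ) (hz : z ∈ B.U) :
    theta^[p] (fun y => Complex.exp (-B.K y)) z = B.herm p 0 z := by
  induction p generalizing z with
  | zero => exact exp_neg_K hpos hz
  | succ p ih =>
    rw [Function.iterate_succ']
    refine (theta_congr ?_).trans (hasWirtinger_herm p 0 hz).theta_eq
    filter_upwards [mem_nhds hz] with y hy using ih hy

theorem Bp_eq (p : ℕ) (hz : z ∈ B.U) : B.Bp p z = B.herm p 0 z / B.herm 0 0 z := by
  rw [Bp, theta_iterate_exp_neg_K hpos p hz, exp_neg_K hpos hz]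

theorem hasWirtinger_Bp (p : ℕ) (hz : z ∈ B.U) : HasWirtinger (B.Bp p)
    (B.Bp (p + 1) z - B.Bp 1 z * B.Bp p z) (B.minor 0 p z / (conj z * B.herm 0 0 z ^ 2)) z := by
  have h0 := ne_zero hz
  have h1 := conj_ne_zero hz
  have h2 := herm_ne_zero hpos hz
  refine (((hasWirtinger_herm p 0 hz).div (hasWirtinger_herm 0 0 hz) h2).congr ?_).congr_val ?_ ?_
  · filter_upwards [mem_nhds hz] with y hy using Bp_eq hpos p hy
  · simp only [Bp_eq hpos _ hz]
    field_simp
  · rw [minor]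
    field_simp

/-- The Picard–Fuchs equation, paired with the conjugate period vector. -/
theorem Bp_four (hz : z ∈ B.U) : B.Bp 4 z = xi z * (2 * B.Bp 3 z + 7 / 5 * B.Bp 2 z
    + 2 / 5 * B.Bp 1 z + 24 / 625) := by
  have h2 := herm_ne_zero hpos hz
  have h : B.herm 4 0 z = xi z * (2 * B.herm 3 0 z + 7 / 5 * B.herm 2 0 z + 2 / 5 * B.herm 1 0 z
      + 24 / 625 * B.herm 0 0 z) := by
    rw [xi_eq hz]
    simp only [herm, hermForm_eq, period_four hz]
    ring
  simp only [Bp_eq hpos _ hz, h]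
  field_simp

theorem dzbar_Bp_one (hz : z ∈ B.U) : dzbar (B.Bp 1) z = -z * B.G z := by
  have h0 := ne_zero hz
  rw [(hasWirtinger_Bp hpos 1 hz).dzbar_eq, G_eq hpos hz]
  field_simp

include hG

theorem minor_ne_zero (hz : z ∈ B.U) : B.minor 0 1 z ≠ 0 := by
  intro h
  apply hG z hz
  rw [G_eq hpos hz, h]
  simp

theorem A_one_eq (hz : z ∈ B.U) :
    B.A 1 z = B.minor 0 2 z / B.minor 0 1 z - 1 - 2 * B.Bp 1 z := by
  have h0 := ne_zero hz
  have h1 := conj_ne_zero hz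
  have h2 := herm_ne_zero hpos hz
  have h3 := minor_ne_zero hpos hG hz
  rw [A, Function.iterate_one, (hasWirtinger_G hpos hz).theta_eq, G_eq hpos hz, Bp_eq hpos 1 hz]
  field_simp
  ring

theorem V₁_eq (hz : z ∈ B.U) : B.V₁ z = B.minor 0 2 z / B.minor 0 1 z := by
  rw [V₁, A_one_eq hpos hG hz]
  ring

theorem V₂_eq (hz : z ∈ B.U) : B.V₂ z = -(B.minor 1 2 z / B.minor 0 1 z) := by
  have h2 := herm_ne_zero hpos hz
  have h3 := minor_ne_zero hpos hG hz
  rw [V₂, V₁_eq hpos hG hz, Bp_eq hpos, Bp_eq hpos]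
  · field_simp
    simp only [minor]
    ring
  all_goals exact hz

/-- The derivatives of `V₁`: the first, by `minor_three`, expresses `A₂` through the other
generators, and the second, by `herm_det`, is the special geometry relation. -/
theorem hasWirtinger_V₁ (hz : z ∈ B.U) : HasWirtinger B.V₁
    (xi z * B.V₁ z - B.V₁ z ^ 2 - 2 * B.V₂ z + 2 / 5 * xi z) (-z * yukawa z * B.Cbar z) z := by
  have h0 := ne_zero hz
  have h1 := conj_ne_zero hz
  have h2 := herm_ne_zero hpos hz
  have h3 := minor_ne_zero hpos hG hz
  have hS := fun p q => hasWirtinger_herm p q hz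
  have hN : HasWirtinger (B.minor 0 2) (B.minor 1 2 z + B.minor 0 3 z)
      ((B.herm 0 0 z * B.herm 2 2 z - B.herm 2 0 z * B.herm 0 2 z) / conj z) z := by
    refine (((hS 0 0).mul (hS 2 1)).sub ((hS 2 0).mul (hS 0 1))).congr_val ?_ ?_
    · simp only [minor]
      ring
    · ring
  refine ((hN.div (hasWirtinger_minor_zero_one hz) h3).congr ?_).congr_val ?_ ?_
  · filter_upwards [mem_nhds hz] with y hy using V₁_eq hpos hG hy
  · rw [V₁_eq hpos hG hz, V₂_eq hpos hG hz, minor_three hz]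
    field_simp
    ring
  · have hx : yukawa z = yukawaX z / z ^ 3 := by
      rw [yukawaX]
      field_simp
    have he : Complex.exp (2 * B.K z) = (B.herm 0 0 z)⁻¹ ^ 2 := by
      rw [← exp_K hpos hz, ← Complex.exp_nat_mul]
      norm_num
    have hdet := herm_det hz
    rw [Cbar, hx, he, G_eq hpos hz]
    simp only [map_div₀, map_pow]
    field_simp
    simp only [minor]
    linear_combination B.herm 0 0 z * hdet

end Kahler

/-! ### The tension and the disk amplitude -/

section Tension

variable {B : Branch} {z : ℂ}

theorem hasTheta_yukawa (hz : z ∈ B.U) : HasTheta yukawa ((xi z - 3) * yukawa z) z := by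
  have h0 := ne_zero hz
  have h3 : HasTheta (fun y => (y ^ 3)⁻¹) (-3 * (z ^ 3)⁻¹) z := by
    refine ⟨_, (hasDerivAt_pow 3 z).inv (pow_ne_zero 3 h0), ?_⟩
    push_cast
    field_simp
  refine (((hasTheta_yukawaX hz).mul h3).congr_fun ?_).congr_theta ?_
  · filter_upwards [mem_nhds hz] with y hy
    have := ne_zero hy
    rw [yukawaX]
    field_simp
  · rw [xi_eq hz, yukawaX]
    field_simp
    ring

theorem hasWirtinger_Q (p : ℕ) (hz : z ∈ B.U) :
    HasWirtinger (B.Q p) (1 / 2 * B.Q p z + B.Q (p + 1) z) 0 z := by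
  refine (((hasTheta_sqrtz hz).mul (hasTheta_T p hz)).congr_theta ?_).hasWirtinger
  simp only [Q]
  ring

/-- The inhomogeneous Picard–Fuchs equation for the generators `Q_p`; here `1/(1-5⁵z) = 1 + ξ`. -/
theorem Q_four (hz : z ∈ B.U) : B.Q 4 z = xi z * (2 * B.Q 3 z + 7 / 5 * B.Q 2 z
    + 2 / 5 * B.Q 1 z + 24 / 625 * B.Q 0 z) + 15 / 4 * z * (1 + xi z) := by
  have h1 := one_sub_ne_zero hz
  have h2 : (1 + xi z : ℂ) = 1 / (1 - 5 ^ 5 * z) := by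
    rw [xi_eq hz, xiFun]
    field_simp
    ring
  rw [h2, xi_eq hz]
  simp only [Q]
  rw [T_four hz]
  linear_combination 15 / 4 * (1 / (1 - 5 ^ 5 * z)) * sqrtz_sq hz

theorem conj_K (z : ℂ) : conj (B.K z) = B.K z := Complex.conj_ofReal _

theorem conj_dz_K (z : ℂ) : conj (dz B.K z) = dzbar B.K z := by
  rw [← dzbar_conj]
  simp only [conj_K]

theorem conj_covD_T (z : ℂ) : conj (B.covD 0 (-1) B.T z) = B.covDbarTbar z := by
  rw [covD, covDbarTbar, dzbar_conj, ← conj_dz_K]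
  simp

theorem theta_dzbar_K (z : ℂ) : theta (dzbar B.K) z = z * B.G z := rfl

theorem hasWirtinger_conj_T (hz : z ∈ B.U) :
    HasWirtinger (fun y => conj (B.T y)) 0 (dzbar (fun y => conj (B.T y)) z) z := by
  have h := (hasTheta_T 0 hz).hasWirtinger.conj (ne_zero hz)
  exact h.congr_val (by simp) h.dzbar_eq.symm

variable (hpos : ∀ z ∈ B.U, 0 < B.hermNorm z) (hG : ∀ z ∈ B.U, B.G z ≠ 0)
include hpos

theorem hasWirtinger_exp_K (hz : z ∈ B.U) : HasWirtinger (fun y => Complex.exp (B.K y))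
    (-B.Bp 1 z * Complex.exp (B.K z)) (dzbar B.K z * Complex.exp (B.K z)) z := by
  have h := hasWirtinger_K hpos hz
  refine (h.comp (Complex.hasDerivAt_exp (B.K z))).congr_val ?_ ?_
  · rw [Bp_eq hpos 1 hz]
    ring
  · rw [h.dzbar_eq]
    ring

theorem differentiableAt_dzbar_K (hz : z ∈ B.U) : DifferentiableAt ℝ (dzbar B.K) z := by
  have h := ((hasWirtinger_herm 0 1 hz).div ((hasWirtinger_conj (ne_zero hz)).mul
    (hasWirtinger_herm 0 0 hz)) (mul_ne_zero (conj_ne_zero hz) (herm_ne_zero hpos hz))).neg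
  refine h.differentiableAt.congr_of_eventuallyEq ?_
  filter_upwards [mem_nhds hz] with y hy using (hasWirtinger_K hpos hy).dzbar_eq

theorem hasWirtinger_covDbarTbar (hz : z ∈ B.U) : HasWirtinger B.covDbarTbar
    (z * B.G z * conj (B.T z)) (dzbar B.covDbarTbar z) z := by
  have h0 := ne_zero hz
  have h1 : HasWirtinger (dzbar fun y => conj (B.T y)) 0
      (dzbar (dzbar fun y => conj (B.T y)) z) z := by
    have h := ((hasTheta_T 1 hz).hasWirtinger.div (hasTheta_id z).hasWirtinger h0).conj h0
    have h' := h.congr (g := dzbar fun y => conj (B.T y)) ?_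
    · exact h'.congr_val (by simp) h'.dzbar_eq.symm
    · filter_upwards [mem_nhds hz] with y hy
      exact ((hasTheta_T 0 hy).hasWirtinger.conj (ne_zero hy)).dzbar_eq
  have h2 := HasWirtinger.of_differentiableAt (differentiableAt_dzbar_K hpos hz)
  have h := h1.add (h2.mul (hasWirtinger_conj_T hz))
  refine HasWirtinger.congr_val (f := B.covDbarTbar) h ?_ h.dzbar_eq.symm
  rw [theta_dzbar_K]
  ring

theorem hasWirtinger_R₂ (hz : z ∈ B.U) : HasWirtinger B.R₂
    (B.R₂ z * (1 / 2 - B.Bp 1 z + xi z)) (B.sqrtz z ^ 7 * Complex.exp (B.K z) * yukawa z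
      * B.covDbarTbar z) z := by
  refine (((((hasTheta_sqrtz hz).hasWirtinger.pow 7).mul (hasWirtinger_exp_K hpos hz)).mul
    (hasTheta_yukawa hz).hasWirtinger).mul (hasWirtinger_conj_T hz)).congr_val ?_ ?_
  · rw [R₂]
    push_cast
    ring
  · rw [covDbarTbar]
    ring

theorem theta_covD_T (hz : z ∈ B.U) : theta (B.covD 0 (-1) B.T) z
    = (theta^[2] B.T z - (B.Bp 2 z - B.Bp 1 z ^ 2) * B.T z - B.Bp 1 z * theta^[1] B.T z
      - (theta^[1] B.T z - B.Bp 1 z * B.T z)) / z := by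
  have h0 := ne_zero hz
  have hT := (hasTheta_T 0 hz).hasWirtinger
  have h := (((hasTheta_T 1 hz).hasWirtinger.sub ((hasWirtinger_Bp hpos 1 hz).mul hT)).div
    (hasTheta_id z).hasWirtinger h0)
  have h' := h.congr (g := B.covD 0 (-1) B.T) ?_
  · rw [h'.theta_eq]
    simp only [Function.iterate_zero, id, zero_add]
    field_simp
    ring
  · filter_upwards [mem_nhds hz] with y hy
    have hy0 := ne_zero hy
    rw [covD, dz_K hpos hy, ← Bp_eq hpos 1 hy, eq_div_iff hy0]
    simp only [Function.iterate_one, Function.iterate_zero, id, theta]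
    push_cast
    field_simp
    ring

include hG

theorem hasWirtinger_R₁ (hz : z ∈ B.U) : HasWirtinger B.R₁
    (B.R₁ z * (1 / 2 + xi z - B.V₁ z) + (B.R₂ z + B.Bp 1 z * B.R₁ z))
    (B.sqrtz z ^ 5 * yukawa z * Complex.exp (B.K z) / B.G z *
      (dzbar B.K z * B.covDbarTbar z - dzbar B.G z / B.G z * B.covDbarTbar z
        + dzbar B.covDbarTbar z)) z := by
  have hg := hG z hz
  have h := ((((hasTheta_sqrtz hz).hasWirtinger.pow 5).mul (((hasWirtinger_exp_K hpos hz).mul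
    (hasTheta_yukawa hz).hasWirtinger).div (HasWirtinger.of_differentiableAt
      (hasWirtinger_G hpos hz).differentiableAt) hg)).mul (hasWirtinger_covDbarTbar hpos hz))
  refine HasWirtinger.congr_val (f := B.R₁) h ?_ ?_
  · rw [R₁, R₂, V₁, A, Function.iterate_one]
    push_cast
    rw [show B.sqrtz z ^ 7 = B.sqrtz z ^ 5 * z by rw [pow_add _ 5 2, sqrtz_sq hz]]
    field_simp
    ring
  · field_simp
    ring

/-- Consequently the multiples of `∂B₁/∂z̄` cancel in the derivative of `R₂ + B₁R₁`, hence
of `m₂`. -/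
theorem dzbar_R₂ (hz : z ∈ B.U) : dzbar B.R₂ z = -B.R₁ z * dzbar (B.Bp 1) z := by
  have hg := hG z hz
  rw [(hasWirtinger_R₂ hpos hz).dzbar_eq, dzbar_Bp_one hpos hz, R₁,
    show B.sqrtz z ^ 7 = B.sqrtz z ^ 5 * z by rw [pow_add _ 5 2, sqrtz_sq hz]]
  field_simp

/-- `z² D_z D_z 𝒯` in terms of the generators. -/
theorem covD_covD_T (hz : z ∈ B.U) : z ^ 2 * B.covD 1 (-1) (B.covD 0 (-1) B.T) z
    = theta^[2] B.T z - B.V₁ z * theta^[1] B.T z - B.V₂ z * B.T z := by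
  have h0 := ne_zero hz
  have hg := hG z hz
  have h1 := theta_covD_T hpos hz
  have h2 : B.Gam z = B.A 1 z / z := by
    rw [Gam, A, Function.iterate_one, theta]
    field_simp
  have h3 : B.covD 0 (-1) B.T z = (theta^[1] B.T z - B.Bp 1 z * B.T z) / z := by
    rw [covD, dz_K hpos hz, ← Bp_eq hpos 1 hz, eq_div_iff h0]
    simp only [Function.iterate_one, theta]
    push_cast
    field_simp
    ring
  rw [theta] at h1
  rw [covD, h2, dz_K hpos hz, ← Bp_eq hpos 1 hz, h3]
  rw [show z ^ 2 * (dz (B.covD 0 (-1) B.T) z - ((1 : ℕ) : ℂ) * (B.A 1 z / z)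
      * ((theta^[1] B.T z - B.Bp 1 z * B.T z) / z) - ((-1 : ℤ) : ℂ) * (-B.Bp 1 z / z)
      * ((theta^[1] B.T z - B.Bp 1 z * B.T z) / z))
    = z * (z * dz (B.covD 0 (-1) B.T) z) - z ^ 2 * ((B.A 1 z / z)
      * ((theta^[1] B.T z - B.Bp 1 z * B.T z) / z)) - z ^ 2 * ((B.Bp 1 z / z)
      * ((theta^[1] B.T z - B.Bp 1 z * B.T z) / z)) by push_cast; ring, h1, V₂, V₁]
  field_simp
  ring

/-- The disk amplitude in terms of the generators. -/
theorem disk_eq (hz : z ∈ B.U) : B.sqrtz z * z ^ 2 * B.disk z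
    = B.Q 2 z - B.V₁ z * B.Q 1 z - B.V₂ z * B.Q 0 z - B.R₁ z := by
  have h := covD_covD_T hpos hG hz
  rw [disk, Q, Q, Q, R₁, show B.sqrtz z ^ 5 = B.sqrtz z * (B.sqrtz z ^ 2) ^ 2 by ring, sqrtz_sq hz]
  simp only [Function.iterate_zero, id] at h ⊢
  linear_combination B.sqrtz z * h

theorem dzbar_V₁ (hz : z ∈ B.U) :
    dzbar B.V₁ z = dzbar (B.A 1) z + 2 * dzbar (B.Bp 1) z := by
  have hB := hasWirtinger_Bp hpos 1 hz
  have hA : HasWirtinger (B.A 1) _ _ z :=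
    (((hasWirtinger_V₁ hpos hG hz).sub (hB.const_mul 2)).sub (HasWirtinger.const 1 z)).congr
      (.of_forall fun y => show B.A 1 y = B.V₁ y - 2 * B.Bp 1 y - 1 by unfold V₁; ring)
  rw [hA.dzbar_eq, (hasWirtinger_V₁ hpos hG hz).dzbar_eq, hB.dzbar_eq]
  ring

/-- The conjugate disk amplitude `△_z̄^z` in terms of `∂R₁/∂z̄` and `∂V₁/∂z̄`. -/
theorem diskBar_eq (hz : z ∈ B.U) : B.diskBar z * yukawaX z
    = B.sqrtz z * (dzbar B.R₁ z - (B.Bp 1 z * B.Q 0 z - B.Q 1 z) * dzbar B.V₁ z) := by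
  have h0 := ne_zero hz
  have hg := hG z hz
  have hGam : conj (B.Gam z) = dzbar B.G z / B.G z := by
    rw [Gam, map_div₀, conj_G hpos hz, ← dzbar_conj]
    congr 1
    refine dzbar_congr ?_
    filter_upwards [mem_nhds hz] with y hy using conj_G hpos hy
  have hdz : conj (dz (B.covD 0 (-1) B.T) z) = dzbar B.covDbarTbar z := by
    rw [← dzbar_conj]
    simp only [conj_covD_T]
  have hexp : conj (Complex.exp (B.K z)) = Complex.exp (B.K z) := by
    rw [← Complex.exp_conj, conj_K]
  have hτ : conj (B.covDbarTbar z) = B.covD 0 (-1) B.T z := by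
    rw [← conj_covD_T, Complex.conj_conj]
  have hD : z * B.covD 0 (-1) B.T z = theta^[1] B.T z - B.Bp 1 z * B.T z := by
    rw [covD, dz_K hpos hz, ← Bp_eq hpos 1 hz]
    simp only [Function.iterate_one, theta]
    push_cast
    field_simp
    ring
  have hconj : conj (B.disk z) = dzbar B.covDbarTbar z - dzbar B.G z / B.G z * B.covDbarTbar z
      + dzbar B.K z * B.covDbarTbar z
      - Complex.exp (B.K z) * conj (yukawa z) / B.G z * B.covD 0 (-1) B.T z := by
    rw [disk, map_sub, map_mul, map_div₀, map_mul, hexp, conj_G hpos hz, hτ,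
      covD]
    simp only [map_sub, map_mul, hGam, conj_covD_T, hdz, conj_dz_K, map_natCast, map_intCast]
    push_cast
    ring
  have hexp2 : Complex.exp (2 * B.K z) = Complex.exp (B.K z) ^ 2 := by
    rw [← Complex.exp_nat_mul]
    norm_num
  have hs := sqrtz_sq hz
  rw [diskBar, hconj, (hasWirtinger_R₁ hpos hG hz).dzbar_eq,
    (hasWirtinger_V₁ hpos hG hz).dzbar_eq, Cbar, hexp2, yukawaX, Q, Q]
  simp only [Function.iterate_zero, id]
  have hs6 : z ^ 3 = B.sqrtz z ^ 6 := by rw [show 6 = 2 * 3 from rfl, pow_mul, hs]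
  have hs4 : z ^ 2 = B.sqrtz z ^ 4 := by rw [show 4 = 2 * 2 from rfl, pow_mul, hs]
  rw [show B.sqrtz z * theta^[1] B.T z
    = B.sqrtz z * (z * B.covD 0 (-1) B.T z + B.Bp 1 z * B.T z) by rw [hD]; ring]
  field_simp
  rw [hs6]
  linear_combination Complex.exp (B.K z) * conj (yukawa z) * B.covD 0 (-1) B.T z * yukawa z
    * B.sqrtz z ^ 2 * hs4

/-- Here `∂V₂/∂z̄ = -B₁ ∂V₁/∂z̄`, because `∂B₂/∂z̄ = V₁ ∂B₁/∂z̄`. -/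
theorem hasWirtinger_V₂ (hz : z ∈ B.U) : HasWirtinger B.V₂
    (B.Bp 3 z - B.Bp 1 z * B.Bp 2 z - (B.Bp 2 z - B.Bp 1 z ^ 2) * B.V₁ z
      - B.Bp 1 z * (xi z * B.V₁ z - B.V₁ z ^ 2 - 2 * B.V₂ z + 2 / 5 * xi z))
    (-B.Bp 1 z * dzbar B.V₁ z) z := by
  have h0 := ne_zero hz
  have h1 := conj_ne_zero hz
  have h2 := herm_ne_zero hpos hz
  have h3 := minor_ne_zero hpos hG hz
  have hV := hasWirtinger_V₁ hpos hG hz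
  refine ((hasWirtinger_Bp hpos 2 hz).sub ((hasWirtinger_Bp hpos 1 hz).mul hV)).congr_val ?_ ?_
  · ring
  · rw [V₁_eq hpos hG hz, hV.dzbar_eq]
    field_simp
    ring

/-- Consequently the multiples of `∂B₁/∂z̄` cancel in `∂v₃/∂z̄`. -/
theorem dzbar_Bp_three (hz : z ∈ B.U) : dzbar (B.Bp 3) z
    = (-B.V₂ z + xi z * B.V₁ z + 2 / 5 * xi z) * dzbar (B.Bp 1) z := by
  have h0 := ne_zero hz
  have h1 := conj_ne_zero hz
  have h2 := herm_ne_zero hpos hz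
  have h3 := minor_ne_zero hpos hG hz
  rw [(hasWirtinger_Bp hpos 3 hz).dzbar_eq, (hasWirtinger_Bp hpos 1 hz).dzbar_eq, minor_three hz,
    V₁_eq hpos hG hz, V₂_eq hpos hG hz]
  field_simp

end Tension

end Branch

/-! ### Rational functions as functions -/

/-- The value of a rational function at `z` (zero at a pole). -/
def ratEval (c : RatFunc ℂ) (z : ℂ) : ℂ := c.eval (RingHom.id ℂ) z

theorem eventually_eval_ne_zero {p : Polynomial ℂ} (hp : p ≠ 0) :
    ∀ᶠ z in Filter.cofinite, p.eval z ≠ 0 := by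
  rw [Filter.eventually_cofinite]
  refine (p.roots.toFinset.finite_toSet).subset fun z hz => ?_
  simpa [hp] using hz

theorem eventually_denom_ne_zero (c : RatFunc ℂ) : ∀ᶠ z in Filter.cofinite, c.denom.eval z ≠ 0 :=
  eventually_eval_ne_zero c.denom_ne_zero

theorem eventually_ratEval_add (c d : RatFunc ℂ) :
    ∀ᶠ z in Filter.cofinite, ratEval (c + d) z = ratEval c z + ratEval d z := by
  filter_upwards [eventually_denom_ne_zero c, eventually_denom_ne_zero d] with z hc hd
  exact RatFunc.eval_add _ _ hc hd

theorem eventually_ratEval_mul (c d : RatFunc ℂ) :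
    ∀ᶠ z in Filter.cofinite, ratEval (c * d) z = ratEval c z * ratEval d z := by
  filter_upwards [eventually_denom_ne_zero c, eventually_denom_ne_zero d] with z hc hd
  exact RatFunc.eval_mul _ _ hc hd

@[simp] theorem ratEval_C (a z : ℂ) : ratEval (RatFunc.C a) z = a := RatFunc.eval_C _ _

@[simp] theorem ratEval_X (z : ℂ) : ratEval RatFunc.X z = z := RatFunc.eval_X _ _

@[simp] theorem ratEval_zero (z : ℂ) : ratEval 0 z = 0 := RatFunc.eval_zero _ _

@[simp] theorem ratEval_one (z : ℂ) : ratEval 1 z = 1 := RatFunc.eval_one _ _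

theorem ratEval_polynomial (p : Polynomial ℂ) (z : ℂ) :
    ratEval (algebraMap (Polynomial ℂ) (RatFunc ℂ) p) z = p.eval z := by
  rw [ratEval, RatFunc.eval_algebraMap]
  simp [Polynomial.eval₂_eq_eval_map]

theorem eventually_ratEval_div (p : Polynomial ℂ) {q : Polynomial ℂ} (hq : q ≠ 0) :
    ∀ᶠ z in Filter.cofinite, ratEval (algebraMap (Polynomial ℂ) (RatFunc ℂ) p
      / algebraMap (Polynomial ℂ) (RatFunc ℂ) q) z = p.eval z / q.eval z := by
  have hq' : algebraMap (Polynomial ℂ) (RatFunc ℂ) q ≠ 0 := RatFunc.algebraMap_ne_zero hq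
  filter_upwards [eventually_ratEval_mul (algebraMap (Polynomial ℂ) (RatFunc ℂ) p
    / algebraMap (Polynomial ℂ) (RatFunc ℂ) q) (algebraMap (Polynomial ℂ) (RatFunc ℂ) q),
    eventually_eval_ne_zero hq] with z h1 h2
  rw [div_mul_cancel₀ _ hq', ratEval_polynomial, ratEval_polynomial] at h1
  rw [eq_div_iff h2, h1]

/-- The field `ℂ(z)` is closed under `θ`. -/
theorem exists_hasTheta_ratEval (c : RatFunc ℂ) : ∃ d : RatFunc ℂ,
    ∀ᶠ z in Filter.cofinite, HasTheta (ratEval c) (ratEval d z) z := by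
  have hq := pow_ne_zero 2 c.denom_ne_zero
  have h := eventually_ratEval_div (Polynomial.X *
    (Polynomial.derivative c.num * c.denom - c.num * Polynomial.derivative c.denom)) hq
  refine ⟨algebraMap (Polynomial ℂ) (RatFunc ℂ) (Polynomial.X *
      (Polynomial.derivative c.num * c.denom - c.num * Polynomial.derivative c.denom))
    / algebraMap (Polynomial ℂ) (RatFunc ℂ) (c.denom ^ 2), ?_⟩
  filter_upwards [eventually_denom_ne_zero c, h] with z h1 h2
  have hd : HasDerivAt (ratEval c) (((Polynomial.derivative c.num).eval z * c.denom.eval z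
      - c.num.eval z * (Polynomial.derivative c.denom).eval z) / c.denom.eval z ^ 2) z :=
    (c.num.hasDerivAt z).div (c.denom.hasDerivAt z) h1
  refine ⟨_, hd, ?_⟩
  rw [h2]
  simp only [Polynomial.eval_mul, Polynomial.eval_sub, Polynomial.eval_pow, Polynomial.eval_X]
  ring

theorem eventually_ratEval_xiRat : ∀ᶠ z in Filter.cofinite, ratEval xiRat z = xiFun z := by
  have hq : (1 - Polynomial.C (5 ^ 5) * Polynomial.X : Polynomial ℂ) ≠ 0 := by
    intro h
    simpa using congrArg (Polynomial.eval 0) h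
  have he : xiRat = algebraMap (Polynomial ℂ) (RatFunc ℂ) (Polynomial.C (5 ^ 5) * Polynomial.X)
      / algebraMap (Polynomial ℂ) (RatFunc ℂ) (1 - Polynomial.C (5 ^ 5) * Polynomial.X) := by
    simp only [xiRat, map_sub, map_one, map_mul, RatFunc.algebraMap_C, RatFunc.algebraMap_X]
  rw [he]
  filter_upwards [eventually_ratEval_div (Polynomial.C (5 ^ 5) * Polynomial.X) hq] with z hz
  rw [hz, xiFun]
  simp

/-! ### Elements of `J` as functions -/

instance : Fintype Gen :=
  ⟨⟨([.u, .v₁, .v₂, .v₃, .Q₀, .Q₁, .Q₂, .Q₃, .m₁, .m₂] : List Gen), by simp⟩,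
    fun i => by cases i <;> simp⟩

namespace Branch

variable (B : Branch)

/-- The filter of the cofinite subsets of `U`. -/
def generic : Filter ℂ := Filter.cofinite ⊓ Filter.principal B.U

theorem generically_iff {p : ℂ → Prop} : B.Generically p ↔ ∀ᶠ z in B.generic, p z := by
  rw [Generically, generic, Filter.eventually_inf_principal, Filter.eventually_cofinite]
  simp only [Classical.not_imp]

variable {B}

theorem eventually_mem : ∀ᶠ z in B.generic, z ∈ B.U :=
  Filter.mem_inf_of_right (Filter.mem_principal_self _)

theorem eventually_of_cofinite {p : ℂ → Prop} (h : ∀ᶠ z in Filter.cofinite, p z) :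
    ∀ᶠ z in B.generic, p z := h.filter_mono inf_le_left

/-- Exceptional sets are closed in `U`, so that generic identities hold near generic points. -/
theorem eventually_eventually_nhds {p : ℂ → Prop} (h : ∀ᶠ z in B.generic, p z) :
    ∀ᶠ z in B.generic, ∀ᶠ y in 𝓝 z, p y := by
  rw [← generically_iff] at h
  have hopen : IsOpen (B.U \ {z | z ∈ B.U ∧ ¬p z}) := B.isOpen.sdiff h.isClosed
  filter_upwards [generically_iff B |>.mp h, eventually_mem] with z hz hU
  filter_upwards [hopen.mem_nhds ⟨hU, fun h' => h'.2 hz⟩] with y hy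
  by_contra hp
  exact hy.2 ⟨hy.1, hp⟩

theorem ev_eq_sum (p : J) {T : Finset (Gen →₀ ℕ)} (hT : p.support ⊆ T) (z : ℂ) :
    B.ev p z = ∑ s ∈ T, ratEval (MvPolynomial.coeff s p) z * s.prod fun i k => B.gen i z ^ k := by
  refine Finset.sum_subset hT fun s _ hs => ?_
  have h0 : MvPolynomial.coeff s p = 0 := by simpa using hs
  change ratEval (MvPolynomial.coeff s p) z * _ = 0
  rw [h0, ratEval_zero, zero_mul]

theorem ev_zero (z : ℂ) : B.ev 0 z = 0 := by simp [ev]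

theorem ev_monomial (s : Gen →₀ ℕ) (c : RatFunc ℂ) (z : ℂ) :
    B.ev (MvPolynomial.monomial s c) z = ratEval c z * s.prod fun i k => B.gen i z ^ k := by
  classical
  rw [ev_eq_sum _ (T := {s}) MvPolynomial.support_monomial_subset]
  simp

theorem ev_C (c : RatFunc ℂ) (z : ℂ) : B.ev (MvPolynomial.C c) z = ratEval c z := by
  rw [← MvPolynomial.monomial_zero', ev_monomial]
  simp

theorem ev_X (i : Gen) (z : ℂ) : B.ev (MvPolynomial.X i) z = B.gen i z := by
  rw [MvPolynomial.X, ev_monomial]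
  simp

theorem ev_add (p q : J) : ∀ᶠ z in B.generic, B.ev (p + q) z = B.ev p z + B.ev q z := by
  classical
  have h : ∀ᶠ z in B.generic, ∀ s ∈ p.support ∪ q.support,
      ratEval (MvPolynomial.coeff s p + MvPolynomial.coeff s q) z
        = ratEval (MvPolynomial.coeff s p) z + ratEval (MvPolynomial.coeff s q) z :=
    (Filter.eventually_all_finset _).mpr fun s _ =>
      eventually_of_cofinite (eventually_ratEval_add _ _)
  filter_upwards [h] with z hz
  rw [ev_eq_sum _ MvPolynomial.support_add, ev_eq_sum p Finset.subset_union_left,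
    ev_eq_sum q Finset.subset_union_right, ← Finset.sum_add_distrib]
  refine Finset.sum_congr rfl fun s hs => ?_
  rw [MvPolynomial.coeff_add, hz s hs, add_mul]

theorem ev_mul (p q : J) : ∀ᶠ z in B.generic, B.ev (p * q) z = B.ev p z * B.ev q z := by
  induction q using MvPolynomial.induction_on' with
  | monomial t d =>
    induction p using MvPolynomial.induction_on' with
    | monomial s c =>
      filter_upwards [eventually_of_cofinite (eventually_ratEval_mul c d)] with z hz
      rw [MvPolynomial.monomial_mul, ev_monomial, ev_monomial, ev_monomial, hz,
        Finsupp.prod_add_index' (by simp) (by simp [pow_add])]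
      ring
    | add p q hp hq =>
      rw [add_mul]
      filter_upwards [hp, hq, ev_add p q, ev_add (p * MvPolynomial.monomial t d)
        (q * MvPolynomial.monomial t d)] with z h1 h2 h3 h4
      rw [h4, h1, h2, h3]
      ring
  | add q r hq hr =>
    rw [mul_add]
    filter_upwards [hq, hr, ev_add q r, ev_add (p * q) (p * r)] with z h1 h2 h3 h4
    rw [h4, h1, h2, h3]
    ring

theorem ev_neg (p : J) : ∀ᶠ z in B.generic, B.ev (-p) z = -B.ev p z := by
  filter_upwards [ev_add p (-p)] with z h
  rw [add_neg_cancel, ev_zero] at h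
  linear_combination -h

theorem ev_sub (p q : J) : ∀ᶠ z in B.generic, B.ev (p - q) z = B.ev p z - B.ev q z := by
  rw [sub_eq_add_neg]
  filter_upwards [ev_add p (-q), ev_neg q] with z h1 h2
  rw [h1, h2]
  ring

/-- Under the independence hypothesis, an element of `J` is determined by its function. -/
theorem eq_zero_of_ev (hind : B.Independent) {p : J} (h : ∀ᶠ z in B.generic, B.ev p z = 0) :
    p = 0 := by
  refine (hind p 0 0 ((generically_iff B).mpr ?_)).1
  filter_upwards [h] with z hz
  rw [hz, ev_zero]
  ring

theorem eq_of_ev (hind : B.Independent) {p q : J} (h : ∀ᶠ z in B.generic, B.ev p z = B.ev q z) :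
    p = q := by
  refine sub_eq_zero.mp (eq_zero_of_ev hind ?_)
  filter_upwards [h, ev_sub p q] with z h1 h2
  rw [h2, h1, sub_self]

/-- The chain rule for `∂/∂z̄`, the coefficients in `ℂ(z)` being holomorphic. -/
theorem hasWirtinger_ev (hgen : ∀ i, ∀ z ∈ B.U, DifferentiableAt ℝ (B.gen i) z) (p : J) :
    ∀ᶠ z in B.generic, HasWirtinger (B.ev p) (theta (B.ev p) z)
      (∑ i, B.ev (MvPolynomial.pderiv i p) z * dzbar (B.gen i) z) z := by
  classical
  induction p using MvPolynomial.induction_on with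
  | C c =>
    obtain ⟨d, hd⟩ := exists_hasTheta_ratEval c
    filter_upwards [eventually_of_cofinite hd] with z hz
    have h := hz.hasWirtinger.congr (g := B.ev (MvPolynomial.C c)) (.of_forall fun y => ev_C c y)
    refine h.congr_val h.theta_eq.symm ?_
    simp [ev_zero]
  | add p q hp hq =>
    have hs : ∀ᶠ z in B.generic, ∀ i ∈ (Finset.univ : Finset Gen),
        B.ev (MvPolynomial.pderiv i (p + q)) z
          = B.ev (MvPolynomial.pderiv i p) z + B.ev (MvPolynomial.pderiv i q) z :=
      (Filter.eventually_all_finset _).mpr fun i _ => by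
        rw [map_add]
        exact ev_add _ _
    filter_upwards [hp, hq, eventually_eventually_nhds (ev_add p q), hs] with z h1 h2 h3 h4
    have h := (h1.add h2).congr h3
    refine h.congr_val h.theta_eq.symm ?_
    rw [← Finset.sum_add_distrib]
    refine Finset.sum_congr rfl fun i hi => ?_
    rw [h4 i hi]
    ring
  | mul_X p j hp =>
    have hs : ∀ᶠ z in B.generic, ∀ i ∈ (Finset.univ : Finset Gen),
        B.ev (MvPolynomial.pderiv i (p * MvPolynomial.X j)) z
          = B.ev (MvPolynomial.pderiv i p) z * B.gen j z + if i = j then B.ev p z else 0 := by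
      refine (Filter.eventually_all_finset _).mpr fun i _ => ?_
      rw [MvPolynomial.pderiv_mul, MvPolynomial.pderiv_X]
      filter_upwards [ev_add (MvPolynomial.pderiv i p * MvPolynomial.X j)
        (p * Pi.single (M := fun _ => J) i 1 j), ev_mul (MvPolynomial.pderiv i p)
        (MvPolynomial.X j)] with z h1 h2
      rw [h1, h2, ev_X]
      by_cases hij : i = j
      · subst hij
        simp
      · simp [hij, ev_zero]
    filter_upwards [hp, eventually_eventually_nhds (ev_mul p (MvPolynomial.X j)), hs,
      eventually_mem] with z h1 h3 h4 hU
    have h2 := HasWirtinger.of_differentiableAt (hgen j z hU)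
    have h := (h1.mul h2).congr (g := B.ev (p * MvPolynomial.X j))
      (by filter_upwards [h3] with y hy; rw [hy, ev_X])
    refine h.congr_val h.theta_eq.symm ?_
    rw [Finset.sum_congr rfl fun i hi => congrArg (· * dzbar (B.gen i) z) (h4 i hi)]
    simp only [add_mul, Finset.sum_add_distrib, ite_mul, zero_mul, Finset.sum_ite_eq',
      Finset.mem_univ, if_true, Finset.sum_mul]
    congr 1
    exact Finset.sum_congr rfl fun i _ => by ring

/-! ### Functions represented in subrings of `J` -/

variable (B) in
/-- The function `f` is generically given by an element of `J` in the generators from `s`. -/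
def Rep (s : Set Gen) (f : ℂ → ℂ) : Prop :=
  ∃ p ∈ MvPolynomial.supported (RatFunc ℂ) s, ∀ᶠ z in B.generic, f z = B.ev p z

namespace Rep

variable {s t : Set Gen} {f g : ℂ → ℂ}

theorem congr (hf : B.Rep s f) (h : ∀ᶠ z in B.generic, g z = f z) : B.Rep s g := by
  obtain ⟨p, hp, hf⟩ := hf
  refine ⟨p, hp, ?_⟩
  filter_upwards [h, hf] with z h1 h2
  rw [h1, h2]

theorem congr_on (hf : B.Rep s f) (h : ∀ z ∈ B.U, g z = f z) : B.Rep s g :=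
  hf.congr (eventually_mem.mono h)

theorem mono (hf : B.Rep s f) (hst : s ⊆ t) : B.Rep t f := by
  obtain ⟨p, hp, hf⟩ := hf
  exact ⟨p, MvPolynomial.supported_mono hst hp, hf⟩

theorem add (hf : B.Rep s f) (hg : B.Rep s g) : B.Rep s fun z => f z + g z := by
  obtain ⟨p, hp, hf⟩ := hf
  obtain ⟨q, hq, hg⟩ := hg
  refine ⟨p + q, add_mem hp hq, ?_⟩
  filter_upwards [hf, hg, ev_add p q] with z h1 h2 h3
  rw [h1, h2, h3]

theorem mul (hf : B.Rep s f) (hg : B.Rep s g) : B.Rep s fun z => f z * g z := by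
  obtain ⟨p, hp, hf⟩ := hf
  obtain ⟨q, hq, hg⟩ := hg
  refine ⟨p * q, mul_mem hp hq, ?_⟩
  filter_upwards [hf, hg, ev_mul p q] with z h1 h2 h3
  rw [h1, h2, h3]

theorem rat (c : RatFunc ℂ) : B.Rep s (ratEval c) :=
  ⟨MvPolynomial.C c, Subalgebra.algebraMap_mem _ c, .of_forall fun z => (ev_C c z).symm⟩

theorem const (c : ℂ) : B.Rep s fun _ => c :=
  (rat (RatFunc.C c)).congr (.of_forall fun z => (ratEval_C c z).symm)

theorem id : B.Rep s fun z => z :=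
  (rat RatFunc.X).congr (.of_forall fun z => (ratEval_X z).symm)

theorem xi : B.Rep s MirrorQuintic.xi := by
  refine (rat xiRat).congr ?_
  filter_upwards [eventually_mem, eventually_of_cofinite eventually_ratEval_xiRat] with z h1 h2
  rw [h2, xi_eq h1]

theorem gen {i : Gen} (hi : i ∈ s) : B.Rep s (B.gen i) :=
  ⟨MvPolynomial.X i, MvPolynomial.X_mem_supported.mpr hi, .of_forall fun z => (ev_X i z).symm⟩

theorem const_mul (c : ℂ) (hf : B.Rep s f) : B.Rep s fun z => c * f z := (const c).mul hf

theorem neg (hf : B.Rep s f) : B.Rep s fun z => -f z :=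
  (hf.const_mul (-1)).congr (.of_forall fun z => by ring)

theorem sub (hf : B.Rep s f) (hg : B.Rep s g) : B.Rep s fun z => f z - g z :=
  (hf.add hg.neg).congr (.of_forall fun z => by ring)

theorem pow (hf : B.Rep s f) (n : ℕ) : B.Rep s fun z => f z ^ n := by
  induction n with
  | zero => exact (const 1).congr (.of_forall fun z => by simp)
  | succ n ih => exact (ih.mul hf).congr (.of_forall fun z => pow_succ _ _)

theorem differentiableAt (hgen : ∀ i, ∀ z ∈ B.U, DifferentiableAt ℝ (B.gen i) z)
    (hf : B.Rep s f) : ∀ᶠ z in B.generic, DifferentiableAt ℝ f z := by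
  obtain ⟨p, -, hf⟩ := hf
  filter_upwards [hasWirtinger_ev hgen p, eventually_eventually_nhds hf] with z h1 h2
  exact h1.differentiableAt.congr_of_eventuallyEq h2

/-- If `θ` maps the generators in `s` into the polynomial ring generated by `s`, then it preserves
this ring. -/
theorem theta_ev (hgen : ∀ i, ∀ z ∈ B.U, DifferentiableAt ℝ (B.gen i) z)
    (hs : ∀ i ∈ s, B.Rep s (theta (B.gen i))) {p : J}
    (hp : p ∈ MvPolynomial.supported (RatFunc ℂ) s) : B.Rep s (theta (B.ev p)) := by
  rw [MvPolynomial.supported_eq_adjoin_X] at hp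
  induction hp using Algebra.adjoin_induction with
  | mem x hx =>
    obtain ⟨i, hi, rfl⟩ := hx
    exact (hs i hi).congr (.of_forall fun z => theta_congr (.of_forall fun y => ev_X i y))
  | algebraMap c =>
    obtain ⟨d, hd⟩ := exists_hasTheta_ratEval c
    refine (rat d).congr ?_
    filter_upwards [eventually_of_cofinite hd] with z hz
    exact (theta_congr (.of_forall fun y => ev_C c y)).trans hz.hasWirtinger.theta_eq
  | add p q hp hq ihp ihq =>
    refine (ihp.add ihq).congr ?_
    filter_upwards [hasWirtinger_ev hgen p, hasWirtinger_ev hgen q,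
      eventually_eventually_nhds (ev_add p q)] with z h1 h2 h3
    exact ((h1.add h2).congr h3).theta_eq
  | mul p q hp hq ihp ihq =>
    have hp' : B.Rep s (B.ev p) := ⟨p, hp, .of_forall fun _ => rfl⟩
    have hq' : B.Rep s (B.ev q) := ⟨q, hq, .of_forall fun _ => rfl⟩
    refine ((ihp.mul hq').add (hp'.mul ihq)).congr ?_
    filter_upwards [hasWirtinger_ev hgen p, hasWirtinger_ev hgen q,
      eventually_eventually_nhds (ev_mul p q)] with z h1 h2 h3
    exact ((h1.mul h2).congr h3).theta_eq

theorem theta (hgen : ∀ i, ∀ z ∈ B.U, DifferentiableAt ℝ (B.gen i) z)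
    (hs : ∀ i ∈ s, B.Rep s (theta (B.gen i))) (hf : B.Rep s f) :
    B.Rep s (MirrorQuintic.theta f) := by
  obtain ⟨p, hp, hf⟩ := hf
  refine (theta_ev hgen hs hp).congr ?_
  filter_upwards [eventually_eventually_nhds hf] with z hz using theta_congr hz

end Rep

/-! ### The derivatives of the generators -/

variable {B : Branch} {z : ℂ}

theorem hFun_eq_xi (hz : z ∈ B.U) : hFun z = 1 + 2 / 5 * xi z := by
  rw [hFun_eq (one_sub_ne_zero hz), xi_eq hz]

theorem sFun_eq_xi (hz : z ∈ B.U) : sFun z = 7 / 25 + 1 / 25 * xi z := by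
  rw [sFun, hFun_eq_xi hz]
  ring

theorem V₁_eq_gen (z : ℂ) : B.V₁ z = B.gen .v₁ z - 3 / 5 := by
  simp only [gen]
  ring

theorem V₂_eq_gen (z : ℂ) : B.V₂ z = B.gen .v₂ z - 2 / 25 := by
  simp only [gen]
  ring

theorem Bp_two_eq (z : ℂ) : B.Bp 2 z = B.V₂ z + B.Bp 1 z * B.V₁ z := by
  rw [V₂]
  ring

theorem gen_v₃_eq (hz : z ∈ B.U) : B.gen .v₃ z = B.Bp 3 z
    - B.Bp 1 z * (-B.V₂ z + xi z * B.V₁ z + 2 / 5 * xi z) + (7 / 25 + 1 / 25 * xi z) := by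
  simp only [gen, sFun_eq_xi hz, hFun_eq_xi hz]
  ring

variable (B) in
/-- The combination `R₂ + B₁R₁`. -/
def R₂₁ (z : ℂ) : ℂ := B.R₂ z + B.Bp 1 z * B.R₁ z

variable (B) in
/-- The holomorphic part of `m₂`. -/
def mHol (z : ℂ) : ℂ := B.Q 0 z * (7 / 25 - 1 / 25 * xi z) - B.Q 1 z * (2 / 25 + 2 / 5 * xi z)
  - B.Q 2 z * xi z + B.Q 3 z

theorem gen_m₂_eq (hz : z ∈ B.U) : B.gen .m₂ z = B.mHol z - B.R₂₁ z := by
  simp only [gen, sFun_eq_xi hz, hFun_eq_xi hz, mHol, R₂₁]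
  ring

theorem R₁_eq_gen (z : ℂ) : B.R₁ z
    = 2 / 25 * B.Q 0 z + 3 / 5 * B.Q 1 z + B.Q 2 z - B.gen .m₁ z := by
  simp only [gen]
  ring

theorem hasWirtinger_mHol (hz : z ∈ B.U) : HasWirtinger B.mHol
    ((1 / 2 * B.Q 0 z + B.Q 1 z) * (7 / 25 - 1 / 25 * xi z)
      - B.Q 0 z * (1 / 25 * (xi z + xi z ^ 2))
      - (1 / 2 * B.Q 1 z + B.Q 2 z) * (2 / 25 + 2 / 5 * xi z)
      - B.Q 1 z * (2 / 5 * (xi z + xi z ^ 2))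
      - (1 / 2 * B.Q 2 z + B.Q 3 z) * xi z - B.Q 2 z * (xi z + xi z ^ 2)
      + (1 / 2 * B.Q 3 z + (xi z * (2 * B.Q 3 z + 7 / 5 * B.Q 2 z
        + 2 / 5 * B.Q 1 z + 24 / 625 * B.Q 0 z) + 15 / 4 * z * (1 + xi z)))) 0 z := by
  have hx := (hasTheta_xi hz).hasWirtinger
  have hc := fun c : ℂ => HasWirtinger.const c z
  have h := (((((hasWirtinger_Q 0 hz).mul ((hc (7 / 25)).sub (hx.const_mul (1 / 25))))).sub
    ((hasWirtinger_Q 1 hz).mul ((hc (2 / 25)).add (hx.const_mul (2 / 5))))).sub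
    ((hasWirtinger_Q 2 hz).mul hx)).add (hasWirtinger_Q 3 hz)
  refine HasWirtinger.congr_val (f := B.mHol) h ?_ ?_
  · rw [Q_four hz]
    ring
  · ring

variable (B) in
/-- The functions `θ(gen i)`, in terms of functions given by elements of `J`. Only `θu` involves
`u`. -/
def thetaGen : Gen → ℂ → ℂ
  | .u => fun z => B.V₂ z + B.Bp 1 z * B.V₁ z - B.Bp 1 z ^ 2
  | .v₁ => fun z => xi z * B.V₁ z - B.V₁ z ^ 2 - 2 * B.V₂ z + 2 / 5 * xi z
  | .v₂ => fun z => B.gen .v₃ z - (7 / 25 + 1 / 25 * xi z) - B.V₁ z * B.V₂ z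
  | .v₃ => fun z => 2 * xi z * (B.gen .v₃ z - (7 / 25 + 1 / 25 * xi z)) + 7 / 5 * xi z * B.V₂ z
      + 24 / 625 * xi z - B.V₂ z * (-B.V₂ z + xi z * B.V₁ z + 2 / 5 * xi z)
      + 1 / 25 * (xi z + xi z ^ 2)
  | .Q₀ => fun z => 1 / 2 * B.Q 0 z + B.Q 1 z
  | .Q₁ => fun z => 1 / 2 * B.Q 1 z + B.Q 2 z
  | .Q₂ => fun z => 1 / 2 * B.Q 2 z + B.Q 3 z
  | .Q₃ => fun z => 1 / 2 * B.Q 3 z + (xi z * (2 * B.Q 3 z + 7 / 5 * B.Q 2 z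
      + 2 / 5 * B.Q 1 z + 24 / 625 * B.Q 0 z) + 15 / 4 * z * (1 + xi z))
  | .m₁ => fun z => 2 / 25 * (1 / 2 * B.Q 0 z + B.Q 1 z) + 3 / 5 * (1 / 2 * B.Q 1 z + B.Q 2 z)
      + (1 / 2 * B.Q 2 z + B.Q 3 z) - (B.R₁ z * (1 / 2 + xi z - B.V₁ z) + B.R₂₁ z)
  | .m₂ => fun z => (1 / 2 * B.Q 0 z + B.Q 1 z) * (7 / 25 - 1 / 25 * xi z)
      - B.Q 0 z * (1 / 25 * (xi z + xi z ^ 2))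
      - (1 / 2 * B.Q 1 z + B.Q 2 z) * (2 / 25 + 2 / 5 * xi z)
      - B.Q 1 z * (2 / 5 * (xi z + xi z ^ 2))
      - (1 / 2 * B.Q 2 z + B.Q 3 z) * xi z - B.Q 2 z * (xi z + xi z ^ 2)
      + (1 / 2 * B.Q 3 z + (xi z * (2 * B.Q 3 z + 7 / 5 * B.Q 2 z
        + 2 / 5 * B.Q 1 z + 24 / 625 * B.Q 0 z) + 15 / 4 * z * (1 + xi z)))
      - ((1 / 2 + xi z) * B.R₂₁ z + B.V₂ z * B.R₁ z)

variable (B) in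
/-- The functions `∂(gen i)/∂z̄`. -/
def dzbarGen : Gen → ℂ → ℂ
  | .u => dzbar (B.Bp 1)
  | .v₁ => dzbar B.V₁
  | .v₂ => fun z => -B.Bp 1 z * dzbar B.V₁ z
  | .v₃ => fun z => -(B.Bp 1 z * (B.Bp 1 z + xi z)) * dzbar B.V₁ z
  | .m₁ => fun z => -dzbar B.R₁ z
  | .m₂ => fun z => -B.Bp 1 z * dzbar B.R₁ z
  | _ => 0

section

variable (hpos : ∀ z ∈ B.U, 0 < B.hermNorm z) (hG : ∀ z ∈ B.U, B.G z ≠ 0)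
include hpos hG

theorem hasWirtinger_R₂₁ (hz : z ∈ B.U) : HasWirtinger B.R₂₁
    ((1 / 2 + xi z) * B.R₂₁ z + B.V₂ z * B.R₁ z) (B.Bp 1 z * dzbar B.R₁ z) z := by
  have h1 := hasWirtinger_Bp hpos 1 hz
  have h2 := hasWirtinger_R₁ hpos hG hz
  have h := (hasWirtinger_R₂ hpos hz).add (h1.mul h2)
  refine HasWirtinger.congr_val (f := B.R₂₁) h ?_ ?_
  · rw [one_add_one_eq_two, Bp_two_eq, R₂₁]
    ring
  · rw [← (hasWirtinger_R₂ hpos hz).dzbar_eq, dzbar_R₂ hpos hG hz, ← h1.dzbar_eq, ← h2.dzbar_eq]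
    ring

/-- The derivatives of the generators. In `θv₂`, `θv₃`, `θm₁`, `θm₂` all terms in `u` cancel, so
that `θ` preserves the polynomial ring in the generators other than `u`. -/
theorem hasWirtinger_gen (i : Gen) (hz : z ∈ B.U) :
    HasWirtinger (B.gen i) (B.thetaGen i z) (B.dzbarGen i z) z := by
  have hc := fun c : ℂ => HasWirtinger.const c z
  have hx := (hasTheta_xi hz).hasWirtinger
  have hu := hasWirtinger_Bp hpos 1 hz
  have hV₁ := hasWirtinger_V₁ hpos hG hz
  have hV₂ := hasWirtinger_V₂ hpos hG hz
  have hQ := fun p => hasWirtinger_Q (B := B) p hz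
  have hR₁ := hasWirtinger_R₁ hpos hG hz
  have hv₃ := gen_v₃_eq hz
  rw [← sub_eq_zero] at hv₃
  cases i with
  | u =>
    refine hu.congr_val ?_ hu.dzbar_eq.symm
    rw [one_add_one_eq_two, Bp_two_eq]
    simp only [thetaGen]
    ring
  | v₁ =>
    refine HasWirtinger.congr_val (f := B.gen .v₁) (hV₁.add (hc (3 / 5))) (add_zero _) ?_
    rw [add_zero]
    exact hV₁.dzbar_eq.symm
  | v₂ =>
    refine HasWirtinger.congr_val (f := B.gen .v₂) (hV₂.add (hc (2 / 25))) ?_ (add_zero _)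
    rw [Bp_two_eq]
    simp only [thetaGen]
    linear_combination -hv₃
  | v₃ =>
    have h3 := hasWirtinger_Bp hpos 3 hz
    have h := ((h3.sub (hu.mul (((hV₂.neg).add (hx.mul hV₁)).add
      (hx.const_mul (2 / 5))))).add ((hc (7 / 25)).add (hx.const_mul (1 / 25)))).congr
      (g := B.gen .v₃) (by filter_upwards [mem_nhds hz] with y hy using gen_v₃_eq hy)
    refine h.congr_val ?_ ?_
    · rw [show 3 + 1 = 4 from rfl, one_add_one_eq_two, Bp_four hpos hz, Bp_two_eq]
      simp only [thetaGen]
      linear_combination (-2 * xi z) * hv₃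
    · rw [← h3.dzbar_eq, dzbar_Bp_three hpos hG hz, ← hu.dzbar_eq, ← hV₁.dzbar_eq]
      simp only [dzbarGen]
      ring
  | Q₀ => exact hQ 0
  | Q₁ => exact hQ 1
  | Q₂ => exact hQ 2
  | Q₃ => exact (hQ 3).congr_val (by rw [show 3 + 1 = 4 from rfl, Q_four hz]; rfl) rfl
  | m₁ =>
    have h := ((((hQ 0).const_mul (2 / 25)).add ((hQ 1).const_mul (3 / 5))).add (hQ 2)).sub hR₁
    refine HasWirtinger.congr_val (f := B.gen .m₁) h ?_ ?_
    · simp only [thetaGen, R₂₁]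
    · rw [← hR₁.dzbar_eq]
      simp only [dzbarGen]
      ring
  | m₂ =>
    refine ((((hasWirtinger_mHol hz).sub (hasWirtinger_R₂₁ hpos hG hz))).congr
      (by filter_upwards [mem_nhds hz] with y hy using gen_m₂_eq hy)).congr_val rfl ?_
    simp only [dzbarGen]
    ring

theorem differentiableAt_gen (i : Gen) (z : ℂ) (hz : z ∈ B.U) : DifferentiableAt ℝ (B.gen i) z :=
  (hasWirtinger_gen hpos hG i hz).differentiableAt

end

/-- The generators other than `u`. -/
def uFree : Set Gen := {Gen.u}ᶜ

namespace Rep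

theorem gen_of_ne {i : Gen} (hi : i ≠ .u) : B.Rep uFree (B.gen i) := gen hi

theorem V₁ : B.Rep uFree B.V₁ :=
  ((gen_of_ne (i := .v₁) nofun).sub (const (3 / 5))).congr (.of_forall V₁_eq_gen)

theorem V₂ : B.Rep uFree B.V₂ :=
  ((gen_of_ne (i := .v₂) nofun).sub (const (2 / 25))).congr (.of_forall V₂_eq_gen)

theorem Q₀ : B.Rep uFree (B.Q 0) := gen_of_ne (i := .Q₀) nofun
theorem Q₁ : B.Rep uFree (B.Q 1) := gen_of_ne (i := .Q₁) nofun
theorem Q₂ : B.Rep uFree (B.Q 2) := gen_of_ne (i := .Q₂) nofun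
theorem Q₃ : B.Rep uFree (B.Q 3) := gen_of_ne (i := .Q₃) nofun
theorem v₃ : B.Rep uFree (B.gen .v₃) := gen_of_ne nofun

theorem R₁ : B.Rep uFree B.R₁ :=
  ((((Q₀.const_mul (2 / 25)).add (Q₁.const_mul (3 / 5))).add Q₂).sub
    (gen_of_ne (i := .m₁) nofun)).congr (.of_forall R₁_eq_gen)

theorem R₂₁ : B.Rep uFree B.R₂₁ := by
  have h : B.Rep uFree B.mHol :=
    (((Q₀.mul ((const (7 / 25)).sub (xi.const_mul (1 / 25)))).sub
      (Q₁.mul ((const (2 / 25)).add (xi.const_mul (2 / 5))))).sub (Q₂.mul xi)).add Q₃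
  refine (h.sub (gen_of_ne (i := .m₂) nofun)).congr_on fun z hz => ?_
  rw [gen_m₂_eq hz]
  ring

theorem thetaGen {i : Gen} (hi : i ∈ uFree) : B.Rep uFree (B.thetaGen i) := by
  cases i
  case u => exact absurd rfl hi
  all_goals
    simp only [Branch.thetaGen]
    repeat' with_reducible first
      | exact V₁ | exact V₂ | exact R₁ | exact R₂₁ | exact xi | exact Q₀ | exact Q₁ | exact Q₂
      | exact Q₃ | exact v₃ | exact id | exact const _ | apply Rep.add | apply Rep.sub
      | apply Rep.mul | apply Rep.pow | apply Rep.neg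

variable (hpos : ∀ z ∈ B.U, 0 < B.hermNorm z) (hG : ∀ z ∈ B.U, B.G z ≠ 0)
include hpos hG

/-- `θ` preserves the polynomial ring in the generators other than `u`. -/
theorem theta_of_uFree {f : ℂ → ℂ} (hf : B.Rep uFree f) : B.Rep uFree (MirrorQuintic.theta f) :=
  hf.theta (differentiableAt_gen hpos hG) fun _ hi =>
    (thetaGen hi).congr_on fun _ hz => (hasWirtinger_gen hpos hG _ hz).theta_eq

end Rep

/-! ### The degree in `u` -/

variable {B : Branch} {z : ℂ}

variable (B) in
/-- The function `f` is generically a polynomial of degree at most `n` in `u`, with coefficients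
given by elements of `J` that do not involve `u`. -/
def DegLE : ℕ → (ℂ → ℂ) → Prop
  | 0, f => B.Rep uFree f
  | n + 1, f => ∃ a b, B.Rep uFree a ∧ DegLE n b ∧ ∀ᶠ z in B.generic, f z = a z + B.Bp 1 z * b z

theorem Rep.u : B.Rep Set.univ (B.Bp 1) := gen (i := .u) (Set.mem_univ _)

namespace DegLE

variable {f f' : ℂ → ℂ} {m n : ℕ}

theorem of_rep (hf : B.Rep uFree f) : B.DegLE n f := by
  induction n generalizing f with
  | zero => exact hf
  | succ n ih => exact ⟨f, fun _ => 0, hf, ih (Rep.const 0), .of_forall fun z => by simp⟩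

theorem congr (hf : B.DegLE n f) (h : ∀ᶠ z in B.generic, f' z = f z) : B.DegLE n f' := by
  cases n with
  | zero => exact Rep.congr hf h
  | succ n =>
    obtain ⟨a, b, ha, hb, hab⟩ := hf
    refine ⟨a, b, ha, hb, ?_⟩
    filter_upwards [h, hab] with z h1 h2
    rw [h1, h2]

theorem rep (hf : B.DegLE n f) : B.Rep Set.univ f := by
  induction n generalizing f with
  | zero => exact Rep.mono hf (Set.subset_univ _)
  | succ n ih =>
    obtain ⟨a, b, ha, hb, hab⟩ := hf
    exact ((ha.mono (Set.subset_univ _)).add (Rep.u.mul (ih hb))).congr hab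

theorem mono (hmn : m ≤ n) (hf : B.DegLE m f) : B.DegLE n f := by
  induction m generalizing f n with
  | zero => exact of_rep hf
  | succ m ih =>
    obtain ⟨a, b, ha, hb, hab⟩ := hf
    obtain ⟨n, rfl⟩ := Nat.exists_eq_add_of_le' (Nat.one_le_of_lt hmn)
    exact ⟨a, b, ha, ih (by omega) hb, hab⟩

theorem add (hf : B.DegLE n f) (hg : B.DegLE n f') : B.DegLE n fun z => f z + f' z := by
  induction n generalizing f f' with
  | zero => exact Rep.add hf hg
  | succ n ih =>
    obtain ⟨a, b, ha, hb, hab⟩ := hf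
    obtain ⟨a', b', ha', hb', hab'⟩ := hg
    refine ⟨_, _, ha.add ha', ih hb hb', ?_⟩
    filter_upwards [hab, hab'] with z h1 h2
    rw [h1, h2]
    ring

theorem rep_mul (hf : B.Rep uFree f) (hg : B.DegLE n f') : B.DegLE n fun z => f z * f' z := by
  induction n generalizing f' with
  | zero => exact Rep.mul hf hg
  | succ n ih =>
    obtain ⟨a, b, ha, hb, hab⟩ := hg
    refine ⟨_, _, hf.mul ha, ih hb, ?_⟩
    filter_upwards [hab] with z h
    rw [h]
    ring

theorem u_mul (hf : B.DegLE n f) : B.DegLE (n + 1) fun z => B.Bp 1 z * f z :=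
  ⟨_, _, Rep.const 0, hf, .of_forall fun _ => (zero_add _).symm⟩

theorem mul (hf : B.DegLE m f) (hg : B.DegLE n f') : B.DegLE (m + n) fun z => f z * f' z := by
  induction m generalizing f with
  | zero => exact mono (by omega) (rep_mul hf hg)
  | succ m ih =>
    obtain ⟨a, b, ha, hb, hab⟩ := hf
    refine ((mono (n := m + n + 1) (by omega) (rep_mul ha hg)).add (ih hb).u_mul).congr
      (f' := fun z => f z * f' z) ?_ |>.mono (by omega)
    filter_upwards [hab] with z h
    rw [h]
    ring

theorem sum {ι : Type*} (s : Finset ι) {f : ι → ℂ → ℂ} (h : ∀ i ∈ s, B.DegLE n (f i)) :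
    B.DegLE n fun z => ∑ i ∈ s, f i z := by
  classical
  induction s using Finset.induction_on with
  | empty => exact (of_rep (Rep.const 0)).congr (.of_forall fun z => by simp)
  | insert i s hi ih =>
    refine ((h i (Finset.mem_insert_self _ _)).add
      (ih fun j hj => h j (Finset.mem_insert_of_mem hj))).congr (.of_forall fun z => ?_)
    rw [Finset.sum_insert hi]

variable (hpos : ∀ z ∈ B.U, 0 < B.hermNorm z) (hG : ∀ z ∈ B.U, B.G z ≠ 0)
include hpos hG

theorem differentiableAt (hf : B.DegLE n f) : ∀ᶠ z in B.generic, DifferentiableAt ℝ f z :=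
  hf.rep.differentiableAt (differentiableAt_gen hpos hG)

theorem theta (hf : B.DegLE n f) : B.DegLE (n + 1) (MirrorQuintic.theta f) := by
  induction n generalizing f with
  | zero => exact of_rep (Rep.theta_of_uFree hpos hG hf)
  | succ n ih =>
    obtain ⟨a, b, ha, hb, hab⟩ := hf
    have ha' := of_rep (n := n + 2) (Rep.theta_of_uFree hpos hG ha)
    have h1 := (rep_mul Rep.V₂ hb).mono (n := n + 2) (by omega)
    have h2 := (rep_mul Rep.V₁ hb).u_mul.mono (n := n + 2) (by omega)
    have h3 := (rep_mul (Rep.const (-1)) hb).u_mul.u_mul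
    refine ((((ha'.add h1).add h2).add h3).add (ih hb).u_mul).congr ?_
    filter_upwards [eventually_eventually_nhds hab, of_rep (n := 0) ha |>.differentiableAt hpos hG,
      hb.differentiableAt hpos hG, eventually_mem] with z h1 h2 h3 hz
    have h := ((HasWirtinger.of_differentiableAt h2).add ((hasWirtinger_gen hpos hG .u hz).mul
      (HasWirtinger.of_differentiableAt h3))).congr h1
    rw [h.theta_eq]
    simp only [thetaGen, gen]
    ring

end DegLE

/-! ### Covariant derivatives of the amplitudes -/

variable {F : ℕ → ℕ → ℂ → ℂ} {g h n : ℕ}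

theorem yukawaX_eq_xi (hz : z ∈ B.U) : yukawaX z = 5 * (1 + xi z) := by
  have h1 := one_sub_ne_zero hz
  rw [yukawaX_eq (ne_zero hz), xi_eq hz, xiFun]
  field_simp
  ring

theorem initial_eq (hgh : 2 < 2 * g + h) : B.initial F g h = F g h := by
  unfold initial
  split <;> first | rfl | omega

theorem amp_zero (hgh : 2 < 2 * g + h) : B.amp F g h 0 = F g h := by
  rw [amp, if_pos (by omega), initial_eq hgh]

theorem amp_succ (hn : 3 - (2 * g + h) ≤ n) :
    B.amp F g h (n + 1) = B.covD n (2 * g - 2 + h) (B.amp F g h n) := by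
  rw [amp, if_neg (by omega), if_neg (by omega)]

/-- The weight `x^{g+h-1} z^{n+h/2}` relating `P_n^{(g,h)}` and `ℱ_n^{(g,h)}`. -/
theorem hasWirtinger_weight (k : ℤ) (h n : ℕ) (hz : z ∈ B.U) :
    HasWirtinger (fun y => yukawaX y ^ k * B.sqrtz y ^ h * y ^ n)
      ((k * xi z + n + h / 2) * (yukawaX z ^ k * B.sqrtz z ^ h * z ^ n)) 0 z := by
  have hx := yukawaX_ne_zero hz
  have hs := sqrtz_ne_zero hz
  have h0 := ne_zero hz
  refine (((((hasTheta_yukawaX hz).hasWirtinger.zpow k hx).mul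
    ((hasTheta_sqrtz hz).hasWirtinger.pow h)).mul
      ((hasTheta_id z).hasWirtinger.pow n))).congr_val ?_ ?_
  · have e1 : (h : ℂ) * B.sqrtz z ^ (h - 1) * (1 / 2 * B.sqrtz z) = h / 2 * B.sqrtz z ^ h := by
      cases h with
      | zero => simp
      | succ h => rw [Nat.add_sub_cancel, pow_succ]; ring
    have e2 : (n : ℂ) * z ^ (n - 1) * z = n * z ^ n := by
      cases n with
      | zero => simp
      | succ n => rw [Nat.add_sub_cancel, pow_succ]; ring
    rw [e1, e2, zpow_sub_one₀ hx, xi_eq hz]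
    field_simp
    ring
  · ring

theorem weight_ne_zero (k : ℤ) (h n : ℕ) (hz : z ∈ B.U) :
    yukawaX z ^ k * B.sqrtz z ^ h * z ^ n ≠ 0 :=
  mul_ne_zero (mul_ne_zero (zpow_ne_zero _ (yukawaX_ne_zero hz)) (pow_ne_zero _ (sqrtz_ne_zero hz)))
    (pow_ne_zero _ (ne_zero hz))

theorem differentiableAt_amp (hz : z ∈ B.U) (hd : DifferentiableAt ℝ (B.PFun F g h n) z) :
    DifferentiableAt ℝ (B.amp F g h n) z := by
  refine (((HasWirtinger.of_differentiableAt hd).div (hasWirtinger_weight (g + h - 1) h n hz)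
    (weight_ne_zero _ _ _ hz)).congr ?_).differentiableAt
  filter_upwards [mem_nhds hz] with y hy
  rw [PFun, mul_div_cancel_left₀ _ (weight_ne_zero _ _ _ hy)]

theorem hasWirtinger_PFun (hz : z ∈ B.U) (hd : DifferentiableAt ℝ (B.PFun F g h n) z) :
    HasWirtinger (B.PFun F g h n)
      (((((g : ℤ) + h - 1 : ℤ) : ℂ) * xi z + n + h / 2) * B.PFun F g h n z
        + yukawaX z ^ ((g : ℤ) + h - 1) * B.sqrtz z ^ h * z ^ n * theta (B.amp F g h n) z)
      (yukawaX z ^ ((g : ℤ) + h - 1) * B.sqrtz z ^ h * z ^ n * dzbar (B.amp F g h n) z) z := by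
  refine HasWirtinger.congr_val (f := B.PFun F g h n) ((hasWirtinger_weight (g + h - 1) h n hz).mul
    (HasWirtinger.of_differentiableAt (differentiableAt_amp hz hd))) ?_ ?_
  · rw [PFun]
    ring
  · ring

section

variable (hpos : ∀ z ∈ B.U, 0 < B.hermNorm z)
include hpos

/-- The covariant derivative `D_z` in terms of the functions `P_n^{(g,h)}`. -/
theorem PFun_succ (hn : 3 - (2 * g + h) ≤ n) (hz : z ∈ B.U) (hG : B.G z ≠ 0)
    (hd : DifferentiableAt ℝ (B.PFun F g h n) z) :
    B.PFun F g h (n + 1) z = theta (B.PFun F g h n) z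
      + (-(((g : ℤ) + h - 1 : ℤ) * xi z + n + h / 2 + n * (B.V₁ z - 1))) * B.PFun F g h n z
      + B.Bp 1 z * ((2 * n + (2 * g - 2 + h)) * B.PFun F g h n z) := by
  have h0 := ne_zero hz
  have h2 : B.Gam z = (B.V₁ z - 1 - 2 * B.Bp 1 z) / z := by
    rw [Gam, V₁, A, Function.iterate_one, theta]
    field_simp
    ring
  rw [(hasWirtinger_PFun hz hd).theta_eq, PFun, PFun, amp_succ hn, covD, h2, dz_K hpos hz,
    ← Bp_eq hpos 1 hz, theta, pow_succ]
  push_cast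
  field_simp
  ring

variable (hG : ∀ z ∈ B.U, B.G z ≠ 0)
include hG

theorem DegLE.PFun_succ {k : ℕ} (hn : 3 - (2 * g + h) ≤ n) (hP : B.DegLE k (B.PFun F g h n)) :
    B.DegLE (k + 1) (B.PFun F g h (n + 1)) := by
  have h1 := hP.theta hpos hG
  have hr : B.Rep uFree fun z =>
      -(((((g : ℤ) + h - 1 : ℤ) : ℂ) * xi z + n + h / 2 + n * (B.V₁ z - 1))) :=
    ((((Rep.xi.const_mul _).add (Rep.const _)).add (Rep.const _)).add
      ((Rep.V₁.sub (Rep.const 1)).const_mul _)).neg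
  have h2 := (DegLE.rep_mul hr hP).mono (n := k + 1) (by omega)
  have h3 := (DegLE.rep_mul (Rep.const (2 * n + (2 * g - 2 + h))) hP).u_mul
  refine ((h1.add h2).add h3).congr ?_
  filter_upwards [hP.differentiableAt hpos hG, eventually_mem] with z hd hz
  exact Branch.PFun_succ hpos hn hz (hG z hz) hd

/-- The initial datum `P_1^{(1,0)}`; the coefficient of `u` is `(2 - 62/3)/2 = -28/3`. -/
theorem PFun_one_zero (hz : z ∈ B.U) : B.PFun F 1 0 1 z
    = 1 / 2 * (1 / 6 * xi z - B.V₁ z - 25 / 6) + B.Bp 1 z * (-28 / 3) := by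
  have h0 := ne_zero hz
  have h1 := one_sub_ne_zero hz
  have hg := hG z hz
  have hA : z * (dz B.G z / B.G z) = B.V₁ z - 1 - 2 * B.Bp 1 z := by
    rw [V₁, A, Function.iterate_one, theta]
    field_simp
    ring
  have hd : z * dz (fun y : ℂ => 1 - 5 ^ 5 * y) z = -5 ^ 5 * z := by
    refine (HasTheta.hasWirtinger (f := fun y : ℂ => 1 - 5 ^ 5 * y) ?_).theta_eq
    exact ((HasTheta.const 1 z).sub ((hasTheta_id z).const_mul (5 ^ 5))).congr_theta (by ring)
  have hx : z * (dz (fun y : ℂ => 1 - 5 ^ 5 * y) z / (1 - 5 ^ 5 * z)) = -xi z := by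
    rw [xi_eq hz, xiFun, ← mul_div_assoc, hd]
    ring
  have hK : z * dz B.K z = -B.Bp 1 z := by
    rw [dz_K hpos hz, ← Bp_eq hpos 1 hz]
    field_simp
  have e : B.PFun F 1 0 1 z = z * B.F10 z := by
    simp [PFun, amp, initial]
  have hi : z * ((-1 - 50 / 12) / z) = -31 / 6 := by
    field_simp
    norm_num
  rw [e, F10]
  linear_combination 1 / 2 * (4 - (-200) / 12) * hK - 1 / 2 * hA - 1 / 12 * hx + 1 / 2 * hi

/-- The initial datum `P_2^{(0,1)} = m₁ - v₁Q₁ - v₂Q₀`, written with `V₁, V₂, R₁`. -/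
theorem PFun_zero_one (hz : z ∈ B.U) : B.PFun F 0 1 2 z
    = B.Q 2 z - B.V₁ z * B.Q 1 z - B.V₂ z * B.Q 0 z - B.R₁ z := by
  rw [← disk_eq hpos hG hz]
  simp [PFun, amp, initial]

/-- The initial datum `P_1^{(0,2)}`. -/
theorem PFun_zero_two (hz : z ∈ B.U) : B.PFun F 0 2 1 z
    = 1 / 2 * (B.Q 2 z - B.V₁ z * B.Q 1 z - B.V₂ z * B.Q 0 z - B.R₁ z) ^ 2
      + 375 / 2 * z ^ 2 * (1 + xi z) ^ 2 + B.Bp 1 z * (-5 / 2 * z * (1 + xi z)) := by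
  have h0 := ne_zero hz
  have h1 := one_sub_ne_zero hz
  have hy : yukawa z ≠ 0 := by
    rw [yukawa]
    exact div_ne_zero (by norm_num) (mul_ne_zero h1 (pow_ne_zero 3 h0))
  have hK : z * dz B.K z = -B.Bp 1 z := by
    rw [dz_K hpos hz, ← Bp_eq hpos 1 hz]
    field_simp
  have e : B.PFun F 0 2 1 z = yukawaX z * B.sqrtz z ^ 2 * z * B.F02 z := by
    simp [PFun, amp, initial]
  have hx := yukawaX_eq_xi hz
  have hi : 75 / (2 * (1 - 5 ^ 5 * z)) = 15 / 2 * yukawaX z := by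
    rw [yukawaX_eq h0]
    field_simp
    norm_num
  have hd : yukawaX z * (-B.disk z * B.diskUp z - 1 / 2 * yukawa z * B.diskUp z * B.diskUp z)
      = 1 / 2 * z ^ 3 * B.disk z ^ 2 := by
    rw [diskUp, yukawaX]
    field_simp
    ring
  rw [e, F02, hi, ← disk_eq hpos hG hz, mul_pow, mul_pow, sqrtz_sq hz]
  rw [hx] at hd ⊢
  linear_combination z ^ 2 * hd + 5 / 2 * z * (1 + xi z) * hK

theorem degLE_disk : B.DegLE 0 (B.PFun F 0 1 2) :=
  Rep.congr_on (((Rep.Q₂.sub (Rep.V₁.mul Rep.Q₁)).sub (Rep.V₂.mul Rep.Q₀)).sub Rep.R₁)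
    fun _ hz => PFun_zero_one hpos hG hz

/-- `P_1^{(g,h)}` has degree at most one in `u`. -/
theorem DegLE.PFun_one (hgh : 1 < 2 * g + h)
    (hP : 2 < 2 * g + h → B.Rep uFree (B.PFun F g h 0)) : B.DegLE 1 (B.PFun F g h 1) := by
  by_cases h2 : 2 < 2 * g + h
  · exact DegLE.PFun_succ (k := 0) hpos hG (by omega) (hP h2)
  · obtain ⟨rfl, rfl⟩ | ⟨rfl, rfl⟩ : g = 1 ∧ h = 0 ∨ g = 0 ∧ h = 2 := by omega
    · exact ⟨_, _, (((Rep.xi.const_mul _).sub Rep.V₁).sub (Rep.const _)).const_mul _,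
        Rep.const _, eventually_mem.mono fun z hz => PFun_one_zero hpos hG hz⟩
    · have hx : B.Rep uFree fun z => 1 + xi z := (Rep.const 1).add Rep.xi
      exact ⟨_, _, (((((Rep.Q₂.sub (Rep.V₁.mul Rep.Q₁)).sub (Rep.V₂.mul Rep.Q₀)).sub
        Rep.R₁).pow 2).const_mul _).add (((Rep.id.pow 2).const_mul _).mul (hx.pow 2)),
        (Rep.id.const_mul _).mul hx, eventually_mem.mono fun z hz => PFun_zero_two hpos hG hz⟩

/-- `P_2^{(g,h)}` has degree at most two in `u`. -/
theorem DegLE.PFun_two (hgh : 0 < 2 * g + h)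
    (hP : 2 < 2 * g + h → B.Rep uFree (B.PFun F g h 0)) : B.DegLE 2 (B.PFun F g h 2) := by
  by_cases h1 : 1 < 2 * g + h
  · exact DegLE.PFun_succ hpos hG (by omega) (DegLE.PFun_one hpos hG h1 hP)
  · obtain ⟨rfl, rfl⟩ : g = 0 ∧ h = 1 := by omega
    exact (degLE_disk hpos hG).mono (by omega)

end

end Branch

/-! ### Polynomials not involving `u` -/

/-- In characteristic zero, a polynomial does not involve `u` if and only if its derivative with
respect to `u` vanishes. -/
theorem mem_supported_uFree_iff {p : J} :
    p ∈ MvPolynomial.supported (RatFunc ℂ) Branch.uFree ↔ MvPolynomial.pderiv Gen.u p = 0 := by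
  rw [MvPolynomial.mem_supported]
  constructor
  · exact fun h => MvPolynomial.pderiv_eq_zero_of_notMem_vars fun hu => h hu rfl
  · rintro h i hi rfl
    obtain ⟨s, hs, hsu⟩ := (MvPolynomial.mem_vars_iff_mem_support _).mp hi
    have h1 := MvPolynomial.coeff_pderiv (i := Gen.u) p (s - Finsupp.single Gen.u 1)
    have h2 : s - Finsupp.single Gen.u 1 + Finsupp.single Gen.u 1 = s :=
      tsub_add_cancel_of_le (Finsupp.single_le_iff.mpr
        (Nat.one_le_iff_ne_zero.mpr (Finsupp.mem_support_iff.mp hsu)))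
    rw [h, MvPolynomial.coeff_zero, h2] at h1
    rcases mul_eq_zero.mp h1.symm with h3 | h3
    · exact MvPolynomial.mem_support_iff.mp hs h3
    · exact Nat.cast_add_one_ne_zero _ h3

/-- Comparison of the coefficients of powers of `u`. -/
theorem coeff_u_eq_zero {a b c : J} (ha : MvPolynomial.pderiv Gen.u a = 0)
    (hb : MvPolynomial.pderiv Gen.u b = 0) (hc : MvPolynomial.pderiv Gen.u c = 0)
    (h : a + MvPolynomial.X Gen.u * b + MvPolynomial.X Gen.u ^ 2 * c = 0) :
    a = 0 ∧ b = 0 ∧ c = 0 := by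
  -- Differentiate the relation twice with respect to `u`.
  have h1 : b + MvPolynomial.X Gen.u * (2 * c) = 0 := by
    have h' := congrArg (MvPolynomial.pderiv Gen.u) h
    simp only [map_add, map_zero, MvPolynomial.pderiv_mul, MvPolynomial.pderiv_pow,
      MvPolynomial.pderiv_X_self, ha, hb, hc] at h'
    linear_combination h'
  have h2 : 2 * c = 0 := by
    have h' := congrArg (MvPolynomial.pderiv Gen.u) h1
    simp only [map_add, map_zero, MvPolynomial.pderiv_mul, MvPolynomial.pderiv_X_self, two_mul,
      hb, hc] at h'
    linear_combination h'
  have h3 : c = 0 := by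
    rcases mul_eq_zero.mp h2 with h4 | h4
    · exact absurd h4 two_ne_zero
    · exact h4
  have h4 : b = 0 := by simpa [h3] using h1
  exact ⟨by simpa [h3, h4] using h, h4, h3⟩

/-- Both orders of differentiation are compared as derivations, on the variables. -/
theorem pderiv_comm (i j : Gen) (p : J) : MvPolynomial.pderiv i (MvPolynomial.pderiv j p)
    = MvPolynomial.pderiv j (MvPolynomial.pderiv i p) := by
  have h : ⁅(MvPolynomial.pderiv i : Derivation (RatFunc ℂ) J J),
      (MvPolynomial.pderiv j : Derivation (RatFunc ℂ) J J)⁆ = 0 := by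
    classical
    refine MvPolynomial.derivation_ext fun k => ?_
    rw [Derivation.commutator_apply, MvPolynomial.pderiv_X, MvPolynomial.pderiv_X,
      Derivation.zero_apply, Pi.single_apply, Pi.single_apply]
    split_ifs <;> simp
  have h' := congrArg (fun D : Derivation (RatFunc ℂ) J J => D p) h
  exact sub_eq_zero.mp (by simpa only [Derivation.commutator_apply, Derivation.zero_apply] using h')

namespace Branch

/-! ### The holomorphic anomaly equation in the polynomial ring -/

variable {B : Branch} {z : ℂ} {F : ℕ → ℕ → ℂ → ℂ} {g h : ℕ}

variable (B) in
/-- The function `P_1^{(g,h-1)}`, zero if `h = 0`. -/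
def YFun (F : ℕ → ℕ → ℂ → ℂ) (g h : ℕ) (z : ℂ) : ℂ := if h = 0 then 0 else B.PFun F g (h - 1) 1 z

theorem PFun_mul_PFun (hz : z ∈ B.U) {g₁ g₂ h₁ h₂ : ℕ} :
    B.PFun F g₁ h₁ 1 z * B.PFun F g₂ h₂ 1 z = yukawaX z ^ (((g₁ + g₂ : ℕ) : ℤ) + (h₁ + h₂ : ℕ) - 2)
      * B.sqrtz z ^ (h₁ + h₂) * z ^ 2 * (B.amp F g₁ h₁ 1 z * B.amp F g₂ h₂ 1 z) := by
  have e : (((g₁ + g₂ : ℕ) : ℤ) + (h₁ + h₂ : ℕ) - 2)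
      = ((g₁ : ℤ) + h₁ - 1) + ((g₂ : ℤ) + h₂ - 1) := by push_cast; ring
  rw [e, zpow_add₀ (yukawaX_ne_zero hz), pow_add, PFun, PFun]
  ring

section

variable (hpos : ∀ z ∈ B.U, 0 < B.hermNorm z) (hG : ∀ z ∈ B.U, B.G z ≠ 0)
include hpos hG

/-- The right-hand side of the anomaly equation in terms of `∂V₁/∂z̄` and `∂R₁/∂z̄`. -/
theorem weight_mul_anomalyRHS (hz : z ∈ B.U) :
    yukawaX z ^ ((g : ℤ) + h - 1) * B.sqrtz z ^ h * B.anomalyRHS F g h z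
      = B.WFun F g h z * dzbar B.V₁ z - B.YFun F g h z * dzbar B.R₁ z := by
  have hx := yukawaX_ne_zero hz
  have h0 := ne_zero hz
  have hC : z ^ 2 * dzbar B.V₁ z = -yukawaX z * B.Cbar z := by
    rw [(hasWirtinger_V₁ hpos hG hz).dzbar_eq, yukawaX]
    ring
  have ek : yukawaX z ^ ((g : ℤ) + h - 1) = yukawaX z ^ ((g : ℤ) + h - 2) * yukawaX z := by
    rw [← zpow_add_one₀ hx]
    congr 1
    ring
  have hS : ∑ p ∈ splittings g h, B.PFun F p.1.1 p.2.1 1 z * B.PFun F p.1.2 p.2.2 1 z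
      = yukawaX z ^ ((g : ℤ) + h - 2) * B.sqrtz z ^ h * z ^ 2 *
        ∑ p ∈ splittings g h, B.amp F p.1.1 p.2.1 1 z * B.amp F p.1.2 p.2.2 1 z := by
    rw [Finset.mul_sum]
    refine Finset.sum_congr rfl fun p hp => ?_
    rw [splittings, Finset.mem_filter, Finset.mem_product] at hp
    rw [PFun_mul_PFun hz, Finset.HasAntidiagonal.mem_antidiagonal.mp hp.1.1,
      Finset.HasAntidiagonal.mem_antidiagonal.mp hp.1.2]
  have h2 : (if g = 0 then 0 else B.PFun F (g - 1) h 2 z)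
      = yukawaX z ^ ((g : ℤ) + h - 2) * B.sqrtz z ^ h * z ^ 2
        * (if g = 0 then 0 else B.amp F (g - 1) h 2 z) := by
    split_ifs with hg
    · ring
    · rw [PFun, Nat.cast_sub (Nat.one_le_iff_ne_zero.mpr hg)]
      congr 4
      push_cast
      ring
  have hY : yukawaX z ^ ((g : ℤ) + h - 1) * B.sqrtz z ^ h
        * (if h = 0 then 0 else B.diskBar z * B.amp F g (h - 1) 1 z)
      = (dzbar B.R₁ z - (B.Bp 1 z * B.Q 0 z - B.Q 1 z) * dzbar B.V₁ z) * B.YFun F g h z := by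
    rw [YFun]
    split_ifs with hh
    · ring
    · have hd := diskBar_eq hpos hG hz
      have hs := sqrtz_sq hz
      obtain ⟨k, rfl⟩ := Nat.exists_eq_succ_of_ne_zero hh
      have e' : ((g : ℤ) + (k.succ - 1 : ℕ) - 1) = (g : ℤ) + k.succ - 2 := by
        push_cast [Nat.succ_sub_one]
        ring
      rw [ek, PFun, e', Nat.succ_sub_one, pow_succ]
      linear_combination yukawaX z ^ ((g : ℤ) + k.succ - 2) * B.sqrtz z ^ k * B.amp F g k 1 z
        * (B.sqrtz z * hd + (dzbar B.R₁ z - (B.Bp 1 z * B.Q 0 z - B.Q 1 z) * dzbar B.V₁ z) * hs)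
  rw [anomalyRHS, mul_sub, hY, WFun, hS, h2, ek, YFun]
  linear_combination (-(1 / 2) * yukawaX z ^ ((g : ℤ) + h - 2) * B.sqrtz z ^ h
    * ((∑ p ∈ splittings g h, B.amp F p.1.1 p.2.1 1 z * B.amp F p.1.2 p.2.2 1 z)
        + if g = 0 then 0 else B.amp F (g - 1) h 2 z)) * (-1) * hC

/-- The chain rule in `J`. -/
theorem dzbar_ev (p : J) : ∀ᶠ z in B.generic, HasWirtinger (B.ev p) (theta (B.ev p) z)
    (B.ev (MvPolynomial.pderiv .u p) z * dzbar (B.Bp 1) z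
      + (B.ev (MvPolynomial.pderiv .v₁ p) z - B.Bp 1 z * B.ev (MvPolynomial.pderiv .v₂ p) z
        - B.Bp 1 z * (B.Bp 1 z + xi z) * B.ev (MvPolynomial.pderiv .v₃ p) z) * dzbar B.V₁ z
      - (B.ev (MvPolynomial.pderiv .m₁ p) z + B.Bp 1 z * B.ev (MvPolynomial.pderiv .m₂ p) z)
        * dzbar B.R₁ z) z := by
  filter_upwards [hasWirtinger_ev (differentiableAt_gen hpos hG) p, eventually_mem] with z h1 hz
  refine h1.congr_val rfl ?_
  simp only [fun i => (hasWirtinger_gen hpos hG i hz).dzbar_eq]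
  have hs : ∀ f : Gen → ℂ, ∑ i, f i = f .u + (f .v₁ + (f .v₂ + (f .v₃ + (f .Q₀ + (f .Q₁
      + (f .Q₂ + (f .Q₃ + (f .m₁ + f .m₂)))))))) := by
    intro f
    change Finset.sum ⟨(([.u, .v₁, .v₂, .v₃, .Q₀, .Q₁, .Q₂, .Q₃, .m₁, .m₂] : List Gen) :
      Multiset Gen), _⟩ f = _
    simp [Finset.sum]
  rw [hs]
  simp only [dzbarGen, Pi.zero_apply]
  ring

/-- The anomaly equation at `(g,h)` as a condition in `J`. -/
theorem anomalyEquation_iff (hind : B.Independent) (hgh : 2 < 2 * g + h) {p y w : J}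
    (hp : ∀ᶠ z in B.generic, B.PFun F g h 0 z = B.ev p z)
    (hy : ∀ᶠ z in B.generic, B.YFun F g h z = B.ev y z)
    (hw : ∀ᶠ z in B.generic, B.WFun F g h z = B.ev w z) :
    B.AnomalyEquation F g h ↔ MvPolynomial.pderiv .u p = 0 ∧
      MvPolynomial.pderiv .v₁ p - MvPolynomial.X .u * MvPolynomial.pderiv .v₂ p
        - MvPolynomial.X .u * (MvPolynomial.X .u + MvPolynomial.C xiRat)
          * MvPolynomial.pderiv .v₃ p = w ∧
      MvPolynomial.pderiv .m₁ p + MvPolynomial.X .u * MvPolynomial.pderiv .m₂ p = y := by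
  set a : J := MvPolynomial.pderiv .v₁ p - MvPolynomial.X .u * MvPolynomial.pderiv .v₂ p
    - MvPolynomial.X .u * (MvPolynomial.X .u + MvPolynomial.C xiRat)
      * MvPolynomial.pderiv .v₃ p with ha
  set c : J := MvPolynomial.pderiv .m₁ p + MvPolynomial.X .u * MvPolynomial.pderiv .m₂ p with hc
  have hxi : ∀ᶠ z in B.generic, B.ev (MvPolynomial.C xiRat) z = xi z := by
    filter_upwards [eventually_mem, eventually_of_cofinite eventually_ratEval_xiRat] with z h1 h2
    rw [ev_C, h2, xi_eq h1]
  have hX : ∀ z, B.ev (MvPolynomial.X .u) z = B.Bp 1 z := fun z => ev_X .u z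
  have eva : ∀ᶠ z in B.generic, B.ev a z = B.ev (MvPolynomial.pderiv .v₁ p) z
      - B.Bp 1 z * B.ev (MvPolynomial.pderiv .v₂ p) z
      - B.Bp 1 z * (B.Bp 1 z + xi z) * B.ev (MvPolynomial.pderiv .v₃ p) z := by
    rw [ha]
    filter_upwards [ev_sub (MvPolynomial.pderiv .v₁ p - MvPolynomial.X .u
      * MvPolynomial.pderiv .v₂ p) (MvPolynomial.X .u * (MvPolynomial.X .u
      + MvPolynomial.C xiRat) * MvPolynomial.pderiv .v₃ p),
      ev_sub (MvPolynomial.pderiv .v₁ p) (MvPolynomial.X .u * MvPolynomial.pderiv .v₂ p),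
      ev_mul (MvPolynomial.X .u) (MvPolynomial.pderiv .v₂ p),
      ev_mul (MvPolynomial.X .u * (MvPolynomial.X .u + MvPolynomial.C xiRat))
        (MvPolynomial.pderiv .v₃ p),
      ev_mul (MvPolynomial.X .u) (MvPolynomial.X .u + MvPolynomial.C xiRat),
      ev_add (MvPolynomial.X .u) (MvPolynomial.C xiRat), hxi] with z h1 h2 h3 h4 h5 h6 h7
    rw [h1, h2, h3, h4, h5, h6, h7, hX]
  have evc : ∀ᶠ z in B.generic, B.ev c z = B.ev (MvPolynomial.pderiv .m₁ p) z
      + B.Bp 1 z * B.ev (MvPolynomial.pderiv .m₂ p) z := by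
    rw [hc]
    filter_upwards [ev_add (MvPolynomial.pderiv .m₁ p)
      (MvPolynomial.X .u * MvPolynomial.pderiv .m₂ p),
      ev_mul (MvPolynomial.X .u) (MvPolynomial.pderiv .m₂ p)] with z h1 h2
    rw [h1, h2, hX]
  -- The coefficients of `∂A₁/∂z̄` and `∂B₁/∂z̄` come from `∂V₁/∂z̄ = ∂A₁/∂z̄ + 2 ∂B₁/∂z̄`.
  have key : ∀ᶠ z in B.generic, (dzbar (F g h) z = B.anomalyRHS F g h z ↔
      B.ev (a - w) z * dzbar (B.A 1) z
        + B.ev (MvPolynomial.pderiv .u p + 2 * (a - w)) z * dzbar (B.Bp 1) z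
        + B.ev (y - c) z * dzbar B.R₁ z = 0) := by
    filter_upwards [dzbar_ev hpos hG p, eventually_eventually_nhds hp, hy, hw, eva, evc,
      ev_sub a w, ev_sub y c, ev_add (MvPolynomial.pderiv .u p) (2 * (a - w)),
      ev_add (a - w) (a - w), eventually_mem] with z h1 h2 h3 h4 h5 h6 h7 h8 h9 h10 hz
    have hP := h1.congr h2
    have hE := (hasWirtinger_PFun hz hP.differentiableAt).dzbar_eq.symm.trans hP.dzbar_eq
    have hne := weight_ne_zero (B := B) ((g : ℤ) + h - 1) h 0 hz
    rw [amp_zero hgh, pow_zero, mul_one] at hE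
    rw [pow_zero, mul_one] at hne
    rw [← mul_right_inj' hne, hE, weight_mul_anomalyRHS hpos hG hz, h9, two_mul, h10, h8, h7, h6,
      h5, h4, h3, dzbar_V₁ hpos hG hz, ← sub_eq_zero]
    refine Eq.congr ?_ rfl
    ring
  rw [AnomalyEquation, generically_iff, Filter.eventually_congr key]
  constructor
  · intro hE
    obtain ⟨h1, h2, h3⟩ := hind (a - w) _ (y - c) ((generically_iff B).mpr hE)
    rw [h1, mul_zero, add_zero] at h2
    exact ⟨h2, sub_eq_zero.mp h1, (sub_eq_zero.mp h3).symm⟩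
  · rintro ⟨h1, h2, h3⟩
    rw [h1, h2, h3]
    refine .of_forall fun z => ?_
    rw [sub_self, sub_self, mul_zero, add_zero, ev_zero]
    ring

/-- If the lower `P^{(g',h')}` do not involve `u`, then `P_1^{(g,h-1)}` has degree at most one
in `u`. -/
theorem degLE_YFun (hgh : 2 < 2 * g + h)
    (hlow : ∀ g' h', 2 < 2 * g' + h' → g' ≤ g → h' ≤ h → (g', h') ≠ (g, h) →
      B.Rep uFree (B.PFun F g' h' 0)) : B.DegLE 1 (B.YFun F g h) := by
  by_cases hh : h = 0
  · exact (DegLE.of_rep (Rep.const 0)).congr (.of_forall fun z => if_pos hh)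
  · refine (DegLE.PFun_one hpos hG (g := g) (h := h - 1) (by omega) fun h2 =>
      hlow _ _ h2 le_rfl (Nat.sub_le _ _) fun e => ?_).congr (.of_forall fun z => if_neg hh)
    have := congrArg Prod.snd e
    simp only at this
    omega

/-- If the lower `P^{(g',h')}` do not involve `u`, then the right-hand side of the anomaly
equation has degree at most two in `u`. -/
theorem degLE_WFun (hgh : 2 < 2 * g + h)
    (hlow : ∀ g' h', 2 < 2 * g' + h' → g' ≤ g → h' ≤ h → (g', h') ≠ (g, h) →
      B.Rep uFree (B.PFun F g' h' 0)) : B.DegLE 2 (B.WFun F g h) := by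
  have hS : B.DegLE 2 fun z =>
      ∑ p ∈ splittings g h, B.PFun F p.1.1 p.2.1 1 z * B.PFun F p.1.2 p.2.2 1 z := by
    refine DegLE.sum _ fun p hp => ?_
    obtain ⟨⟨g₁, g₂⟩, ⟨h₁, h₂⟩⟩ := p
    simp only [splittings, Finset.mem_filter, Finset.mem_product, ne_eq, Prod.mk.injEq] at hp
    obtain ⟨⟨hg, hh⟩, hp⟩ := hp
    replace hg : g₁ + g₂ = g := Finset.HasAntidiagonal.mem_antidiagonal.mp hg
    replace hh : h₁ + h₂ = h := Finset.HasAntidiagonal.mem_antidiagonal.mp hh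
    refine DegLE.mul (m := 1) (n := 1) ?_ ?_
    · refine DegLE.PFun_one hpos hG (g := g₁) (h := h₁) (by omega)
        fun h2 => hlow _ _ h2 (by omega) (by omega) ?_
      simp only [ne_eq, Prod.mk.injEq]
      omega
    · refine DegLE.PFun_one hpos hG (g := g₂) (h := h₂) (by omega)
        fun h2 => hlow _ _ h2 (by omega) (by omega) ?_
      simp only [ne_eq, Prod.mk.injEq]
      omega
  have h2 : B.DegLE 2 fun z => if g = 0 then 0 else B.PFun F (g - 1) h 2 z := by
    by_cases hg : g = 0
    · exact (DegLE.of_rep (Rep.const 0)).congr (.of_forall fun z => if_pos hg)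
    · refine (DegLE.PFun_two hpos hG (g := g - 1) (h := h) (by omega) fun h2 =>
        hlow _ _ h2 (by omega) le_rfl ?_).congr (.of_forall fun z => if_neg hg)
      simp only [ne_eq, Prod.mk.injEq]
      omega
  have hY := degLE_YFun hpos hG hgh hlow
  have hQ : B.DegLE 1 fun z => B.Bp 1 z * B.Q 0 z - B.Q 1 z :=
    ⟨_, _, Rep.Q₁.neg, Rep.Q₀, .of_forall fun z => by ring⟩
  exact (DegLE.rep_mul (Rep.const (-(1 / 2))) (hS.add h2)).add (hQ.mul hY)

end

theorem DegLE.exists_one {f : ℂ → ℂ} (hf : B.DegLE 1 f) : ∃ a b : J,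
    MvPolynomial.pderiv .u a = 0 ∧ MvPolynomial.pderiv .u b = 0 ∧
    ∀ᶠ z in B.generic, B.ev (a + MvPolynomial.X .u * b) z = f z := by
  obtain ⟨a, b, ⟨a', ha, haf⟩, ⟨b', hb, hbf⟩, hab⟩ := hf
  refine ⟨a', b', mem_supported_uFree_iff.mp ha, mem_supported_uFree_iff.mp hb, ?_⟩
  filter_upwards [haf, hbf, hab, ev_add a' (MvPolynomial.X .u * b'), ev_mul (MvPolynomial.X .u) b']
    with z h1 h2 h3 h4 h5
  rw [h4, h5, h3, h1, h2, ev_X]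
  rfl

theorem DegLE.exists_two {f : ℂ → ℂ} (hf : B.DegLE 2 f) : ∃ a b c : J,
    MvPolynomial.pderiv .u a = 0 ∧ MvPolynomial.pderiv .u b = 0 ∧ MvPolynomial.pderiv .u c = 0 ∧
    ∀ᶠ z in B.generic,
      B.ev (a + MvPolynomial.X .u * b + MvPolynomial.X .u ^ 2 * c) z = f z := by
  obtain ⟨a, r, ⟨a', ha, haf⟩, hr, har⟩ := hf
  obtain ⟨b, c, hb, hc, hbc⟩ := hr.exists_one
  refine ⟨a', b, c, mem_supported_uFree_iff.mp ha, hb, hc, ?_⟩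
  have e : a' + MvPolynomial.X .u * b + MvPolynomial.X .u ^ 2 * c
      = a' + MvPolynomial.X .u * (b + MvPolynomial.X .u * c) := by ring
  rw [e]
  filter_upwards [haf, har, hbc, ev_add a' (MvPolynomial.X .u * (b + MvPolynomial.X .u * c)),
    ev_mul (MvPolynomial.X .u) (b + MvPolynomial.X .u * c)] with z h1 h2 h3 h4 h5
  rw [h4, h5, h3, h2, h1, ev_X]
  rfl

/-- By induction, the anomaly equations imply that the `P^{(g',h')}` do not involve `u`. -/
theorem rep_uFree_of_anomalyEquation (hpos : ∀ z ∈ B.U, 0 < B.hermNorm z)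
    (hG : ∀ z ∈ B.U, B.G z ≠ 0) (hind : B.Independent) (n : ℕ) :
    ∀ g h, g + h = n → 2 < 2 * g + h →
    (∀ g' h', 2 < 2 * g' + h' → g' ≤ g → h' ≤ h →
      B.Rep Set.univ (B.PFun F g' h' 0) ∧ B.AnomalyEquation F g' h') →
    B.Rep uFree (B.PFun F g h 0) := by
  induction n using Nat.strong_induction_on with
  | _ n ih =>
    intro g h hn hgh hP
    have hlow : ∀ g' h', 2 < 2 * g' + h' → g' ≤ g → h' ≤ h → (g', h') ≠ (g, h) →
        B.Rep uFree (B.PFun F g' h' 0) := by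
      intro g' h' h1 h2 h3 h4
      rw [ne_eq, Prod.mk.injEq] at h4
      exact ih (g' + h') (by omega) g' h' rfl h1 fun g'' h'' h5 h6 h7 =>
        hP g'' h'' h5 (h6.trans h2) (h7.trans h3)
    obtain ⟨y, -, hy⟩ := (degLE_YFun hpos hG hgh hlow).rep
    obtain ⟨w, -, hw⟩ := (degLE_WFun hpos hG hgh hlow).rep
    obtain ⟨⟨p, -, hp⟩, hE⟩ := hP g h hgh le_rfl le_rfl
    exact ⟨p, mem_supported_uFree_iff.mpr
      ((anomalyEquation_iff hpos hG hind hgh hp hy hw).mp hE).1, hp⟩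

/-- Under the independence hypothesis, the expansion in powers of `u` is unique. -/
theorem IsUExpansion.unique (hind : B.Independent) {Y Y' : Fin 2 → J} {W W' : Fin 3 → J}
    (h1 : B.IsUExpansion F g h Y W) (h2 : B.IsUExpansion F g h Y' W') : Y = Y' ∧ W = W' := by
  have hY := eq_of_ev hind (((generically_iff B).mp h1.Y_eq).mp
    (((generically_iff B).mp h2.Y_eq).mono fun z e e' => e'.trans e.symm))
  have hW := eq_of_ev hind (((generically_iff B).mp h1.W_eq).mp
    (((generically_iff B).mp h2.W_eq).mono fun z e e' => e'.trans e.symm))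
  have dY : ∀ i, MvPolynomial.pderiv Gen.u (Y i - Y' i) = 0 := fun i => by
    rw [map_sub, h1.Y_indep, h2.Y_indep, sub_self]
  have dW : ∀ i, MvPolynomial.pderiv Gen.u (W i - W' i) = 0 := fun i => by
    rw [map_sub, h1.W_indep, h2.W_indep, sub_self]
  obtain ⟨y0, y1, -⟩ := coeff_u_eq_zero (dY 0) (dY 1) (map_zero _) (by linear_combination hY)
  obtain ⟨w0, w1, w2⟩ := coeff_u_eq_zero (dW 0) (dW 1) (dW 2) (by linear_combination hW)
  constructor
  · funext i
    fin_cases i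
    exacts [sub_eq_zero.mp y0, sub_eq_zero.mp y1]
  · funext i
    fin_cases i
    exacts [sub_eq_zero.mp w0, sub_eq_zero.mp w1, sub_eq_zero.mp w2]

/-- Comparison of the coefficients of powers of `u` turns the condition of `anomalyEquation_iff`
into the system of partial differential equations. -/
theorem pdeSystem_iff {Y : Fin 2 → J} {W : Fin 3 → J} {p : J}
    (hY : ∀ i, MvPolynomial.pderiv Gen.u (Y i) = 0)
    (hW : ∀ i, MvPolynomial.pderiv Gen.u (W i) = 0) :
    PDESystem Y W p ↔ MvPolynomial.pderiv .u p = 0 ∧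
      MvPolynomial.pderiv .v₁ p - MvPolynomial.X .u * MvPolynomial.pderiv .v₂ p
        - MvPolynomial.X .u * (MvPolynomial.X .u + MvPolynomial.C xiRat)
          * MvPolynomial.pderiv .v₃ p
        = W 0 + MvPolynomial.X Gen.u * W 1 + MvPolynomial.X Gen.u ^ 2 * W 2 ∧
      MvPolynomial.pderiv .m₁ p + MvPolynomial.X .u * MvPolynomial.pderiv .m₂ p
        = Y 0 + MvPolynomial.X Gen.u * Y 1 := by
  constructor
  · rintro ⟨du, dm₁, dm₂, dv₁, dv₂, dv₃⟩
    refine ⟨du, ?_, by rw [dm₁, dm₂]⟩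
    rw [dv₁, dv₂, dv₃]
    ring
  · rintro ⟨du, e1, e2⟩
    have hp : ∀ i, MvPolynomial.pderiv Gen.u (MvPolynomial.pderiv i p) = 0 := fun i => by
      rw [pderiv_comm, du, map_zero]
    obtain ⟨a0, a1, a2⟩ := coeff_u_eq_zero (a := MvPolynomial.pderiv .v₁ p - W 0)
      (b := -MvPolynomial.pderiv .v₂ p - MvPolynomial.C xiRat * MvPolynomial.pderiv .v₃ p - W 1)
      (c := -MvPolynomial.pderiv .v₃ p - W 2)
      (by rw [map_sub, hp, hW, sub_self])
      (by rw [map_sub, map_sub, map_neg, MvPolynomial.pderiv_C_mul, hp, hp, hW]; simp)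
      (by rw [map_sub, map_neg, hp, hW]; simp) (by linear_combination e1)
    obtain ⟨c0, c1, -⟩ := coeff_u_eq_zero (a := MvPolynomial.pderiv .m₁ p - Y 0)
      (b := MvPolynomial.pderiv .m₂ p - Y 1) (c := 0)
      (by rw [map_sub, hp, hY, sub_self]) (by rw [map_sub, hp, hY, sub_self]) (map_zero _)
      (by linear_combination e2)
    exact ⟨du, sub_eq_zero.mp c0, sub_eq_zero.mp c1, sub_eq_zero.mp a0,
      by linear_combination -a1 + MvPolynomial.C xiRat * a2, by linear_combination -a2⟩

end Branch
end MirrorQuintic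

end

theorem mainTheorem1 (B : MirrorQuintic.Branch)
    (hpos : ∀ z ∈ B.U, 0 < B.hermNorm z) (hG : ∀ z ∈ B.U, B.G z ≠ 0)
    (hind : B.Independent)
    (F : ℕ → ℕ → ℂ → ℂ) (P : ℕ → ℕ → MirrorQuintic.J) (g h : ℕ) (hgh : 2 < 2 * g + h)
    (hP : ∀ g' h', 2 < 2 * g' + h' → g' ≤ g → h' ≤ h →
      B.Generically fun z => B.PFun F g' h' 0 z = B.ev (P g' h') z)
    (hlower : ∀ g' h', 2 < 2 * g' + h' → g' ≤ g → h' ≤ h → (g', h') ≠ (g, h) →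
      B.AnomalyEquation F g' h') :
    (∃! YW : (Fin 2 → MirrorQuintic.J) × (Fin 3 → MirrorQuintic.J),
      B.IsUExpansion F g h YW.1 YW.2) ∧
    ∀ (Y : Fin 2 → MirrorQuintic.J) (W : Fin 3 → MirrorQuintic.J), B.IsUExpansion F g h Y W →
      (B.AnomalyEquation F g h ↔ MirrorQuintic.PDESystem Y W (P g h)) := by
  have hgen := fun p : ℂ → Prop => B.generically_iff (p := p)
  -- The lower anomaly equations remove `u` from the lower amplitudes.
  have hlow : ∀ g' h', 2 < 2 * g' + h' → g' ≤ g → h' ≤ h → (g', h') ≠ (g, h) →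
      B.Rep MirrorQuintic.Branch.uFree (B.PFun F g' h' 0) := by
    intro g' h' h1 h2 h3 h4
    refine MirrorQuintic.Branch.rep_uFree_of_anomalyEquation hpos hG hind _ g' h' rfl h1 ?_
    intro g'' h'' h5 h6 h7
    refine ⟨⟨P g'' h'', by simp, (hgen _).mp (hP g'' h'' h5 (h6.trans h2) (h7.trans h3))⟩,
      hlower g'' h'' h5 (h6.trans h2) (h7.trans h3) ?_⟩
    rw [ne_eq, Prod.mk.injEq] at h4 ⊢
    omega
  constructor
  · obtain ⟨y₀, y₁, hy₀, hy₁, hy⟩ :=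
      (MirrorQuintic.Branch.degLE_YFun hpos hG hgh hlow).exists_one
    obtain ⟨w₀, w₁, w₂, hw₀, hw₁, hw₂, hw⟩ :=
      (MirrorQuintic.Branch.degLE_WFun hpos hG hgh hlow).exists_two
    have hE : B.IsUExpansion F g h ![y₀, y₁] ![w₀, w₁, w₂] := by
      refine ⟨fun i => ?_, fun i => ?_, (hgen _).mpr hy, (hgen _).mpr hw⟩
      · fin_cases i
        exacts [hy₀, hy₁]
      · fin_cases i
        exacts [hw₀, hw₁, hw₂]
    refine ⟨(_, _), hE, fun YW h' => ?_⟩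
    obtain ⟨e1, e2⟩ := h'.unique hind hE
    exact Prod.ext e1 e2
  · intro Y W hE
    rw [MirrorQuintic.Branch.pdeSystem_iff hE.Y_indep hE.W_indep]
    exact MirrorQuintic.Branch.anomalyEquation_iff hpos hG hind hgh
      ((hgen _).mp (hP g h hgh le_rfl le_rfl))
      (((hgen _).mp hE.Y_eq).mono fun z e => e.symm) (((hgen _).mp hE.W_eq).mono fun z e => e.symm)
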